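/- Let $(X,d,\mu)$ be a space of homogeneous type: $d:X\times X\to[0,\infty)$ is a quasi-metric ($d(x,y)=d(y,x)$; $d(x,y)=0$ iff $x=y$; $d(x,y)\le A_0[d(x,z)+d(z,y)]$ for some constant $A_0\ge 1$), and $\mu$ is a nonzero Borel measure for the topology in which $U$ is open iff every $x\in U$ has a ball $B(x,\tau)\subset U$, $\tau>0$, where $B(x,r)=\{y: d(x,y)<r\}$; all balls are $\mu$-measurable and $\mu(B(x,2r))\le C_\mu\,\mu(B(x,r))<\infty$ for all $x\in X$, $r>0$. Assume $\mu(X)=\infty$ and $\mu(\{x\})=0$ for every $x\in X$. Below, "locally integrable" means integrable on every ball, and suprema are taken over balls $B=B(z,r)$, $r>0$. Let $1<p<\infty$, $0<\kappa<1$, and let $\omega\in A_p(X)$, that is, $\omega\ge 0$ is locally integrable, not almost everywhere zero, and, with $p'=p/(p-1)$ and $0^{1-p'}=\infty$, $$[\omega]_{A_p}=\sup_B\Big(\frac1{\mu(B)}\int_B\omega\,d\mu\Big)\Big(\frac1{\mu(B)}\int_B\omega^{1-p'}\,d\mu\Big)^{p-1}<\infty .$$ Write $\omega(B)=\int_B\omega\,d\mu$,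 and let $L^{p,\kappa}_\omega(X)$ be the space of measurable $f$ with $$\|f\|_{L^{p,\kappa}_\omega(X)}=\sup_B\Big(\frac1{\omega(B)^\kappa}\int_B|f|^p\,\omega\,d\mu\Big)^{1/p}<\infty .$$ Let $b:X\to\mathbb R$ be locally integrable, and let $$C_bf(x)=\sup_{B\ni x}\frac1{\mu(B)}\int_B|b(x)-b(y)|\,|f(y)|\,d\mu(y).$$ Then $C_b$ is bounded on $L^{p,\kappa}_\omega(X)$, i.e. it maps this space into itself and there is a constant $C$ with $\|C_bf\|_{L^{p,\kappa}_\omega(X)}\le C\|f\|_{L^{p,\kappa}_\omega(X)}$ for all $f\in L^{p,\kappa}_\omega(X)$, if and only if $b\in BMO(X)$, i.e. $$\sup_B\frac1{\mu(B)}\int_B|b-b_B|\,d\mu<\infty,\qquad b_B=\frac1{\mu(B)}\int_Bb\,d\mu .$$ (If the balls are not all open, then $C_bf$ need not be measurable; in that case boundedness means the norm inequality only, with the integral of $|C_bf|^p\omega$ over $B$ read as an upper integral.) -/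

import Mathlib

open MeasureTheory
open scoped ENNReal NNReal

/-- A quasi-metric on a set `X`. -/
structure QuasiMetric (X : Type*) where
  /-- the quasi-distance -/
  d : X → X → ℝ
  nonneg : ∀ x y, 0 ≤ d x y
  symm : ∀ x y, d x y = d y x
  eq_zero_iff : ∀ x y, d x y = 0 ↔ x = y
  quasi_triangle : ∃ A₀ : ℝ, 1 ≤ A₀ ∧ ∀ x y z, d x y ≤ A₀ * (d x z + d z y)

namespace QuasiMetric

variable {X : Type*}

/-- The quasi-metric ball `B(x, r) = {y | d(x, y) < r}`. -/
def ball (Q : QuasiMetric X) (x : X) (r : ℝ) : Set X := {y | Q.d x y < r}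

/-- The topology induced by a quasi-metric: `U` is open iff every point of `U` is the centre of a
ball contained in `U`. (Balls need not be open.) -/
@[reducible] def topology (Q : QuasiMetric X) : TopologicalSpace X where
  IsOpen U := ∀ x ∈ U, ∃ τ : ℝ, 0 < τ ∧ Q.ball x τ ⊆ U
  isOpen_univ := fun _ _ => ⟨1, one_pos, Set.subset_univ _⟩
  isOpen_inter := by
    intro U V hU hV x hx
    obtain ⟨s, hs, hsU⟩ := hU x hx.1
    obtain ⟨t, ht, htV⟩ := hV x hx.2
    exact ⟨min s t, lt_min hs ht, fun y (hy : Q.d x y < min s t) =>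
      ⟨hsU (lt_of_lt_of_le hy (min_le_left _ _)), htV (lt_of_lt_of_le hy (min_le_right _ _))⟩⟩
  isOpen_sUnion := by
    intro S hS x hx
    obtain ⟨U, hU, hxU⟩ := hx
    obtain ⟨t, ht, htU⟩ := hS U hU x hxU
    exact ⟨t, ht, htU.trans (Set.subset_sUnion_of_mem hU)⟩

end QuasiMetric

/-- `(X, d, μ)` is a space of homogeneous type: `μ` is a nonzero Borel measure for the topology of
the quasi-metric `d`, all balls are measurable (for the completion of `μ`), and `μ` is doubling with
finite values on balls. -/
structure IsHomogeneousType {X : Type*} [m : MeasurableSpace X] (Q : QuasiMetric X)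
    (μ : Measure X) : Prop where
  borel : m = @borel X Q.topology
  nullMeasurableSet_ball : ∀ x r, NullMeasurableSet (Q.ball x r) μ
  ne_zero : μ ≠ 0
  measure_ball_lt_top : ∀ x r, 0 < r → μ (Q.ball x r) < ∞
  doubling : ∃ C : ℝ≥0, ∀ x r, 0 < r → μ (Q.ball x (2 * r)) ≤ C * μ (Q.ball x r)

/-- The upper integral of a function that need not be measurable. -/
noncomputable def upperLIntegral {X : Type*} [MeasurableSpace X] (ν : Measure X)
    (φ : X → ℝ≥0∞) : ℝ≥0∞ :=
  ⨅ (h : X → ℝ≥0∞) (_ : Measurable h) (_ : ∀ᵐ x ∂ν, φ x ≤ h x), ∫⁻ x, h x ∂ν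

/-- On measurable functions the upper integral is the usual integral. -/
theorem upperLIntegral_eq_lintegral {X : Type*} [MeasurableSpace X] (ν : Measure X)
    (φ : X → ℝ≥0∞) (hφ : AEMeasurable φ ν) : upperLIntegral ν φ = ∫⁻ x, φ x ∂ν := by
  apply le_antisymm
  · refine (iInf₂_le (hφ.mk φ) hφ.measurable_mk).trans ((iInf_le _ ?_).trans ?_)
    · exact hφ.ae_eq_mk.mono fun x hx => hx.le
    · exact (lintegral_congr_ae hφ.ae_eq_mk).ge
  · exact le_iInf₂ fun h _ => le_iInf fun hle => lintegral_mono_ae hle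

namespace QuasiMetric

variable {X : Type*} [MeasurableSpace X]

/-- Local integrability on a space of homogeneous type: integrability on every ball. -/
def LocallyIntegrableOnBalls (Q : QuasiMetric X) (μ : Measure X) (f : X → ℝ) : Prop :=
  ∀ x r, 0 < r → IntegrableOn f (Q.ball x r) μ

/-- The average `μ(B)⁻¹ ∫_B φ dμ` of a nonnegative function over `B = B(x, r)`. -/
noncomputable def laverageBall (Q : QuasiMetric X) (μ : Measure X) (φ : X → ℝ≥0∞)
    (x : X) (r : ℝ) : ℝ≥0∞ :=
  (μ (Q.ball x r))⁻¹ * ∫⁻ y in Q.ball x r, φ y ∂μ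

/-- The constant `[ω]_{A_p}`, `1 < p < ∞`, with `p' = p / (p - 1)`. A negative power of `0` is `∞`
here. -/
noncomputable def apConstant (Q : QuasiMetric X) (μ : Measure X) (p : ℝ) (ω : X → ℝ) : ℝ≥0∞ :=
  ⨆ (x : X) (r : ℝ) (_ : 0 < r),
    Q.laverageBall μ (fun y => ENNReal.ofReal (ω y)) x r *
      Q.laverageBall μ (fun y => ENNReal.ofReal (ω y) ^ (1 - p / (p - 1))) x r ^ (p - 1)

/-- `ω ∈ A_p(X)`: a nonnegative locally integrable function, not almost everywhere zero, with finite
`A_p` constant. (It is then positive almost everywhere.) -/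
structure IsApWeight (Q : QuasiMetric X) (μ : Measure X) (p : ℝ) (ω : X → ℝ) : Prop where
  nonneg : ∀ x, 0 ≤ ω x
  locallyIntegrable : Q.LocallyIntegrableOnBalls μ ω
  not_ae_zero : ¬ ∀ᵐ x ∂μ, ω x = 0
  apConstant_lt_top : Q.apConstant μ p ω < ∞

/-- The weighted Morrey norm `sup_B (ω(B)^{-κ} ∫_B g^p ω dμ)^{1/p}`. -/
noncomputable def morreyNorm (Q : QuasiMetric X) (μ : Measure X) (p κ : ℝ) (ω : X → ℝ)
    (g : X → ℝ≥0∞) : ℝ≥0∞ :=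
  ⨆ (x : X) (r : ℝ) (_ : 0 < r),
    (upperLIntegral (μ.restrict (Q.ball x r)) (fun y => g y ^ p * ENNReal.ofReal (ω y)) /
      (∫⁻ y in Q.ball x r, ENNReal.ofReal (ω y) ∂μ) ^ κ) ^ (1 / p)

/-- `f ∈ L^{p,κ}_ω(X)`. For a locally integrable weight, finiteness of the norm contains
`f ∈ L^p_loc(ω)`. -/
def MemMorrey (Q : QuasiMetric X) (μ : Measure X) (p κ : ℝ) (ω : X → ℝ) (f : X → ℝ) : Prop :=
  AEMeasurable f μ ∧ Q.morreyNorm μ p κ ω (fun x => ‖f x‖ₑ) < ∞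

/-- Boundedness on `L^{p,κ}_ω(X)` of an operator with nonnegative extended values. If the balls are
open, the images of elements of the space have to be measurable; if they are not, a supremum over
balls need not be measurable, and the norm of the image is understood through the upper integral. -/
def IsBoundedOnMorrey (Q : QuasiMetric X) (μ : Measure X) (p κ : ℝ) (ω : X → ℝ)
    (T : (X → ℝ) → X → ℝ≥0∞) : Prop :=
  ∃ C : ℝ≥0, ∀ f : X → ℝ, Q.MemMorrey μ p κ ω f →
    ((∀ x r, @IsOpen X Q.topology (Q.ball x r)) → AEMeasurable (T f) μ) ∧
      Q.morreyNorm μ p κ ω (T f) ≤ C * Q.morreyNorm μ p κ ω (fun x => ‖f x‖ₑ)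

/-- The maximal commutator `C_b f(x) = sup_{B ∋ x} μ(B)⁻¹ ∫_B |b(x) - b(y)| |f(y)| dμ(y)`. -/
noncomputable def maximalCommutator (Q : QuasiMetric X) (μ : Measure X) (b f : X → ℝ)
    (x : X) : ℝ≥0∞ :=
  ⨆ (z : X) (r : ℝ) (_ : 0 < r) (_ : x ∈ Q.ball z r),
    Q.laverageBall μ (fun y => ENNReal.ofReal (|b x - b y| * |f y|)) z r

/-- The `BMO` seminorm `sup_B μ(B)⁻¹ ∫_B |b - b_B| dμ`. -/
noncomputable def bmoNorm (Q : QuasiMetric X) (μ : Measure X) (b : X → ℝ) : ℝ≥0∞ :=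
  ⨆ (z : X) (r : ℝ) (_ : 0 < r),
    Q.laverageBall μ (fun x => ENNReal.ofReal |b x - ⨍ y in Q.ball z r, b y ∂μ|) z r

/-- `b ∈ BMO(X)`. -/
def MemBMO (Q : QuasiMetric X) (μ : Measure X) (b : X → ℝ) : Prop :=
  Q.LocallyIntegrableOnBalls μ b ∧ Q.bmoNorm μ b < ∞

end QuasiMetric

/-! Boundedness forces b into BMO by testing on the indicator of a ball B: on B the maximal
commutator of 1_B dominates |b - b_B|, so the Morrey bound gives ∫_B |b - b_B|^p ω ≤ A^p ω(B), and
Hölder together with the A_p condition turns this into a bound for the mean oscillation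
(`IsBoundedOnMorrey.memBMO`).

For the converse, apply |u| ≤ e^u + e^{-u} to u = t(b(x) - b(y)). With a = tb it shows that C_b f is
at most a constant times e^a M(e^{-a}|f|) + e^{-a} M(e^a|f|), where M is a maximal function
(`maximalCommutator_le`). Hence it is enough that M conjugated by e^{±a} is bounded on the Morrey
space for one small t > 0. Write ω = e^v and u = v + pa. Conjugation turns the L^p(e^v) bound into
Muckenhoupt's theorem for e^u, which settles the part of f near a given ball. For the distant part
the quotient of the e^u measure by the κ-th power of the e^v measure must not be larger on a ball
than on a bigger one, up to a constant. This holds because u is a convex combination of v and v +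
p/(1-κ) a, with coefficients κ and 1-κ: logarithmic convexity of v ↦ ∫ e^v bounds the quotient from
above, and the A_p conditions reverse that convexity inequality on the large ball
(`expMeasure_mul_rpow_le`). That small multiples of b may be added to v without leaving A_p is the
weighted John–Nirenberg inequality (`IsExpAp.exists_add_mul`).

Quasi-metric balls need not be open, so all of this is done on closed balls of a metric equivalent
to a power of d, where Vitali coverings and Lebesgue differentiation apply. A sequence of closed
balls represents all of them up to comparable measure, so the maximal function is measurable and the
commutator has a measurable majorant even when it is not measurable itself. -/

section

open Metric Set Filter Topology


/-! ### Doubling measures and Vitali coverings. -/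

/-- A measure on a pseudometric space which is positive, finite and doubling on closed balls. -/
structure IsDoublingOnBalls {X : Type*} [PseudoMetricSpace X] [MeasurableSpace X]
    (ν : Measure X) (C : ℝ≥0) : Prop where
  pos : ∀ x r, 0 < r → 0 < ν (closedBall x r)
  lt_top : ∀ x r, ν (closedBall x r) < ∞
  doubling : ∀ x r, 0 < r → ν (closedBall x (2 * r)) ≤ C * ν (closedBall x r)

namespace IsDoublingOnBalls

variable {X : Type*} [PseudoMetricSpace X] [MeasurableSpace X] {ν : Measure X} {C : ℝ≥0}

theorem measure_closedBall_two_pow_mul_le (h : IsDoublingOnBalls ν C) (x : X) {r : ℝ}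
    (hr : 0 < r) (n : ℕ) : ν (closedBall x (2 ^ n * r)) ≤ C ^ n * ν (closedBall x r) := by
  induction n with
  | zero => simp
  | succ n ih =>
    have := h.doubling x (2 ^ n * r) (by positivity)
    calc ν (closedBall x (2 ^ (n + 1) * r)) = ν (closedBall x (2 * (2 ^ n * r))) := by ring_nf
      _ ≤ C * ν (closedBall x (2 ^ n * r)) := this
      _ ≤ C * (C ^ n * ν (closedBall x r)) := by gcongr
      _ = C ^ (n + 1) * ν (closedBall x r) := by ring

theorem measure_closedBall_le (h : IsDoublingOnBalls ν C) {x y : X} {r s : ℝ} (hs : 0 < s) (n : ℕ)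
    (hrs : r + dist x y ≤ 2 ^ n * s) :
    ν (closedBall x r) ≤ C ^ n * ν (closedBall y s) :=
  (measure_mono (closedBall_subset_closedBall' hrs)).trans
    (h.measure_closedBall_two_pow_mul_le y hs n)

theorem isUnifLocDoublingMeasure (h : IsDoublingOnBalls ν C) : IsUnifLocDoublingMeasure ν :=
  ⟨C, by filter_upwards [self_mem_nhdsWithin] with ε hε x using h.doubling x ε hε⟩

theorem isLocallyFiniteMeasure (h : IsDoublingOnBalls ν C) : IsLocallyFiniteMeasure ν :=
  ⟨fun x => ⟨closedBall x 1, closedBall_mem_nhds x one_pos, h.lt_top x 1⟩⟩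

theorem sigmaFinite (h : IsDoublingOnBalls ν C) : SigmaFinite ν := by
  rcases isEmpty_or_nonempty X with hX | ⟨⟨x⟩⟩
  · rw [Measure.eq_zero_of_isEmpty ν]; infer_instance
  · exact ⟨⟨{ set := fun n => closedBall x n
              set_mem := fun _ => trivial
              finite := fun n => h.lt_top x n
              spanning := iUnion_closedBall_nat x }⟩⟩

/-- Disjoint balls of radius ε/4 all have positive measure, so by σ-finiteness they are countably
many. The centres of a Vitali subfamily of all such balls therefore form a countable ε-net. -/
theorem secondCountableTopology [OpensMeasurableSpace X] (h : IsDoublingOnBalls ν C) :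
    SecondCountableTopology X := by
  have := h.sigmaFinite
  refine secondCountable_of_almost_dense_set fun ε hε => ?_
  obtain ⟨u, -, hdisj, hcov⟩ := Vitali.exists_disjoint_subfamily_covering_enlargement_closedBall
    (univ : Set X) id (fun _ => ε / 4) (ε / 4) (fun _ _ => le_rfl) 4 (by norm_num)
  refine ⟨u, ?_, fun x => ?_⟩
  · have hc := Measure.countable_meas_pos_of_disjoint_iUnion (μ := ν)
      (As := fun a : u => closedBall (a : X) (ε / 4)) (fun _ => measurableSet_closedBall)
      (fun a b hab => hdisj a.2 b.2 (Subtype.coe_injective.ne hab))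
    have huniv : {a : u | 0 < ν (closedBall (a : X) (ε / 4))} = univ :=
      eq_univ_of_forall fun a => h.pos _ _ (by positivity)
    rw [huniv, countable_univ_iff] at hc
    exact hc
  · obtain ⟨b, hb, hsub⟩ := hcov x (mem_univ x)
    refine ⟨b, hb, ?_⟩
    have := hsub (mem_closedBall_self (by positivity))
    simpa [mul_div_cancel₀] using this

/-- Vitali covering: if `η` dominates the doubling measure `ν` on each ball of a family, then it
dominates it on their union, up to a constant. -/
theorem measure_biUnion_closedBall_le [OpensMeasurableSpace X] (h : IsDoublingOnBalls ν C)
    {ι : Type*} (t : Set ι) (x : ι → X) (r : ι → ℝ) (R : ℝ) (hr0 : ∀ i ∈ t, 0 < r i)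
    (hrR : ∀ i ∈ t, r i ≤ R) (η : Measure X)
    (hη : ∀ i ∈ t, ν (closedBall (x i) (r i)) ≤ η (closedBall (x i) (r i))) :
    ν (⋃ i ∈ t, closedBall (x i) (r i)) ≤ C ^ 3 * η univ := by
  have := h.secondCountableTopology
  obtain ⟨u, hut, hdisj, hcov⟩ := Vitali.exists_disjoint_subfamily_covering_enlargement_closedBall
    t x r R hrR 5 (by norm_num)
  have hu : u.Countable := hdisj.countable_of_nonempty_interior fun i hi =>
    ⟨x i, ball_subset_interior_closedBall (mem_ball_self (hr0 i (hut hi)))⟩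
  calc ν (⋃ i ∈ t, closedBall (x i) (r i))
      ≤ ν (⋃ i ∈ u, closedBall (x i) (5 * r i)) := by
        refine measure_mono (iUnion₂_subset fun i hi => ?_)
        obtain ⟨b, hb, hsub⟩ := hcov i hi
        exact hsub.trans (subset_biUnion_of_mem (u := fun i => closedBall (x i) (5 * r i)) hb)
    _ ≤ ∑' i : u, ν (closedBall (x i) (5 * r i)) := measure_biUnion_le ν hu _
    _ ≤ ∑' i : u, C ^ 3 * η (closedBall (x i) (r i)) := by
        refine ENNReal.tsum_le_tsum fun i => ?_
        have hi := hr0 i (hut i.2)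
        refine (h.measure_closedBall_le hi 3 ?_).trans (mul_le_mul' le_rfl (hη i (hut i.2)))
        rw [dist_self]; linarith
    _ = C ^ 3 * η (⋃ i ∈ u, closedBall (x i) (r i)) := by
        rw [ENNReal.tsum_mul_left, measure_biUnion hu hdisj fun _ _ => measurableSet_closedBall]
    _ ≤ C ^ 3 * η univ := by gcongr; exact subset_univ _

end IsDoublingOnBalls

/-! ### The maximal function on L^q of a doubling measure. -/

theorem ENNReal.setLIntegral_Ioi_rpow_indicator {s : ℝ} (hs : 0 < s) (a : ℝ≥0∞) :
    ∫⁻ t in Ioi (0 : ℝ), {t : ℝ | ENNReal.ofReal t < a}.indicator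
      (fun t => ENNReal.ofReal (t ^ (s - 1))) t = ENNReal.ofReal s⁻¹ * a ^ s := by
  have key : ∀ c : ℝ, 0 ≤ c → ∫⁻ t in Ioo (0 : ℝ) c, ENNReal.ofReal (t ^ (s - 1)) =
      ENNReal.ofReal s⁻¹ * ENNReal.ofReal c ^ s := by
    intro c hc
    rw [setLIntegral_congr (Ioo_ae_eq_Ioc (μ := volume)),
      ← ofReal_integral_eq_lintegral_ofReal]
    · rw [← intervalIntegral.integral_of_le hc, integral_rpow (Or.inl (by linarith)),
        sub_add_cancel, Real.zero_rpow hs.ne', sub_zero, div_eq_inv_mul,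
        ENNReal.ofReal_mul (by positivity), ENNReal.ofReal_rpow_of_nonneg hc hs.le]
    · exact (intervalIntegral.intervalIntegrable_rpow' (by linarith)).1
    · filter_upwards [ae_restrict_mem measurableSet_Ioc] with t ht
      exact Real.rpow_nonneg ht.1.le _
  induction a using ENNReal.recTopCoe with
  | coe c =>
    rw [lintegral_indicator (measurableSet_lt (by fun_prop) (by fun_prop)),
      Measure.restrict_restrict (measurableSet_lt (by fun_prop) (by fun_prop))]
    have : {t : ℝ | ENNReal.ofReal t < c} ∩ Ioi 0 = Ioo (0 : ℝ) c := by
      ext t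
      simp only [mem_inter_iff, mem_ofPred_eq, mem_Ioi, mem_Ioo]
      constructor
      · rintro ⟨h1, h2⟩
        refine ⟨h2, ?_⟩
        rw [← ENNReal.ofReal_coe_nnreal] at h1
        exact (ENNReal.ofReal_lt_ofReal_iff_of_nonneg h2.le).1 h1
      · rintro ⟨h1, h2⟩
        refine ⟨?_, h1⟩
        rw [← ENNReal.ofReal_coe_nnreal]
        exact (ENNReal.ofReal_lt_ofReal_iff_of_nonneg h1.le).2 h2
    rw [this, key c c.2, ENNReal.ofReal_coe_nnreal]
  | top =>
    rw [ENNReal.top_rpow_of_pos hs, ENNReal.mul_top (by simpa using hs)]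
    refine ENNReal.eq_top_of_forall_nnreal_le fun M => ?_
    -- The upper limit (sM)^{1/s} makes the truncated integral equal to M, so the full integral
    -- exceeds every finite M.
    have hM := key ((s * M) ^ s⁻¹) (by positivity)
    rw [ENNReal.ofReal_rpow_of_nonneg (by positivity) hs.le, ← Real.rpow_mul (by positivity),
      inv_mul_cancel₀ hs.ne', Real.rpow_one, ← ENNReal.ofReal_mul (by positivity),
      inv_mul_cancel_left₀ hs.ne', ENNReal.ofReal_coe_nnreal] at hM
    rw [← hM]
    simp only [ENNReal.ofReal_lt_top]
    rw [show {t : ℝ | True} = univ from rfl, indicator_univ]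
    exact lintegral_mono_set Ioo_subset_Ioi_self


/-- The uncentred maximal function over a sequence of closed balls. -/
noncomputable def ballMaximal {X : Type*} [PseudoMetricSpace X] [MeasurableSpace X]
    (ν : Measure X) (z : ℕ → X) (r : ℕ → ℝ) (g : X → ℝ≥0∞) (x : X) : ℝ≥0∞ :=
  ⨆ n, (closedBall (z n) (r n)).indicator
    (fun _ => (ν (closedBall (z n) (r n)))⁻¹ * ∫⁻ y in closedBall (z n) (r n), g y ∂ν) x

section

variable {X : Type*} [PseudoMetricSpace X] [MeasurableSpace X] {ν : Measure X} {C : ℝ≥0}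
  {z : ℕ → X} {r : ℕ → ℝ}

theorem le_ballMaximal (g : X → ℝ≥0∞) (n : ℕ) {x : X} (hx : x ∈ closedBall (z n) (r n)) :
    (ν (closedBall (z n) (r n)))⁻¹ * ∫⁻ y in closedBall (z n) (r n), g y ∂ν ≤
      ballMaximal ν z r g x := by
  refine le_trans ?_ (le_iSup _ n)
  rw [indicator_of_mem hx]

theorem ballMaximal_le {g : X → ℝ≥0∞} {x : X} {a : ℝ≥0∞}
    (h : ∀ n, x ∈ closedBall (z n) (r n) →
      (ν (closedBall (z n) (r n)))⁻¹ * ∫⁻ y in closedBall (z n) (r n), g y ∂ν ≤ a) :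
    ballMaximal ν z r g x ≤ a :=
  iSup_le fun n => indicator_apply_le' (h n) fun _ => zero_le

theorem ballMaximal_add_le (g₁ g₂ : X → ℝ≥0∞) (hg : Measurable g₁) (x : X) :
    ballMaximal ν z r (fun y => g₁ y + g₂ y) x ≤
      ballMaximal ν z r g₁ x + ballMaximal ν z r g₂ x := by
  refine ballMaximal_le fun n hn => ?_
  rw [lintegral_add_left hg, mul_add]
  exact add_le_add (le_ballMaximal g₁ n hn) (le_ballMaximal g₂ n hn)

variable [OpensMeasurableSpace X]

theorem measurable_ballMaximal (g : X → ℝ≥0∞) : Measurable (ballMaximal ν z r g) :=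
  Measurable.iSup fun _ => measurable_const.indicator measurableSet_closedBall

/-- On a ball where the average exceeds l, the part of g below l/2 accounts for at most half of it.
So ν(B) is at most 2/l times the integral over B of the part of g above l/2, and Vitali applies with
η the measure of that density. Keeping only the large part of g is what allows integration in l. -/
theorem IsDoublingOnBalls.measure_lt_ballMaximal_le (h : IsDoublingOnBalls ν C)
    (hr : ∀ n, 0 < r n) {g : X → ℝ≥0∞} (hg : Measurable g) {l : ℝ≥0∞} (hl0 : l ≠ 0)
    (hlt : l ≠ ∞) :
    ν {x | l < ballMaximal ν z r g x} ≤
      2 * C ^ 3 * (l⁻¹ * ∫⁻ x, {x | l / 2 < g x}.indicator g x ∂ν) := by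
  set S := {n | l < (ν (closedBall (z n) (r n)))⁻¹ * ∫⁻ y in closedBall (z n) (r n), g y ∂ν}
  -- Vitali needs bounded radii: only the balls of index below N are covered, uniformly in N, and
  -- then N increases.
  have hS : {x | l < ballMaximal ν z r g x} ⊆
      ⋃ N : ℕ, ⋃ n ∈ {n | n ∈ S ∧ n < N}, closedBall (z n) (r n) := by
    intro x hx
    obtain ⟨n, hn⟩ := lt_iSup_iff.1 (show l < ballMaximal ν z r g x from hx)
    by_cases hxn : x ∈ closedBall (z n) (r n)
    · rw [indicator_of_mem hxn] at hn
      exact mem_iUnion.2 ⟨n + 1, mem_biUnion (⟨hn, n.lt_succ_self⟩ : n ∈ {m | m ∈ S ∧ m < n + 1})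
        hxn⟩
    · rw [indicator_of_notMem hxn] at hn
      exact absurd hn (not_lt.2 zero_le)
  refine (measure_mono hS).trans ?_
  rw [Monotone.measure_iUnion]
  swap
  · intro N N' hN
    exact biUnion_subset_biUnion_left fun n hn => ⟨hn.1, hn.2.trans_le hN⟩
  refine iSup_le fun N => ?_
  set G := {x | l / 2 < g x}.indicator g
  have hG : Measurable G := hg.indicator (measurableSet_lt measurable_const hg)
  refine (h.measure_biUnion_closedBall_le _ z r (∑ n ∈ Finset.range N, r n) (fun n _ => hr n)
    (fun n hn => Finset.single_le_sum (fun i _ => (hr i).le) (Finset.mem_range.2 hn.2))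
    ((2 * l⁻¹) • ν.withDensity G) fun n hn => ?_).trans_eq ?_
  · have hν0 := (h.pos (z n) _ (hr n)).ne'
    have hνt := (h.lt_top (z n) (r n)).ne
    set B := closedBall (z n) (r n)
    have h1 : l * ν B ≤ ∫⁻ y in B, g y ∂ν := by
      have := mul_le_mul' hn.1.le (le_refl (ν B))
      rwa [mul_comm (ν B)⁻¹, mul_assoc, ENNReal.inv_mul_cancel hν0 hνt, mul_one] at this
    have h2 : ∫⁻ y in B, g y ∂ν ≤ ∫⁻ y in B, G y ∂ν + l / 2 * ν B := by
      rw [← setLIntegral_const, ← lintegral_add_left hG]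
      refine lintegral_mono fun y => ?_
      by_cases hy : l / 2 < g y
      · exact (le_of_eq (indicator_of_mem (s := {x | l / 2 < g x}) hy g).symm).trans le_self_add
      · exact (not_lt.1 hy).trans le_add_self
    have h3 : l / 2 * ν B ≤ ∫⁻ y in B, G y ∂ν := by
      have h4 : l / 2 * ν B + l / 2 * ν B ≤ ∫⁻ y in B, G y ∂ν + l / 2 * ν B := by
        rw [← add_mul, ENNReal.add_halves]; exact h1.trans h2
      exact (ENNReal.add_le_add_iff_right (ENNReal.mul_ne_top (ENNReal.div_ne_top hlt two_ne_zero)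
        hνt)).1 h4
    rw [Measure.smul_apply, smul_eq_mul, withDensity_apply _ measurableSet_closedBall]
    calc ν B = 2 * l⁻¹ * (l / 2 * ν B) := by
          rw [← mul_assoc, div_eq_mul_inv, show 2 * l⁻¹ * (l * 2⁻¹) = (2 * 2⁻¹) * (l * l⁻¹) by ring,
            ENNReal.mul_inv_cancel two_ne_zero ENNReal.ofNat_ne_top,
            ENNReal.mul_inv_cancel hl0 hlt, one_mul, one_mul]
      _ ≤ _ := by gcongr
  · rw [Measure.smul_apply, smul_eq_mul, withDensity_apply _ MeasurableSet.univ,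
      Measure.restrict_univ]
    ring

/-- The maximal function with respect to a doubling measure `ν` is bounded on `L^q(ν)`. -/
theorem IsDoublingOnBalls.lintegral_ballMaximal_rpow_le (h : IsDoublingOnBalls ν C)
    (hr : ∀ n, 0 < r n) {g : X → ℝ≥0∞} (hg : Measurable g) {q : ℝ} (hq : 1 < q) :
    ∫⁻ x, ballMaximal ν z r g x ^ q ∂ν ≤
      (2 * C ^ 3 * ENNReal.ofReal q * ENNReal.ofReal (q - 1)⁻¹ * 2 ^ (q - 1)) *
        ∫⁻ x, g x ^ q ∂ν := by
  have := h.sigmaFinite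
  have hq0 : 0 < q := by linarith
  have hq1 : 0 < q - 1 := by linarith
  set M := ballMaximal ν z r g
  have hM : Measurable M := measurable_ballMaximal g
  have hmeas : Measurable fun p : X × ℝ => {t : ℝ | ENNReal.ofReal t < M p.1}.indicator
      (fun t => ENNReal.ofReal (t ^ (q - 1))) p.2 := by
    have : (fun p : X × ℝ => {t : ℝ | ENNReal.ofReal t < M p.1}.indicator
      (fun t => ENNReal.ofReal (t ^ (q - 1))) p.2) = {p : X × ℝ | ENNReal.ofReal p.2 < M p.1}.indicator
      (fun p => ENNReal.ofReal (p.2 ^ (q - 1))) := rfl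
    rw [this]
    exact Measurable.indicator (by fun_prop) (measurableSet_lt (by fun_prop) (by fun_prop))
  have hmeas' : Measurable fun p : ℝ × X => {t : ℝ | ENNReal.ofReal t < 2 * g p.2}.indicator
      (fun t => ENNReal.ofReal (t ^ (q - 1 - 1))) p.1 := by
    have : (fun p : ℝ × X => {t : ℝ | ENNReal.ofReal t < 2 * g p.2}.indicator
      (fun t => ENNReal.ofReal (t ^ (q - 1 - 1))) p.1) =
      {p : ℝ × X | ENNReal.ofReal p.1 < 2 * g p.2}.indicator
      (fun p => ENNReal.ofReal (p.1 ^ (q - 1 - 1))) := rfl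
    rw [this]
    exact Measurable.indicator (by fun_prop) (measurableSet_lt (by fun_prop) (by fun_prop))
  have hqq : ENNReal.ofReal q * ENNReal.ofReal q⁻¹ = 1 := by
    rw [← ENNReal.ofReal_mul hq0.le, mul_inv_cancel₀ hq0.ne', ENNReal.ofReal_one]
  calc ∫⁻ x, M x ^ q ∂ν
      = ENNReal.ofReal q * ∫⁻ x, (∫⁻ t in Ioi (0 : ℝ), {t : ℝ | ENNReal.ofReal t < M x}.indicator
          (fun t => ENNReal.ofReal (t ^ (q - 1))) t) ∂ν := by
        simp_rw [ENNReal.setLIntegral_Ioi_rpow_indicator hq0]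
        rw [lintegral_const_mul _ (by fun_prop), ← mul_assoc, hqq, one_mul]
    _ = ENNReal.ofReal q * ∫⁻ t in Ioi (0 : ℝ),
          ENNReal.ofReal (t ^ (q - 1)) * ν {x | ENNReal.ofReal t < M x} := by
        rw [lintegral_lintegral_swap hmeas.aemeasurable]
        congr 1
        refine lintegral_congr fun t => ?_
        rw [← lintegral_indicator_const (measurableSet_lt measurable_const hM)]
        rfl
    -- The factor 1/t of the weak estimate lowers the power to t^{q-2}, still integrable at 0 since
    -- q > 1. After Tonelli the t-integral runs up to 2 g(x) and returns g^{q-1}.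
    _ ≤ ENNReal.ofReal q * ∫⁻ t in Ioi (0 : ℝ), (2 * C ^ 3 * ∫⁻ x, g x *
          {t : ℝ | ENNReal.ofReal t < 2 * g x}.indicator
            (fun t => ENNReal.ofReal (t ^ (q - 1 - 1))) t ∂ν) := by
        refine mul_le_mul' le_rfl (setLIntegral_mono' measurableSet_Ioi fun t ht => ?_)
        have ht : 0 < t := ht
        have hw := h.measure_lt_ballMaximal_le (z := z) hr hg (l := ENNReal.ofReal t)
          (by simpa using ht) ENNReal.ofReal_ne_top
        refine (mul_le_mul' le_rfl hw).trans_eq ?_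
        rw [mul_left_comm, ← mul_assoc (ENNReal.ofReal _), ← ENNReal.ofReal_inv_of_pos ht,
          ← ENNReal.ofReal_mul (by positivity), ← div_eq_mul_inv, ← Real.rpow_sub_one ht.ne',
          ← lintegral_const_mul' _ _ ENNReal.ofReal_ne_top]
        congr 1
        refine lintegral_congr fun x => ?_
        have hiff : ENNReal.ofReal t / 2 < g x ↔ ENNReal.ofReal t < 2 * g x := by
          rw [mul_comm, ENNReal.div_lt_iff (Or.inl two_ne_zero) (Or.inl ENNReal.ofNat_ne_top)]
        by_cases hx : ENNReal.ofReal t < 2 * g x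
        · rw [indicator_of_mem (s := {x | ENNReal.ofReal t / 2 < g x}) (hiff.2 hx),
            indicator_of_mem (s := {t : ℝ | ENNReal.ofReal t < 2 * g x}) hx, mul_comm]
        · rw [indicator_of_notMem (s := {x | ENNReal.ofReal t / 2 < g x}) (mt hiff.1 hx),
            indicator_of_notMem (s := {t : ℝ | ENNReal.ofReal t < 2 * g x}) hx, mul_zero, mul_zero]
    _ = ENNReal.ofReal q * (2 * C ^ 3) * ∫⁻ x, g x * (∫⁻ t in Ioi (0 : ℝ),
          {t : ℝ | ENNReal.ofReal t < 2 * g x}.indicator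
            (fun t => ENNReal.ofReal (t ^ (q - 1 - 1))) t) ∂ν := by
        rw [lintegral_const_mul', lintegral_lintegral_swap, ← mul_assoc]
        · congr 1
          refine lintegral_congr fun x => ?_
          exact lintegral_const_mul (g x) (hmeas'.comp (measurable_id.prodMk measurable_const))
        · exact ((hg.comp measurable_snd).mul hmeas').aemeasurable
        · exact ENNReal.mul_ne_top ENNReal.ofNat_ne_top (by simp)
    _ = (2 * C ^ 3 * ENNReal.ofReal q * ENNReal.ofReal (q - 1)⁻¹ * 2 ^ (q - 1)) *
        ∫⁻ x, g x ^ q ∂ν := by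
        simp_rw [ENNReal.setLIntegral_Ioi_rpow_indicator hq1]
        have hpt : ∀ x, g x * (ENNReal.ofReal (q - 1)⁻¹ * (2 * g x) ^ (q - 1)) =
            ENNReal.ofReal (q - 1)⁻¹ * 2 ^ (q - 1) * g x ^ q := by
          intro x
          have : g x ^ q = g x * g x ^ (q - 1) := by
            conv_lhs => rw [← add_sub_cancel 1 q, ENNReal.rpow_add_of_nonneg _ _ zero_le_one hq1.le,
              ENNReal.rpow_one]
          rw [ENNReal.mul_rpow_of_nonneg _ _ hq1.le, this]
          ring
        simp_rw [hpt]
        rw [lintegral_const_mul _ (by fun_prop)]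
        ring

theorem IsDoublingOnBalls.exists_lintegral_ballMaximal_rpow_le (h : IsDoublingOnBalls ν C)
    {q : ℝ} (hq : 1 < q) :
    ∃ A : ℝ≥0, ∀ (z : ℕ → X) (r : ℕ → ℝ), (∀ n, 0 < r n) → ∀ g : X → ℝ≥0∞, Measurable g →
      ∫⁻ x, ballMaximal ν z r g x ^ q ∂ν ≤ A * ∫⁻ x, g x ^ q ∂ν := by
  have h2 : (2 : ℝ≥0∞) ^ (q - 1) ≠ ∞ :=
    ENNReal.rpow_ne_top_of_nonneg (by linarith) ENNReal.ofNat_ne_top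
  lift 2 * (C : ℝ≥0∞) ^ 3 * ENNReal.ofReal q * ENNReal.ofReal (q - 1)⁻¹ * 2 ^ (q - 1) to ℝ≥0
    using by finiteness with A hA
  exact ⟨A, fun z r hr g hg => hA ▸ h.lintegral_ballMaximal_rpow_le hr hg hq⟩

end


/-! ### A_p weights in exponential form and Muckenhoupt's theorem. -/

/-- The positive function `exp v`, with extended nonnegative values. -/
noncomputable def expWeight {X : Type*} (v : X → ℝ) (x : X) : ℝ≥0∞ := ENNReal.ofReal (Real.exp (v x))

/-- The measure `exp v dμ`. -/
noncomputable def expMeasure {X : Type*} [MeasurableSpace X] (μ : Measure X) (v : X → ℝ) :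
    Measure X := μ.withDensity (expWeight v)

section

variable {X : Type*}

theorem expWeight_ne_zero (v : X → ℝ) (x : X) : expWeight v x ≠ 0 := by
  simp [expWeight, Real.exp_pos]

theorem expWeight_ne_top (v : X → ℝ) (x : X) : expWeight v x ≠ ∞ := ENNReal.ofReal_ne_top

theorem expWeight_rpow (v : X → ℝ) (s : ℝ) (x : X) :
    expWeight v x ^ s = expWeight (fun y => s * v y) x := by
  rw [expWeight, expWeight, ENNReal.ofReal_rpow_of_pos (Real.exp_pos _), ← Real.exp_mul, mul_comm]

theorem expWeight_mul (v u : X → ℝ) (x : X) :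
    expWeight v x * expWeight u x = expWeight (fun y => v y + u y) x := by
  rw [expWeight, expWeight, expWeight, Real.exp_add, ENNReal.ofReal_mul (Real.exp_pos _).le]

variable [MeasurableSpace X] {μ : Measure X} {v u : X → ℝ}

@[fun_prop]
theorem measurable_expWeight (hv : Measurable v) : Measurable (expWeight v) :=
  (Real.measurable_exp.comp hv).ennreal_ofReal

theorem lintegral_expMeasure (hv : Measurable v) {g : X → ℝ≥0∞} (hg : Measurable g) :
    ∫⁻ x, g x ∂(expMeasure μ v) = ∫⁻ x, expWeight v x * g x ∂μ :=
  lintegral_withDensity_eq_lintegral_mul μ (measurable_expWeight hv) hg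

theorem setLIntegral_expMeasure (hv : Measurable v) {g : X → ℝ≥0∞} (hg : Measurable g)
    {s : Set X} (hs : MeasurableSet s) :
    ∫⁻ x in s, g x ∂(expMeasure μ v) = ∫⁻ x in s, expWeight v x * g x ∂μ :=
  setLIntegral_withDensity_eq_setLIntegral_mul μ (measurable_expWeight hv) hg hs

theorem expMeasure_apply {s : Set X} (hs : MeasurableSet s) :
    expMeasure μ v s = ∫⁻ x in s, expWeight v x ∂μ := withDensity_apply _ hs

theorem expMeasure_absolutelyContinuous : expMeasure μ v ≪ μ :=
  withDensity_absolutelyContinuous _ _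

theorem absolutelyContinuous_expMeasure (hv : Measurable v) : μ ≪ expMeasure μ v :=
  withDensity_absolutelyContinuous' (measurable_expWeight hv).aemeasurable
    (ae_of_all _ (expWeight_ne_zero v))

/-- Logarithmic convexity of `v ↦ ∫ exp v`. -/
theorem expMeasure_convexComb_le (hv : Measurable v) (hu : Measurable u) {a b : ℝ} (ha : 0 ≤ a)
    (hb : 0 ≤ b) (hab : a + b = 1) {s : Set X} (hs : MeasurableSet s) :
    expMeasure μ (fun y => a * v y + b * u y) s ≤ expMeasure μ v s ^ a * expMeasure μ u s ^ b := by
  rw [expMeasure_apply hs, expMeasure_apply hs, expMeasure_apply hs]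
  simp_rw [← expWeight_mul, ← expWeight_rpow]
  exact ENNReal.lintegral_mul_norm_pow_le (by fun_prop) (by fun_prop) ha hb hab

/-- Hölder's inequality against the weight `exp v`. -/
theorem setLIntegral_rpow_le_expMeasure (hv : Measurable v) {p : ℝ} (hp : 1 < p) {g : X → ℝ≥0∞}
    (hg : Measurable g) {s : Set X} (hs : MeasurableSet s) :
    (∫⁻ x in s, g x ∂μ) ^ p ≤
      (∫⁻ x in s, g x ^ p ∂(expMeasure μ v)) *
        expMeasure μ (fun y => -v y / (p - 1)) s ^ (p - 1) := by
  have hp0 : 0 < p := by linarith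
  have hp1 : 0 < p - 1 := by linarith
  rw [setLIntegral_expMeasure hv (by fun_prop) hs, expMeasure_apply hs]
  -- Hölder for the factorisation g = (e^v g^p)^{1/p} (e^{-v/(p-1)})^{(p-1)/p}.
  have h := ENNReal.lintegral_mul_norm_pow_le (μ := μ.restrict s)
    (f := fun x => expWeight v x * g x ^ p) (g := expWeight fun y => -v y / (p - 1))
    (p := 1 / p) (q := (p - 1) / p) (by fun_prop) (by fun_prop) (by positivity) (by positivity)
    (by field_simp; ring)
  have heq : ∀ x, (expWeight v x * g x ^ p) ^ (1 / p) *
      (expWeight (fun y => -v y / (p - 1)) x) ^ ((p - 1) / p) = g x := by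
    intro x
    rw [ENNReal.mul_rpow_of_nonneg _ _ (by positivity), ← ENNReal.rpow_mul,
      mul_one_div_cancel hp0.ne', ENNReal.rpow_one, expWeight_rpow, expWeight_rpow,
      mul_right_comm, expWeight_mul]
    have : (1 / p * v x + (p - 1) / p * (-v x / (p - 1))) = 0 := by field_simp; ring
    rw [expWeight, this, Real.exp_zero, ENNReal.ofReal_one, one_mul]
  simp_rw [heq] at h
  calc _ ≤ _ := ENNReal.rpow_le_rpow h hp0.le
    _ = _ := by
      rw [ENNReal.mul_rpow_of_nonneg _ _ hp0.le, ← ENNReal.rpow_mul, ← ENNReal.rpow_mul,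
        one_div_mul_cancel hp0.ne', div_mul_cancel₀ _ hp0.ne', ENNReal.rpow_one]

theorem measure_rpow_le_expMeasure (hv : Measurable v) {p : ℝ} (hp : 1 < p)
    {s : Set X} (hs : MeasurableSet s) :
    μ s ^ p ≤ expMeasure μ v s * expMeasure μ (fun y => -v y / (p - 1)) s ^ (p - 1) := by
  simpa using setLIntegral_rpow_le_expMeasure (μ := μ) hv hp (g := fun _ => 1) measurable_const hs

end

/-- The weight `exp v` satisfies the `A_p` condition on closed balls with constant `K`. -/
structure IsExpAp {X : Type*} [PseudoMetricSpace X] [MeasurableSpace X] (μ : Measure X) (p : ℝ)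
    (K : ℝ≥0) (v : X → ℝ) : Prop where
  measurable : Measurable v
  le : ∀ x r, 0 < r → expMeasure μ v (closedBall x r) *
    expMeasure μ (fun y => -v y / (p - 1)) (closedBall x r) ^ (p - 1) ≤ K * μ (closedBall x r) ^ p

namespace IsExpAp

variable {X : Type*} [PseudoMetricSpace X] [MeasurableSpace X] {μ : Measure X} {C K : ℝ≥0} {p : ℝ}
  {v : X → ℝ}

theorem measurable_dual (hv : IsExpAp μ p K v) : Measurable fun y => -v y / (p - 1) :=
  hv.measurable.neg.div_const _

/-- Raise the A_p inequality to the power 1/(p-1) = p' - 1; taking the dual exponent twice returns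
v, so the two factors only change places. -/
theorem dual (hv : IsExpAp μ p K v) (hp : 1 < p) :
    IsExpAp μ (p / (p - 1)) (K ^ (1 / (p - 1))) fun y => -v y / (p - 1) where
  measurable := hv.measurable_dual
  le x r hr := by
    have hp1 : 0 < p - 1 := by linarith
    have e1 : p / (p - 1) - 1 = 1 / (p - 1) := by field_simp; ring
    have e2 : (fun y => -(-v y / (p - 1)) / (p / (p - 1) - 1)) = v := by
      ext y; rw [e1]; field_simp
    rw [e2, e1]
    have := ENNReal.rpow_le_rpow (hv.le x r hr) (z := 1 / (p - 1)) (by positivity)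
    rw [ENNReal.mul_rpow_of_nonneg _ _ (by positivity),
      ENNReal.mul_rpow_of_nonneg _ _ (by positivity), ← ENNReal.rpow_mul, ← ENNReal.rpow_mul,
      mul_one_div_cancel hp1.ne', ENNReal.rpow_one, mul_one_div] at this
    rw [mul_comm, ENNReal.coe_rpow_of_nonneg _ (by positivity)]
    exact this

variable (hv : IsExpAp μ p K v) (hμ : IsDoublingOnBalls μ C)
include hv hμ

theorem expMeasure_closedBall_pos (x : X) {r : ℝ} (hr : 0 < r) :
    0 < expMeasure μ v (closedBall x r) :=
  pos_iff_ne_zero.2 fun h => (hμ.pos x r hr).ne' (absolutelyContinuous_expMeasure hv.measurable h)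

theorem expMeasure_dual_closedBall_pos (x : X) {r : ℝ} (hr : 0 < r) :
    0 < expMeasure μ (fun y => -v y / (p - 1)) (closedBall x r) :=
  pos_iff_ne_zero.2 fun h =>
    (hμ.pos x r hr).ne' (absolutelyContinuous_expMeasure hv.measurable_dual h)

theorem expMeasure_closedBall_lt_top (hp : 1 < p) (x : X) (r : ℝ) :
    expMeasure μ v (closedBall x r) < ∞ := by
  suffices h : ∀ r, 0 < r → expMeasure μ v (closedBall x r) < ∞ from
    (measure_mono (closedBall_subset_closedBall (le_max_left r 1))).trans_lt
      (h _ (lt_max_of_lt_right one_pos))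
  intro r hr
  refine ENNReal.lt_top_of_mul_ne_top_left (ne_top_of_le_ne_top ?_ (hv.le x r hr)) ?_
  · exact ENNReal.mul_ne_top ENNReal.coe_ne_top
      (ENNReal.rpow_ne_top_of_nonneg (by linarith) (hμ.lt_top x r).ne)
  · exact (ENNReal.rpow_pos_of_nonneg (hv.expMeasure_dual_closedBall_pos hμ x hr)
      (by linarith)).ne'

-- Hölder bounds μ(s)^p by the weight of s times a power of the dual weight of s. The latter is at
-- most that of the ball, where A_p trades it for the weight of the ball.
omit hμ in
theorem measure_rpow_mul_le (hp : 1 < p) {s : Set X} (hs : MeasurableSet s) {x : X} {r : ℝ}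
    (hr : 0 < r) (hsub : s ⊆ closedBall x r) :
    μ s ^ p * expMeasure μ v (closedBall x r) ≤
      K * expMeasure μ v s * μ (closedBall x r) ^ p := by
  calc μ s ^ p * expMeasure μ v (closedBall x r)
      ≤ (expMeasure μ v s * expMeasure μ (fun y => -v y / (p - 1)) s ^ (p - 1)) *
          expMeasure μ v (closedBall x r) := by
        gcongr; exact measure_rpow_le_expMeasure hv.measurable hp hs
    _ ≤ (expMeasure μ v s * expMeasure μ (fun y => -v y / (p - 1)) (closedBall x r) ^ (p - 1)) *
          expMeasure μ v (closedBall x r) := by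
        gcongr
    _ = expMeasure μ v s * (expMeasure μ v (closedBall x r) *
          expMeasure μ (fun y => -v y / (p - 1)) (closedBall x r) ^ (p - 1)) := by ring
    _ ≤ expMeasure μ v s * (K * μ (closedBall x r) ^ p) := mul_le_mul' le_rfl (hv.le x r hr)
    _ = _ := by ring

theorem expMeasure_closedBall_le (hp : 1 < p) {s : Set X} (hs : MeasurableSet s) {x : X} {r : ℝ}
    (hr : 0 < r) (hsub : s ⊆ closedBall x r) {a : ℝ≥0} (ha : μ (closedBall x r) ≤ a * μ s) :
    expMeasure μ v (closedBall x r) ≤ (K * a ^ p : ℝ≥0) * expMeasure μ v s := by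
  have hp0 : 0 ≤ p := by linarith
  have h0 : μ s ^ p ≠ 0 := by
    refine (ENNReal.rpow_pos_of_nonneg (pos_iff_ne_zero.2 fun h => ?_) hp0).ne'
    rw [h, mul_zero] at ha
    exact (hμ.pos x r hr).not_ge ha
  have ht : μ s ^ p ≠ ∞ := ENNReal.rpow_ne_top_of_nonneg hp0
    ((measure_mono hsub).trans_lt (hμ.lt_top x r)).ne
  rw [← ENNReal.mul_le_mul_iff_right h0 ht]
  calc _ ≤ _ := hv.measure_rpow_mul_le hp hs hr hsub
    _ ≤ K * expMeasure μ v s * (a * μ s) ^ p := by gcongr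
    _ = _ := by
      rw [ENNReal.mul_rpow_of_nonneg _ _ hp0, ENNReal.coe_mul, ENNReal.coe_rpow_of_nonneg _ hp0]
      ring

variable [OpensMeasurableSpace X]

theorem isDoublingOnBalls (hp : 1 < p) :
    IsDoublingOnBalls (expMeasure μ v) (K * C ^ p) where
  pos x _ hr := hv.expMeasure_closedBall_pos hμ x hr
  lt_top := hv.expMeasure_closedBall_lt_top hμ hp
  doubling x r hr := hv.expMeasure_closedBall_le hμ hp measurableSet_closedBall (by positivity)
    (closedBall_subset_closedBall (by linarith)) (hμ.doubling x r hr)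

/-- Muckenhoupt's theorem: the maximal function is bounded on `L^p` of an `A_p` weight. -/
theorem exists_lintegral_ballMaximal_rpow_le (hp : 1 < p) :
    ∃ A : ℝ≥0, ∀ (z : ℕ → X) (r : ℕ → ℝ), (∀ n, 0 < r n) → ∀ g : X → ℝ≥0∞, Measurable g →
      ∫⁻ x, ballMaximal μ z r g x ^ p ∂(expMeasure μ v) ≤
        A * ∫⁻ x, g x ^ p ∂(expMeasure μ v) := by
  have hp0 : 0 < p := by linarith
  have hp1 : 0 < p - 1 := by linarith
  set q := p / (p - 1) with hq
  have hq1 : 1 < q := by rw [hq, lt_div_iff₀ hp1]; linarith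
  have hpq : (p - 1) * q = p := by rw [hq]; field_simp
  set σ := fun y => -v y / (p - 1) with hσdef
  have hσ : IsExpAp μ q _ σ := hv.dual hp
  have dv := hv.isDoublingOnBalls hμ hp
  have dσ := hσ.isDoublingOnBalls hμ hq1
  obtain ⟨A, hA⟩ := dv.exists_lintegral_ballMaximal_rpow_le hq1
  obtain ⟨A', hA'⟩ := dσ.exists_lintegral_ballMaximal_rpow_le hp
  refine ⟨K ^ q * (A * A'), fun z r hr g hg => ?_⟩
  rw [ENNReal.coe_mul, ENNReal.coe_mul, ENNReal.coe_rpow_of_nonneg _ (by linarith)]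
  -- Lerner's argument: M is controlled by two maximal functions, one for the measure e^σ and one
  -- for e^v. Both measures are doubling, so only the unweighted theory is needed.
  set G := ballMaximal (expMeasure μ σ) z r fun x => expWeight (fun y => -σ y) x * g x with hG
  have hGm : Measurable G := measurable_ballMaximal _
  have hvm := hv.measurable
  have hσm : Measurable σ := hv.measurable_dual
  set H := fun x => expWeight (fun y => -v y) x * G x ^ (p - 1) with hH
  have hHm : Measurable H := by fun_prop
  have cancel : ∀ (u : X → ℝ) (x : X) (a : ℝ≥0∞),
      expWeight u x * (expWeight (fun y => -u y) x * a) = a := by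
    intro u x a
    rw [← mul_assoc, expWeight_mul]; simp [expWeight]
  -- The μ-average of g is the e^σ-average of e^{-σ} g times σ(B)/μ(B). The first factor is at most
  -- G everywhere on B; A_p bounds the (p-1)-th power of the second by K μ(B)/v(B). Together they
  -- give K times an e^v-average of H.
  have key : ∀ x, ballMaximal μ z r g x ^ (p - 1) ≤ K * ballMaximal (expMeasure μ v) z r H x := by
    intro x
    rw [← ENNReal.le_rpow_inv_iff hp1]
    refine ballMaximal_le fun n hn => ?_
    rw [ENNReal.le_rpow_inv_iff hp1]
    refine le_trans ?_ (mul_le_mul' le_rfl (le_ballMaximal (ν := expMeasure μ v) H n hn))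
    have hB := measurableSet_closedBall (x := z n) (ε := r n)
    have m0 := (hμ.pos _ _ (hr n) : 0 < μ (closedBall (z n) (r n))).ne'
    have mt := (hμ.lt_top (z n) (r n)).ne
    have v0 := (dv.pos (z n) _ (hr n)).ne'
    have vt := (dv.lt_top (z n) (r n)).ne
    have s0 := (dσ.pos (z n) _ (hr n)).ne'
    have st := (dσ.lt_top (z n) (r n)).ne
    have hK := hv.le (z n) _ (hr n)
    have hGle : ∀ y ∈ closedBall (z n) (r n), (expMeasure μ σ (closedBall (z n) (r n)))⁻¹ *
        ∫⁻ y in closedBall (z n) (r n), g y ∂μ ≤ G y := by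
      intro y hy
      refine le_trans (le_of_eq ?_) (le_ballMaximal (ν := expMeasure μ σ) _ n hy)
      rw [setLIntegral_expMeasure hσm (by fun_prop) hB]
      simp_rw [cancel]
    set B := closedBall (z n) (r n)
    set I := ∫⁻ y in B, g y ∂μ
    have h1 : ((expMeasure μ σ B)⁻¹ * I) ^ (p - 1) * μ B ≤ ∫⁻ y in B, H y ∂(expMeasure μ v) := by
      rw [setLIntegral_expMeasure hvm hHm hB, ← setLIntegral_const]
      refine setLIntegral_mono' hB fun y hy => ?_
      simp_rw [hH, cancel]
      exact ENNReal.rpow_le_rpow (hGle y hy) hp1.le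
    have h2 : (μ B)⁻¹ * I = ((expMeasure μ σ B)⁻¹ * I) * (expMeasure μ σ B * (μ B)⁻¹) := by
      rw [mul_right_comm, ← mul_assoc, ENNReal.inv_mul_cancel s0 st, one_mul, mul_comm]
    have h3 : (expMeasure μ σ B * (μ B)⁻¹) ^ (p - 1) ≤ K * μ B * (expMeasure μ v B)⁻¹ := by
      rw [← div_eq_mul_inv (K * μ B : ℝ≥0∞), ENNReal.le_div_iff_mul_le (Or.inl v0) (Or.inl vt),
        ENNReal.mul_rpow_of_nonneg _ _ hp1.le]
      calc _ = (expMeasure μ v B * expMeasure μ σ B ^ (p - 1)) * (μ B)⁻¹ ^ (p - 1) := by ring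
        _ ≤ (K * μ B ^ p) * (μ B)⁻¹ ^ (p - 1) := by gcongr
        _ = K * μ B := by
          rw [ENNReal.inv_rpow, mul_assoc, ← ENNReal.rpow_neg, ← ENNReal.rpow_add _ _ m0 mt]
          simp
    calc ((μ B)⁻¹ * I) ^ (p - 1)
        = ((expMeasure μ σ B)⁻¹ * I) ^ (p - 1) * (expMeasure μ σ B * (μ B)⁻¹) ^ (p - 1) := by
          rw [h2, ENNReal.mul_rpow_of_nonneg _ _ hp1.le]
      _ ≤ ((expMeasure μ σ B)⁻¹ * I) ^ (p - 1) * (K * μ B * (expMeasure μ v B)⁻¹) := by gcongr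
      _ = K * ((expMeasure μ v B)⁻¹ * (((expMeasure μ σ B)⁻¹ * I) ^ (p - 1) * μ B)) := by ring
      _ ≤ _ := by gcongr
  calc ∫⁻ x, ballMaximal μ z r g x ^ p ∂(expMeasure μ v)
      ≤ ∫⁻ x, (K : ℝ≥0∞) ^ q * ballMaximal (expMeasure μ v) z r H x ^ q ∂(expMeasure μ v) := by
        refine lintegral_mono fun x => ?_
        rw [← ENNReal.mul_rpow_of_nonneg _ _ (by linarith), ← hpq, ENNReal.rpow_mul]
        exact ENNReal.rpow_le_rpow (key x) (by linarith)
    _ = K ^ q * ∫⁻ x, ballMaximal (expMeasure μ v) z r H x ^ q ∂(expMeasure μ v) :=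
        lintegral_const_mul _ ((measurable_ballMaximal _).pow_const _)
    _ ≤ K ^ q * (A * ∫⁻ x, H x ^ q ∂(expMeasure μ v)) := by
        gcongr; exact hA z r hr H hHm
    -- Here v - qv = σ because q - 1 = 1/(p-1). In the last change of density, σ - pσ = v.
    _ = K ^ q * (A * ∫⁻ x, G x ^ p ∂(expMeasure μ σ)) := by
        rw [lintegral_expMeasure hvm (by fun_prop), lintegral_expMeasure hσm (by fun_prop)]
        congr 3
        ext x
        rw [hH, ENNReal.mul_rpow_of_nonneg _ _ (by linarith), ← ENNReal.rpow_mul, hpq,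
          expWeight_rpow, ← mul_assoc, expWeight_mul]
        congr 2
        ext y
        simp only [hσdef, hq]
        field_simp
        ring
    _ ≤ K ^ q * (A * (A' * ∫⁻ x, (expWeight (fun y => -σ y) x * g x) ^ p ∂(expMeasure μ σ))) := by
        gcongr; exact hA' z r hr _ (by fun_prop)
    _ = K ^ q * (A * (A' * ∫⁻ x, g x ^ p ∂(expMeasure μ v))) := by
        rw [lintegral_expMeasure hσm (by fun_prop), lintegral_expMeasure hvm (by fun_prop)]
        congr 5
        ext x
        rw [ENNReal.mul_rpow_of_nonneg _ _ hp0.le, expWeight_rpow, ← mul_assoc, expWeight_mul]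
        congr 2
        ext y
        simp only [hσdef]
        field_simp
        ring
    _ = _ := by ring

end IsExpAp


/-! ### A weighted John–Nirenberg inequality. -/

section

variable {X : Type*} [PseudoMetricSpace X] [MeasurableSpace X] {μ ν : Measure X} {A C D : ℝ≥0}

theorem IsDoublingOnBalls.one_le (h : IsDoublingOnBalls ν C) (x : X) : 1 ≤ C := by
  have h1 : ν (closedBall x 1) ≤ C * ν (closedBall x 1) :=
    (measure_mono (closedBall_subset_closedBall (by norm_num))).trans (h.doubling x 1 one_pos)
  by_contra! hC
  have h2 := ENNReal.mul_lt_mul_left (h.pos x 1 one_pos).ne' (h.lt_top x 1).ne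
    (show (C : ℝ≥0∞) < 1 by exact_mod_cast hC)
  rw [one_mul] at h2
  exact h2.not_ge h1

/-- The covering bound applied to η = A ν restricted to G. It turns a density estimate around almost
every point of F into a global comparison of F with G. -/
theorem IsDoublingOnBalls.measure_le_of_forall_exists_closedBall [OpensMeasurableSpace X]
    (h : IsDoublingOnBalls ν D) {F G : Set X} (R : ℝ)
    (hFG : ∀ᵐ y ∂ν, y ∈ F → ∃ s, 0 < s ∧ s ≤ R ∧
      ν (closedBall y s) ≤ A * ν (closedBall y s ∩ G)) :
    ν F ≤ D ^ 3 * A * ν G := by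
  classical
  set F' := {y | y ∈ F ∧ ∃ s, 0 < s ∧ s ≤ R ∧ ν (closedBall y s) ≤ A * ν (closedBall y s ∩ G)}
  have hF : F ≤ᵐ[ν] F' := by
    filter_upwards [hFG] with y hy hyF using ⟨hyF, hy hyF⟩
  choose! s hs0 hsR hs using fun y (hy : y ∈ F') => hy.2
  calc ν F ≤ ν F' := measure_mono_ae hF
    _ ≤ ν (⋃ y ∈ F', closedBall y (s y)) :=
        measure_mono fun y hy => mem_biUnion hy (mem_closedBall_self (hs0 y hy).le)
    _ ≤ D ^ 3 * ((A : ℝ≥0∞) • ν.restrict G) univ := by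
        refine h.measure_biUnion_closedBall_le F' id s R hs0 hsR _ fun y hy => ?_
        rw [Measure.smul_apply, smul_eq_mul, Measure.restrict_apply measurableSet_closedBall]
        exact hs y hy
    _ = D ^ 3 * A * ν G := by
        rw [Measure.smul_apply, smul_eq_mul, Measure.restrict_apply_univ, mul_assoc]

/-- Around almost every point of a set of small density in a ball there is a smaller concentric
ball in which the density is small, but bounded from below. -/
theorem IsDoublingOnBalls.ae_exists_density_between [BorelSpace X] (h : IsDoublingOnBalls μ C)
    {F : Set X} (hF : MeasurableSet F) :
    ∀ᵐ y ∂μ, y ∈ F → ∀ ρ, 0 < ρ → 4 * C * μ (F ∩ closedBall y ρ) ≤ μ (closedBall y ρ) →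
      ∃ s, 0 < s ∧ s ≤ ρ ∧ 4 * μ (F ∩ closedBall y s) ≤ μ (closedBall y s) ∧
        μ (closedBall y s) < 4 * C * μ (F ∩ closedBall y s) := by
  have := h.secondCountableTopology
  have := h.isUnifLocDoublingMeasure
  have := h.isLocallyFiniteMeasure
  have hd := IsUnifLocDoublingMeasure.ae_tendsto_measure_inter_div μ F 1
  rw [ae_restrict_iff' hF] at hd
  filter_upwards [hd] with y hy hyF ρ hρ hsmall
  have hpow : ∀ j : ℕ, 0 < ρ * (1 / 2) ^ j := fun j => by positivity
  have hlim : Tendsto (fun j : ℕ => ρ * (1 / 2) ^ j) atTop (𝓝[>] 0) := by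
    rw [tendsto_nhdsWithin_iff]
    refine ⟨?_, Eventually.of_forall hpow⟩
    simpa using (tendsto_pow_atTop_nhds_zero_of_lt_one (by norm_num)
      (by norm_num : (1 / 2 : ℝ) < 1)).const_mul ρ
  have ht := hy hyF (fun _ => y) _ hlim
    (Eventually.of_forall fun j => mem_closedBall_self (by rw [one_mul]; exact (hpow j).le))
  have hex : ∃ j : ℕ, μ (closedBall y (ρ * (1 / 2) ^ j)) <
      4 * C * μ (F ∩ closedBall y (ρ * (1 / 2) ^ j)) := by
    have h4 : (4 : ℝ≥0∞)⁻¹ < 1 := by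
      rw [ENNReal.inv_lt_one]; norm_num
    obtain ⟨j, hj⟩ := (ht.eventually (lt_mem_nhds h4)).exists
    refine ⟨j, ?_⟩
    have hC : (1 : ℝ≥0∞) ≤ C := by exact_mod_cast h.one_le y
    rw [ENNReal.lt_div_iff_mul_lt (Or.inl (h.pos y _ (hpow j)).ne') (Or.inl (h.lt_top y _).ne)] at hj
    have h5 : μ (closedBall y (ρ * (1 / 2) ^ j)) <
        4 * μ (F ∩ closedBall y (ρ * (1 / 2) ^ j)) := by
      have := ENNReal.mul_lt_mul_right (a := 4) (by norm_num) ENNReal.ofNat_ne_top hj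
      rwa [← mul_assoc, ENNReal.mul_inv_cancel (by norm_num) ENNReal.ofNat_ne_top, one_mul] at this
    refine h5.trans_le ?_
    rw [mul_assoc]
    gcongr
    exact le_mul_of_one_le_left' hC
  classical
  -- Stopping time: the first halving at which the density of F exceeds 1/(4C). Lebesgue
  -- differentiation provides one, and j = 0 is excluded by the hypothesis on ρ. Since the previous
  -- ball failed, doubling keeps the density at j at most 1/4.
  set j := Nat.find hex with hj
  have hjs := Nat.find_spec hex
  rw [← hj] at hjs
  refine ⟨ρ * (1 / 2) ^ j, hpow j, mul_le_of_le_one_right hρ.le (pow_le_one₀ (by norm_num)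
    (by norm_num)), ?_, hjs⟩
  obtain ⟨i, hi⟩ : ∃ i, j = i + 1 := by
    refine Nat.exists_eq_succ_of_ne_zero fun h0 => ?_
    rw [h0, pow_zero, mul_one] at hjs
    exact hjs.not_ge hsmall
  have hmin := not_lt.1 (Nat.find_min hex (show i < Nat.find hex by omega))
  have hrad : 2 * (ρ * (1 / 2) ^ j) = ρ * (1 / 2) ^ i := by rw [hi]; ring
  have hdb := h.doubling y _ (hpow j)
  rw [hrad] at hdb
  have hC0 : (C : ℝ≥0∞) ≠ 0 := by
    have := (zero_lt_one.trans_le (h.one_le y)).ne'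
    exact_mod_cast this
  rw [← ENNReal.mul_le_mul_iff_right hC0 ENNReal.coe_ne_top]
  calc C * (4 * μ (F ∩ closedBall y (ρ * (1 / 2) ^ j)))
      ≤ C * (4 * μ (F ∩ closedBall y (ρ * (1 / 2) ^ i))) := by
        gcongr 3
        refine inter_subset_inter_right _ (closedBall_subset_closedBall ?_)
        rw [← hrad]; linarith [hpow j]
    _ = 4 * C * μ (F ∩ closedBall y (ρ * (1 / 2) ^ i)) := by ring
    _ ≤ _ := hmin.trans hdb

end

/-- The constants `m x r` approximate `b` on closed balls, with mean oscillation at most `1`. -/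
def HasUnitMeanOscillation {X : Type*} [PseudoMetricSpace X] [MeasurableSpace X] (μ : Measure X)
    (b : X → ℝ) (m : X → ℝ → ℝ) : Prop :=
  ∀ x r, 0 < r → ∫⁻ y in closedBall x r, ENNReal.ofReal |b y - m x r| ∂μ ≤ μ (closedBall x r)

namespace HasUnitMeanOscillation

variable {X : Type*} [PseudoMetricSpace X] [MeasurableSpace X] {μ ν : Measure X} {A C D : ℝ≥0}
  {b : X → ℝ} {m : X → ℝ → ℝ}

theorem mul_measure_le (hosc : HasUnitMeanOscillation μ b m) (hb : Measurable b) (x : X) {r : ℝ}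
    (hr : 0 < r) (T : ℝ≥0) {s : Set X} (hs : s ⊆ closedBall x r) (hT : ∀ y ∈ s, T ≤ |b y - m x r|) :
    T * μ s ≤ μ (closedBall x r) := by
  calc T * μ s = T * μ.restrict (closedBall x r) s := by
        rw [Measure.restrict_eq_self _ hs]
    _ ≤ T * μ.restrict (closedBall x r) {y | (T : ℝ≥0∞) ≤ ENNReal.ofReal |b y - m x r|} := by
        gcongr
        intro y hy
        simp only [mem_ofPred_eq]
        rw [← ENNReal.ofReal_coe_nnreal]
        exact ENNReal.ofReal_le_ofReal (hT y hy)
    _ ≤ _ := (mul_meas_ge_le_lintegral₀ (by fun_prop) _).trans (hosc x r hr)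

/-- Integrate the triangle inequality through b(y) over the smaller ball. -/
theorem abs_sub_le (hosc : HasUnitMeanOscillation μ b m) (hμ : IsDoublingOnBalls μ C)
    (hb : Measurable b) {x x' : X} {r r' : ℝ} (hr : 0 < r) (hr' : 0 < r')
    (hsub : closedBall x r ⊆ closedBall x' r') {c : ℝ≥0}
    (hc : μ (closedBall x' r') ≤ c * μ (closedBall x r)) :
    |m x r - m x' r'| ≤ 1 + c := by
  have h : ENNReal.ofReal |m x r - m x' r'| * μ (closedBall x r) ≤
      (1 + c : ℝ≥0) * μ (closedBall x r) := by
    calc ENNReal.ofReal |m x r - m x' r'| * μ (closedBall x r)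
        = ∫⁻ _ in closedBall x r, ENNReal.ofReal |m x r - m x' r'| ∂μ := by rw [setLIntegral_const]
      _ ≤ ∫⁻ y in closedBall x r, (ENNReal.ofReal |b y - m x r| +
            ENNReal.ofReal |b y - m x' r'|) ∂μ := by
          refine lintegral_mono fun y => ?_
          rw [← ENNReal.ofReal_add (abs_nonneg _) (abs_nonneg _)]
          refine ENNReal.ofReal_le_ofReal ?_
          rw [abs_sub_comm (b y)]
          exact _root_.abs_sub_le _ _ _
      _ ≤ μ (closedBall x r) + c * μ (closedBall x r) := by
          rw [lintegral_add_left (by fun_prop)]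
          exact add_le_add (hosc x r hr)
            (((lintegral_mono_set hsub).trans (hosc x' r' hr')).trans hc)
      _ = _ := by push_cast; ring
  have h2 := (ENNReal.mul_le_mul_iff_left (hμ.pos x r hr).ne' (hμ.lt_top x r).ne).1 h
  rw [← ENNReal.ofReal_coe_nnreal] at h2
  simpa using (ENNReal.ofReal_le_ofReal_iff (by positivity)).1 h2

theorem abs_sub_div_two_pow_le (hosc : HasUnitMeanOscillation μ b m)
    (hμ : IsDoublingOnBalls μ C) (hb : Measurable b) (x : X) {r : ℝ} (hr : 0 < r) (n : ℕ) :
    |m x (r / 2 ^ n) - m x r| ≤ n * (1 + C) := by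
  induction n with
  | zero => simp
  | succ n ih =>
    have hp : 0 < r / 2 ^ (n + 1) := by positivity
    have h2 : 2 * (r / 2 ^ (n + 1)) = r / 2 ^ n := by rw [pow_succ]; field_simp
    have h := hosc.abs_sub_le hμ hb (x := x) (x' := x) hp (r' := r / 2 ^ n) (by positivity)
      (closedBall_subset_closedBall (by rw [← h2]; linarith)) (c := C)
      (by rw [← h2]; exact hμ.doubling x _ hp)
    calc _ ≤ _ := _root_.abs_sub_le _ (m x (r / 2 ^ n)) _
      _ ≤ (1 + C) + n * (1 + C) := add_le_add h ih
      _ = _ := by push_cast; ring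

/-- The growth of the constants towards the boundary of a ball is at most logarithmic. -/
theorem exists_abs_sub_le_log (hosc : HasUnitMeanOscillation μ b m)
    (hμ : IsDoublingOnBalls μ C) (hb : Measurable b) {x₀ y : X} {r₀ : ℝ} (hy : dist y x₀ < 2 * r₀) :
    ∃ ρ, 0 < ρ ∧ ρ ≤ (2 * r₀ - dist y x₀) / 8 ∧ |m y ρ - m x₀ (2 * r₀)| ≤
      (1 + C ^ 2 + 5 * (1 + C)) * (1 + Real.log (2 * r₀ / (2 * r₀ - dist y x₀))) := by
  have hd := dist_nonneg (x := y) (y := x₀)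
  have hr₀ : 0 < r₀ := by linarith
  set τ := 2 * r₀ - dist y x₀ with hτ
  have hτ0 : 0 < τ := by linarith
  have hτ1 : τ ≤ 2 * r₀ := by linarith
  set φ := Real.log (2 * r₀ / τ)
  have hφ0 : 0 ≤ φ := Real.log_nonneg (by rwa [one_le_div hτ0])
  -- n + 1 halvings of 4r₀ are just enough to reach a radius at most τ/8. Their number is
  -- logarithmic in r₀/τ, and each changes the constant by at most 1 + C.
  obtain ⟨n, hn1, hn2⟩ := exists_nat_pow_near (x := 32 * r₀ / τ) (y := (2 : ℝ))
    (by rw [one_le_div hτ0]; linarith) (by norm_num)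
  have hn : (n : ℝ) ≤ 2 * φ + 4 + 0 := by
    have h1 := Real.log_le_log (by positivity) hn1
    rw [Real.log_pow, show 32 * r₀ / τ = 2 ^ 4 * (2 * r₀ / τ) by ring,
      Real.log_mul (by positivity) (by positivity), Real.log_pow] at h1
    have hl2 := Real.log_two_gt_d9
    push_cast at h1
    have h3 : ((n : ℝ) - 4) * Real.log 2 ≤ φ := by linarith
    by_contra! hcon
    nlinarith
  have hN : 4 * r₀ / 2 ^ (n + 1) ≤ τ / 8 := by
    rw [div_le_div_iff₀ (by positivity) (by positivity)]
    rw [div_lt_iff₀ hτ0] at hn2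
    nlinarith
  refine ⟨4 * r₀ / 2 ^ (n + 1), by positivity, hN, ?_⟩
  have h1 := hosc.abs_sub_div_two_pow_le hμ hb y (r := 4 * r₀) (by positivity) (n + 1)
  have h2 : |m x₀ (2 * r₀) - m y (4 * r₀)| ≤ 1 + (C ^ 2 : ℝ≥0) := by
    refine hosc.abs_sub_le hμ hb (by positivity) (by positivity)
      (closedBall_subset_closedBall' (by rw [dist_comm]; linarith)) ?_
    rw [ENNReal.coe_pow]
    exact hμ.measure_closedBall_le (by positivity) 2 (by linarith)
  push_cast at h1 h2
  rw [abs_sub_comm] at h2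
  have hC : (0 : ℝ) ≤ C := C.2
  calc _ ≤ _ := _root_.abs_sub_le _ (m y (4 * r₀)) _
    _ ≤ (n + 1) * (1 + C) + (1 + C ^ 2) := add_le_add h1 h2
    _ ≤ (2 * φ + 4 + 1) * (1 + C) + (1 + C ^ 2) := by gcongr; linarith
    _ ≤ _ := by nlinarith [mul_nonneg hφ0 hC, mul_nonneg hφ0 (sq_nonneg (C : ℝ))]

end HasUnitMeanOscillation


theorem Real.abs_le_exp_add_exp_neg (u : ℝ) : |u| ≤ Real.exp u + Real.exp (-u) := by
  have h1 := Real.add_one_le_exp u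
  have h2 := Real.add_one_le_exp (-u)
  have h3 := Real.exp_pos u
  have h4 := Real.exp_pos (-u)
  rw [abs_le]
  constructor <;> linarith

theorem Real.abs_log_div_sub_log_div_le {R t s : ℝ} (hR : 0 < R) (ht : 0 < t) (hs : |s - t| ≤ t / 8) :
    |Real.log (R / s) - Real.log (R / t)| ≤ 1 := by
  rw [abs_le] at hs
  have hs0 : 0 < s := by linarith
  have h1 := Real.log_le_sub_one_of_pos (div_pos hs0 ht)
  have h2 := Real.log_le_sub_one_of_pos (div_pos ht hs0)
  rw [Real.log_div hs0.ne' ht.ne'] at h1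
  rw [Real.log_div ht.ne' hs0.ne'] at h2
  have h3 : s / t ≤ 2 := by rw [div_le_iff₀ ht]; linarith
  have h4 : t / s ≤ 2 := by rw [div_le_iff₀ hs0]; linarith
  rw [Real.log_div hR.ne' hs0.ne', Real.log_div hR.ne' ht.ne', abs_le]
  constructor <;> linarith

/-- The set of points of `ball x₀ (2 * r₀)` at which `b` differs from `c` by more than a
threshold, which grows logarithmically at the boundary. -/
def oscillationLevel {X : Type*} [PseudoMetricSpace X] (b : X → ℝ) (c L : ℝ) (x₀ : X) (r₀ l : ℝ) :
    Set X :=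
  {y | dist y x₀ < 2 * r₀ ∧ l + L * Real.log (2 * r₀ / (2 * r₀ - dist y x₀)) < |b y - c|}

section

variable {X : Type*} [PseudoMetricSpace X] [MeasurableSpace X] {μ ν : Measure X} {A C D : ℝ≥0}
  {b : X → ℝ} {m : X → ℝ → ℝ}

theorem measurableSet_oscillationLevel [OpensMeasurableSpace X] (hb : Measurable b) (c L : ℝ)
    (x₀ : X) (r₀ l : ℝ) : MeasurableSet (oscillationLevel b c L x₀ r₀ l) := by
  have hd : Measurable fun y => dist y x₀ := (continuous_id.dist continuous_const).measurable
  have h1 : Measurable fun y => l + L * Real.log (2 * r₀ / (2 * r₀ - dist y x₀)) := by fun_prop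
  have h2 : Measurable fun y => |b y - c| := by fun_prop
  exact (measurableSet_lt hd measurable_const).inter (measurableSet_lt h1 h2)

/-- `ν` satisfies a weak `A_∞` condition with respect to `μ`: subsets of balls of proportion at
least a quarter for `μ` have a definite proportion for `ν`. -/
def IsQuarterComparable (μ ν : Measure X) (A : ℝ≥0) : Prop :=
  ∀ x r, 0 < r → ∀ s, MeasurableSet s → s ⊆ closedBall x r →
    μ (closedBall x r) ≤ 4 * μ s → ν (closedBall x r) ≤ A * ν s

namespace HasUnitMeanOscillation

/-- Around almost every point of the upper level set F there is a ball in which at least a quarter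
of the μ-measure lies in E \ F; the weak A_∞ condition and a covering then give the claim for ν. The
logarithm in the threshold absorbs the drift of the mean values as the balls shrink towards the
boundary, so all of them stay inside the original ball. The increment 2L + T + 2 is exactly what the
argument loses: L twice for the variation of the logarithm, T for a point of F near the local mean,
2 for the typical oscillation. -/
theorem measure_oscillationLevel_le [BorelSpace X] (hosc : HasUnitMeanOscillation μ b m)
    (hμ : IsDoublingOnBalls μ C) (hν : IsDoublingOnBalls ν D) (hac : ν ≪ μ)
    (hA : IsQuarterComparable μ ν A) (hb : Measurable b) {L T : ℝ}
    (hL : L = 1 + C ^ 2 + 5 * (1 + C)) (hT : T = 4 * C) (x₀ : X) {r₀ l : ℝ}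
    (hl : 2 * L + T ≤ l) :
    ν (oscillationLevel b (m x₀ (2 * r₀)) L x₀ r₀ (l + (2 * L + T + 2))) ≤
      D ^ 3 * A * ν (oscillationLevel b (m x₀ (2 * r₀)) L x₀ r₀ l \
        oscillationLevel b (m x₀ (2 * r₀)) L x₀ r₀ (l + (2 * L + T + 2))) := by
  have hC0 : (0 : ℝ) ≤ C := C.2
  have hL0 : 0 < L := by rw [hL]; positivity
  have hT0 : 0 ≤ T := by rw [hT]; positivity
  set c := m x₀ (2 * r₀)
  set K := 2 * L + T + 2
  set E := oscillationLevel b c L x₀ r₀ l with hE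
  set F := oscillationLevel b c L x₀ r₀ (l + K) with hF
  have hEm : MeasurableSet E := measurableSet_oscillationLevel hb _ _ _ _ _
  have hFm : MeasurableSet F := measurableSet_oscillationLevel hb _ _ _ _ _
  refine hν.measure_le_of_forall_exists_closedBall (2 * r₀) ?_
  filter_upwards [hac.ae_le (hμ.ae_exists_density_between hFm)] with y hy hyF
  have hyd : dist y x₀ < 2 * r₀ := hyF.1
  have hd0 := dist_nonneg (x := y) (y := x₀)
  have hr₀ : 0 < r₀ := by linarith
  obtain ⟨ρ, hρ0, hρ, hmρ⟩ := hosc.exists_abs_sub_le_log hμ hb hyd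
  rw [← hL] at hmρ
  set φ := fun z => Real.log (2 * r₀ / (2 * r₀ - dist z x₀)) with hφ
  change |m y ρ - c| ≤ L * (1 + φ y) at hmρ
  have hvar : ∀ z ∈ closedBall y ρ, dist z x₀ < 2 * r₀ ∧ |φ z - φ y| ≤ 1 := by
    intro z hz
    have h1 : |dist z x₀ - dist y x₀| ≤ ρ := (abs_dist_sub_le z y x₀).trans hz
    have h2 := abs_le.1 h1
    refine ⟨by linarith, Real.abs_log_div_sub_log_div_le (by linarith) (by linarith) ?_⟩
    rw [show 2 * r₀ - dist z x₀ - (2 * r₀ - dist y x₀) = -(dist z x₀ - dist y x₀) by ring, abs_neg]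
    linarith
  -- On F near y, b is at distance at least T = 4C from the local mean, so Chebyshev makes F sparse
  -- in the starting ball.
  have hFρ : 4 * C * μ (F ∩ closedBall y ρ) ≤ μ (closedBall y ρ) := by
    have := hosc.mul_measure_le hb y hρ0 (4 * C) (s := F ∩ closedBall y ρ) inter_subset_right ?_
    · simpa using this
    intro z hz
    obtain ⟨-, hv⟩ := hvar z hz.2
    have hv := abs_le.1 hv
    have hzF : l + K + L * φ z < |b z - c| := hz.1.2
    have htri := _root_.abs_sub_le (b z) (m y ρ) c
    have h1 : L * (1 + φ y) ≤ L * (2 + φ z) := mul_le_mul_of_nonneg_left (by linarith) hL0.le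
    push_cast
    nlinarith
  obtain ⟨s, hs0, hsρ, hup, hlow⟩ := hy hyF ρ hρ0 hFρ
  refine ⟨s, hs0, by linarith, ?_⟩
  refine hA y s hs0 _ (measurableSet_closedBall.inter (hEm.diff hFm)) inter_subset_left ?_
  set B := closedBall y s with hB
  have hBρ : B ⊆ closedBall y ρ := closedBall_subset_closedBall hsρ
  have hBt : μ B ≠ ∞ := (hμ.lt_top y s).ne
  -- In the stopping ball F has density above 1/(4C), more than Chebyshev allows for points at
  -- distance T from the mean. Hence some point of F is close to the mean, and the mean itself is
  -- far from c.
  obtain ⟨z, hzF, hzB, hz⟩ : ∃ z, z ∈ F ∧ z ∈ B ∧ |b z - m y s| < T := by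
    by_contra! hcon
    have := hosc.mul_measure_le hb y hs0 (4 * C) (s := F ∩ closedBall y s) inter_subset_right
      fun z hz => by push_cast; rw [← hT]; exact hcon z hz.1 hz.2
    push_cast at this
    exact hlow.not_ge this
  have hms : l + K + L * (φ y - 1) - T < |m y s - c| := by
    have h1 := (abs_le.1 (hvar z (hBρ hzB)).2).1
    have h2 : l + K + L * φ z < |b z - c| := hzF.2
    have h3 := _root_.abs_sub_le (b z) (m y s) c
    have h4 : L * (φ y - 1) ≤ L * φ z := mul_le_mul_of_nonneg_left (by linarith) hL0.le
    linarith
  set N := {x | x ∈ B ∧ 2 ≤ |b x - m y s|} with hN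
  have hNle : 2 * μ N ≤ μ B := by
    simpa using hosc.mul_measure_le hb y hs0 2 (s := N) (fun x hx => hx.1) fun x hx => hx.2
  have hcov : B ⊆ N ∪ ((F ∩ B) ∪ (B ∩ (E \ F))) := by
    intro x hx
    by_cases hxN : 2 ≤ |b x - m y s|
    · exact Or.inl ⟨hx, hxN⟩
    · by_cases hxF : x ∈ F
      · exact Or.inr (Or.inl ⟨hxF, hx⟩)
      · refine Or.inr (Or.inr ⟨hx, ⟨(hvar x (hBρ hx)).1, ?_⟩, hxF⟩)
        change l + L * φ x < |b x - c|
        have h1 := (abs_le.1 (hvar x (hBρ hx)).2).2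
        have h2 := _root_.abs_sub_le (m y s) (b x) c
        rw [abs_sub_comm (m y s) (b x)] at h2
        have h4 : L * φ x ≤ L * (φ y + 1) := mul_le_mul_of_nonneg_left (by linarith) hL0.le
        linarith
  -- Points at distance at least 2 from the mean fill at most half of B, and F at most a quarter;
  -- the rest lies in E \ F.
  have h4 : 4 * μ B ≤ 3 * μ B + 4 * μ (B ∩ (E \ F)) := by
    calc 4 * μ B ≤ 4 * (μ N + (μ (F ∩ B) + μ (B ∩ (E \ F)))) := by
          gcongr
          exact (measure_mono hcov).trans ((measure_union_le _ _).trans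
            (add_le_add_right (measure_union_le _ _) _))
      _ = 2 * (2 * μ N) + 4 * μ (F ∩ B) + 4 * μ (B ∩ (E \ F)) := by ring
      _ ≤ 2 * μ B + μ B + 4 * μ (B ∩ (E \ F)) := by gcongr
      _ = _ := by ring
  rw [show (4 : ℝ≥0∞) * μ B = 3 * μ B + μ B by ring] at h4
  exact (ENNReal.add_le_add_iff_left (ENNReal.mul_ne_top ENNReal.ofNat_ne_top hBt)).1 h4

/-- Since ν(E \ F) ≥ ν(F)/M with M = D³A + 1, each step of the level reduces the measure by the
factor 1 + 1/M: geometric decay. -/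
theorem pow_mul_measure_oscillationLevel_le [BorelSpace X] (hosc : HasUnitMeanOscillation μ b m)
    (hμ : IsDoublingOnBalls μ C) (hν : IsDoublingOnBalls ν D) (hac : ν ≪ μ)
    (hA : IsQuarterComparable μ ν A) (hb : Measurable b) {L T : ℝ}
    (hL : L = 1 + C ^ 2 + 5 * (1 + C)) (hT : T = 4 * C) (x₀ : X) {r₀ : ℝ} (hr₀ : 0 < r₀) (k : ℕ) :
    (1 + (D ^ 3 * A + 1)⁻¹ : ℝ≥0) ^ k *
        ν (oscillationLevel b (m x₀ (2 * r₀)) L x₀ r₀ (2 * L + T + k * (2 * L + T + 2))) ≤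
      D * ν (closedBall x₀ r₀) := by
  have hC0 : (0 : ℝ) ≤ C := C.2
  have hL0 : 0 < L := by rw [hL]; positivity
  have hT0 : 0 ≤ T := by rw [hT]; positivity
  have hsub : ∀ l, oscillationLevel b (m x₀ (2 * r₀)) L x₀ r₀ l ⊆ closedBall x₀ (2 * r₀) :=
    fun l y hy => hy.1.le
  induction k with
  | zero =>
    simp only [pow_zero, one_mul]
    exact (measure_mono (hsub _)).trans (hν.doubling x₀ r₀ hr₀)
  | succ k ih =>
    refine le_trans ?_ ih
    rw [pow_succ, mul_assoc]
    gcongr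
    have h := hosc.measure_oscillationLevel_le hμ hν hac hA hb hL hT x₀ (r₀ := r₀)
      (l := 2 * L + T + k * (2 * L + T + 2)) (by have : 0 ≤ k * (2 * L + T + 2) := by positivity
                                                 linarith)
    rw [show 2 * L + T + ((k + 1 : ℕ) : ℝ) * (2 * L + T + 2) =
      2 * L + T + k * (2 * L + T + 2) + (2 * L + T + 2) by push_cast; ring]
    set E := oscillationLevel b (m x₀ (2 * r₀)) L x₀ r₀ (2 * L + T + k * (2 * L + T + 2))
    set F := oscillationLevel b (m x₀ (2 * r₀)) L x₀ r₀
      (2 * L + T + k * (2 * L + T + 2) + (2 * L + T + 2))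
    have hFm : MeasurableSet F := measurableSet_oscillationLevel hb _ _ _ _ _
    have hFE : F ⊆ E := fun y hy => ⟨hy.1, lt_of_le_of_lt (by linarith) hy.2⟩
    set M : ℝ≥0 := D ^ 3 * A + 1
    have hM0 : (M : ℝ≥0∞) ≠ 0 := by
      have : M ≠ 0 := by positivity
      exact_mod_cast this
    have h' : (M : ℝ≥0∞)⁻¹ * ν F ≤ ν (E \ F) := by
      rw [mul_comm, ← div_eq_mul_inv]
      refine ENNReal.div_le_of_le_mul' (h.trans ?_)
      gcongr
      simp only [M]; push_cast; exact le_self_add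
    calc _ = ν F + (M : ℝ≥0∞)⁻¹ * ν F := by
          rw [ENNReal.coe_add, ENNReal.coe_inv (by positivity), ENNReal.coe_one]; ring
      _ ≤ ν F + ν (E \ F) := by gcongr
      _ = ν E := by rw [measure_add_sdiff hFm.nullMeasurableSet, union_eq_self_of_subset_left hFE]

/-- A weighted John–Nirenberg inequality. -/
theorem exists_lintegral_exp_le [BorelSpace X] (hosc : HasUnitMeanOscillation μ b m)
    (hμ : IsDoublingOnBalls μ C) (hν : IsDoublingOnBalls ν D) (hac : ν ≪ μ)
    (hA : IsQuarterComparable μ ν A) (hb : Measurable b) :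
    ∃ s : ℝ, 0 < s ∧ ∃ A' : ℝ≥0, ∀ x r, 0 < r →
      ∫⁻ y in closedBall x r, ENNReal.ofReal (Real.exp (s * |b y - m x (2 * r)|)) ∂ν ≤
        A' * ν (closedBall x r) := by
  obtain ⟨L, hL⟩ : ∃ L : ℝ, L = 1 + C ^ 2 + 5 * (1 + C) := ⟨_, rfl⟩
  obtain ⟨T, hT⟩ : ∃ T : ℝ, T = 4 * C := ⟨_, rfl⟩
  have hC0 : (0 : ℝ) ≤ C := C.2
  have hL0 : 0 < L := by rw [hL]; positivity
  have hT0 : 0 ≤ T := by rw [hT]; positivity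
  set K := 2 * L + T + 2 with hK
  have hK0 : 0 < K := by positivity
  set β : ℝ≥0 := 1 + (D ^ 3 * A + 1)⁻¹ with hβ
  have hβ1 : 1 < β := by rw [hβ]; exact lt_add_of_pos_right _ (by positivity)
  -- Only the square root of the decay rate β is spent on the exponential; the other root makes the
  -- sum over levels converge.
  obtain ⟨γ, hγβ, hγ1⟩ : ∃ γ : ℝ≥0, γ * γ = β ∧ 1 < γ :=
    ⟨NNReal.sqrt β, NNReal.mul_self_sqrt β, by
      by_contra! h
      exact hβ1.not_ge (by rw [← NNReal.mul_self_sqrt β]; exact mul_le_one' h h)⟩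
  have hγ0 : (0 : ℝ) < γ := by exact_mod_cast zero_lt_one.trans hγ1
  set s := Real.log γ / K with hs
  have hs0 : 0 < s := div_pos (Real.log_pos (by exact_mod_cast hγ1)) hK0
  have hsK : Real.exp (s * K) = γ := by
    rw [hs, div_mul_cancel₀ _ hK0.ne', Real.exp_log hγ0]
  set Λ := 3 * L + T with hΛ
  set Q : ℝ≥0 := (Real.exp (s * Λ)).toNNReal * γ ^ 2 with hQ
  have hgeo : ∑' j : ℕ, ((γ : ℝ≥0∞)⁻¹) ^ j ≠ ∞ := by
    rw [ENNReal.tsum_geometric]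
    refine ENNReal.inv_ne_top.2 (tsub_pos_of_lt (ENNReal.inv_lt_one.2 ?_)).ne'
    exact_mod_cast hγ1
  refine ⟨s, hs0, Q * (1 + (∑' j : ℕ, ((γ : ℝ≥0∞)⁻¹) ^ j).toNNReal * D), fun x r hr => ?_⟩
  set c := m x (2 * r)
  set E : ℕ → Set X := fun j => oscillationLevel b c L x r (2 * L + T + j * K) with hE
  have hEm : ∀ j, MeasurableSet (E j) := fun j => measurableSet_oscillationLevel hb _ _ _ _ _
  have hpt : ∀ y ∈ closedBall x r, ENNReal.ofReal (Real.exp (s * |b y - c|)) ≤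
      Q * (1 + ∑' j : ℕ, (γ : ℝ≥0∞) ^ j * (E j).indicator 1 y) := by
    intro y hy
    have hy : dist y x ≤ r := hy
    have hQr : (Q : ℝ) = Real.exp (s * Λ) * γ ^ 2 := by
      rw [hQ]; push_cast; rw [Real.coe_toNNReal _ (Real.exp_pos _).le]
    have hγ1' : (1 : ℝ) ≤ γ := by exact_mod_cast hγ1.le
    by_cases hsmall : |b y - c| < Λ + K
    · refine le_trans (b := (Q : ℝ≥0∞)) ?_ (le_mul_of_one_le_right' le_self_add)
      rw [← ENNReal.ofReal_coe_nnreal, hQr]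
      refine ENNReal.ofReal_le_ofReal ?_
      calc Real.exp (s * |b y - c|) ≤ Real.exp (s * (Λ + K)) := by gcongr
        _ = Real.exp (s * Λ) * γ := by rw [mul_add, Real.exp_add, hsK]
        _ ≤ Real.exp (s * Λ) * γ ^ 2 := by gcongr; nlinarith
    · rw [not_lt] at hsmall
      set h := |b y - c|
      -- Taking one less than the floor makes the inequality defining E j strict. The bound h - Λ ≤
      -- (j + 2)K then costs the factor γ² in Q.
      obtain ⟨j, hj⟩ : ∃ j, ⌊(h - Λ) / K⌋₊ = j + 1 := by
        refine Nat.exists_eq_succ_of_ne_zero (Nat.floor_pos.2 ?_).ne'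
        rw [one_le_div hK0]; linarith
      have h1 : ((j : ℝ) + 1) * K ≤ h - Λ := by
        have := Nat.floor_le (a := (h - Λ) / K) (div_nonneg (by linarith) hK0.le)
        rw [hj, le_div_iff₀ hK0] at this
        exact_mod_cast this
      have h2 : h - Λ ≤ ((j : ℝ) + 2) * K := by
        have := (Nat.lt_floor_add_one ((h - Λ) / K)).le
        rw [hj, div_le_iff₀ hK0] at this
        push_cast at this
        linarith
      have hyE : y ∈ E j := by
        refine ⟨by linarith, ?_⟩
        -- On the half-size ball the boundary term is at most log 2 < 1, so it costs one more L;
        -- this is the third L in Λ.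
        have hlog : Real.log (2 * r / (2 * r - dist y x)) ≤ 1 := by
          have hle : 2 * r / (2 * r - dist y x) ≤ 2 := by
            rw [div_le_iff₀ (by linarith)]; linarith
          have := Real.log_le_log (div_pos (by linarith) (by linarith)) hle
          linarith [Real.log_two_lt_d9]
        change 2 * L + T + j * K + L * _ < h
        nlinarith
      calc ENNReal.ofReal (Real.exp (s * h))
          ≤ ENNReal.ofReal (Q * γ ^ j) := by
            refine ENNReal.ofReal_le_ofReal ?_
            calc Real.exp (s * h) ≤ Real.exp (s * Λ + (j + 2 : ℕ) * (s * K)) := by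
                  refine Real.exp_le_exp.2 ?_
                  push_cast
                  nlinarith
              _ = Q * γ ^ j := by
                  rw [Real.exp_add, Real.exp_nat_mul, hsK, hQr]; ring
        _ = Q * ((γ : ℝ≥0∞) ^ j * (E j).indicator 1 y) := by
            rw [indicator_of_mem hyE, ENNReal.ofReal_mul (NNReal.coe_nonneg Q), ENNReal.ofReal_coe_nnreal,
              ENNReal.ofReal_pow hγ0.le, ENNReal.ofReal_coe_nnreal, Pi.one_apply, mul_one]
        _ ≤ _ := by
            gcongr
            exact (ENNReal.le_tsum (f := fun j : ℕ => (γ : ℝ≥0∞) ^ j * (E j).indicator 1 y) j).trans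
              le_add_self
  have hterm : ∀ j, (γ : ℝ≥0∞) ^ j * ν (E j) ≤ (γ : ℝ≥0∞)⁻¹ ^ j * (D * ν (closedBall x r)) := by
    intro j
    have h := hosc.pow_mul_measure_oscillationLevel_le hμ hν hac hA hb hL hT x hr j
    have hne : (γ : ℝ≥0∞) ≠ 0 := by exact_mod_cast (zero_lt_one.trans hγ1).ne'
    calc (γ : ℝ≥0∞) ^ j * ν (E j)
        = ((γ : ℝ≥0∞)⁻¹ * γ) ^ j * ((γ : ℝ≥0∞) ^ j * ν (E j)) := by
          rw [ENNReal.inv_mul_cancel hne ENNReal.coe_ne_top, one_pow, one_mul]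
      _ = (γ : ℝ≥0∞)⁻¹ ^ j * ((β : ℝ≥0∞) ^ j * ν (E j)) := by
          rw [← hγβ, mul_pow, ENNReal.coe_mul, mul_pow]; ring
      _ ≤ _ := by gcongr
  calc ∫⁻ y in closedBall x r, ENNReal.ofReal (Real.exp (s * |b y - c|)) ∂ν
      ≤ ∫⁻ y in closedBall x r, Q * (1 + ∑' j : ℕ, (γ : ℝ≥0∞) ^ j * (E j).indicator 1 y) ∂ν :=
        setLIntegral_mono' measurableSet_closedBall hpt
    _ = Q * (ν (closedBall x r) + ∑' j : ℕ, (γ : ℝ≥0∞) ^ j *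
          (ν.restrict (closedBall x r)) (E j)) := by
        rw [lintegral_const_mul' _ _ ENNReal.coe_ne_top, lintegral_add_left measurable_const,
          setLIntegral_const, one_mul, lintegral_tsum]
        · congr 3
          ext j
          rw [lintegral_const_mul' _ _ (by finiteness), lintegral_indicator_one (hEm j)]
        · exact fun j => ((measurable_one.indicator (hEm j)).const_mul _).aemeasurable
    _ ≤ Q * (ν (closedBall x r) + ∑' j : ℕ, (γ : ℝ≥0∞)⁻¹ ^ j * (D * ν (closedBall x r))) := by
        refine mul_le_mul' le_rfl (add_le_add le_rfl (ENNReal.tsum_le_tsum fun j => ?_))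
        exact (mul_le_mul' le_rfl (Measure.restrict_apply_le _ _)).trans (hterm j)
    _ = _ := by
        rw [ENNReal.tsum_mul_right]
        push_cast
        rw [ENNReal.coe_toNNReal hgeo]
        ring

end HasUnitMeanOscillation

end


/-! ### Perturbation of A_p weights, and the conjugated maximal function on Morrey spaces. -/

section

variable {X : Type*} [PseudoMetricSpace X] [MeasurableSpace X] {μ : Measure X} {C K : ℝ≥0} {p : ℝ}
  {v b : X → ℝ} {m : X → ℝ → ℝ}

theorem IsExpAp.isQuarterComparable (hv : IsExpAp μ p K v) (hμ : IsDoublingOnBalls μ C)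
    (hp : 1 < p) : IsQuarterComparable μ (expMeasure μ v) (K * 4 ^ p) :=
  fun _ _ hr _ hs hsub h => hv.expMeasure_closedBall_le hμ hp hs hr hsub (by simpa using h)

omit [PseudoMetricSpace X] in
theorem expMeasure_add_mul_le (hv : Measurable v) (hb : Measurable b) {B : Set X}
    (hB : MeasurableSet B) {s s₀ c : ℝ} (hs : |s| ≤ s₀) {A : ℝ≥0∞}
    (hA : ∫⁻ y in B, ENNReal.ofReal (Real.exp (s₀ * |b y - c|)) ∂(expMeasure μ v) ≤
      A * expMeasure μ v B) :
    expMeasure μ (fun y => v y + s * b y) B ≤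
      ENNReal.ofReal (Real.exp (s * c)) * (A * expMeasure μ v B) := by
  calc expMeasure μ (fun y => v y + s * b y) B
      = ∫⁻ y in B, expWeight (fun y => s * b y) y ∂(expMeasure μ v) := by
        rw [expMeasure_apply hB, setLIntegral_expMeasure hv (by fun_prop) hB]
        simp_rw [expWeight_mul]
    _ ≤ ∫⁻ y in B, ENNReal.ofReal (Real.exp (s * c)) *
          ENNReal.ofReal (Real.exp (s₀ * |b y - c|)) ∂(expMeasure μ v) := by
        refine lintegral_mono fun y => ?_
        rw [expWeight, ← ENNReal.ofReal_mul (Real.exp_pos _).le, ← Real.exp_add]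
        refine ENNReal.ofReal_le_ofReal (Real.exp_le_exp.2 ?_)
        have h1 : s * (b y - c) ≤ |s| * |b y - c| := by rw [← abs_mul]; exact le_abs_self _
        have h2 : |s| * |b y - c| ≤ s₀ * |b y - c| := by gcongr
        linarith
    _ ≤ _ := by
        rw [lintegral_const_mul' _ _ ENNReal.ofReal_ne_top]
        gcongr

/-- Small multiples of a function of bounded mean oscillation can be added to the logarithm of an
`A_p` weight. -/
theorem IsExpAp.exists_add_mul [BorelSpace X] (hv : IsExpAp μ p K v) (hμ : IsDoublingOnBalls μ C)
    (hp : 1 < p) (hb : Measurable b) (hosc : HasUnitMeanOscillation μ b m) :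
    ∃ s₀ : ℝ, 0 < s₀ ∧ ∃ K' : ℝ≥0, ∀ s, |s| ≤ s₀ → IsExpAp μ p K' fun y => v y + s * b y := by
  have hp1 : 0 < p - 1 := by linarith
  have hq1 : 1 < p / (p - 1) := by rw [lt_div_iff₀ hp1]; linarith
  have hσ := hv.dual hp
  obtain ⟨s₁, hs₁, A₁, h₁⟩ := hosc.exists_lintegral_exp_le hμ (hv.isDoublingOnBalls hμ hp)
    expMeasure_absolutelyContinuous (hv.isQuarterComparable hμ hp) hb
  obtain ⟨s₂, hs₂, A₂, h₂⟩ := hosc.exists_lintegral_exp_le hμ (hσ.isDoublingOnBalls hμ hq1)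
    expMeasure_absolutelyContinuous (hσ.isQuarterComparable hμ hq1) hb
  -- Adding sb to v adds -sb/(p-1) to the dual exponent, whence the factor p - 1. Both estimates are
  -- centred at the same constant c, so the exponentials of c cancel in the A_p product.
  refine ⟨min s₁ ((p - 1) * s₂), by positivity, A₁ * A₂ ^ (p - 1) * K, fun s hs => ?_⟩
  have hvm := hv.measurable
  refine ⟨by fun_prop, fun x r hr => ?_⟩
  have e₁ := expMeasure_add_mul_le (s := s) hvm hb measurableSet_closedBall
    (hs.trans (min_le_left _ _)) (h₁ x r hr)
  have e₂ := expMeasure_add_mul_le (s := -s / (p - 1)) hv.measurable_dual hb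
    measurableSet_closedBall (by
      rw [abs_div, abs_neg, abs_of_pos hp1, div_le_iff₀ hp1, mul_comm]
      exact hs.trans (min_le_right _ _)) (h₂ x r hr)
  have hfun : (fun y => -(v y + s * b y) / (p - 1)) =
      fun y => -v y / (p - 1) + -s / (p - 1) * b y := by ext y; ring
  rw [hfun]
  set B := closedBall x r
  set c := m x (2 * r)
  calc _ ≤ (ENNReal.ofReal (Real.exp (s * c)) * (A₁ * expMeasure μ v B)) *
        (ENNReal.ofReal (Real.exp (-s / (p - 1) * c)) *
          (A₂ * expMeasure μ (fun y => -v y / (p - 1)) B)) ^ (p - 1) := by gcongr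
    _ = (ENNReal.ofReal (Real.exp (s * c)) * ENNReal.ofReal (Real.exp (-s / (p - 1) * c)) ^ (p - 1))
        * (A₁ * A₂ ^ (p - 1)) *
        (expMeasure μ v B * expMeasure μ (fun y => -v y / (p - 1)) B ^ (p - 1)) := by
      rw [ENNReal.mul_rpow_of_nonneg _ _ hp1.le, ENNReal.mul_rpow_of_nonneg _ _ hp1.le]
      ring
    _ = (A₁ * A₂ ^ (p - 1)) *
        (expMeasure μ v B * expMeasure μ (fun y => -v y / (p - 1)) B ^ (p - 1)) := by
      rw [ENNReal.ofReal_rpow_of_pos (Real.exp_pos _), ← Real.exp_mul,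
        ← ENNReal.ofReal_mul (Real.exp_pos _).le, ← Real.exp_add,
        show s * c + -s / (p - 1) * c * (p - 1) = 0 by field_simp; ring, Real.exp_zero,
        ENNReal.ofReal_one, one_mul]
    _ ≤ (A₁ * A₂ ^ (p - 1)) * (K * μ B ^ p) := mul_le_mul' le_rfl (hv.le x r hr)
    _ = _ := by
      push_cast
      rw [ENNReal.coe_rpow_of_nonneg _ hp1.le]
      ring

variable {K₁ K₂ : ℝ≥0} {a : X → ℝ} {κ : ℝ}

/-- Comparison of the weights `exp (v + p a)` and `exp v` on nested balls. -/
theorem expMeasure_mul_rpow_le [OpensMeasurableSpace X] (hμ : IsDoublingOnBalls μ C) (hp : 1 < p)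
    (hκ0 : 0 < κ) (hκ1 : κ < 1) (hv : IsExpAp μ p K v)
    (h₁ : IsExpAp μ p K₁ fun y => v y + p * a y)
    (h₂ : IsExpAp μ p K₂ fun y => v y + p / (1 - κ) * a y) {B : Set X} (hB : MeasurableSet B)
    {z : X} {ρ : ℝ} (hρ : 0 < ρ) (hsub : B ⊆ closedBall z ρ) :
    expMeasure μ (fun y => v y + p * a y) B * expMeasure μ v (closedBall z ρ) ^ κ ≤
      (K ^ κ * K₂ ^ (1 - κ) : ℝ≥0) *
        (expMeasure μ (fun y => v y + p * a y) (closedBall z ρ) * expMeasure μ v B ^ κ) := by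
  have hp1 : 0 < p - 1 := by linarith
  have hκ1' : 0 < 1 - κ := by linarith
  have hp0 : 0 ≤ p := by linarith
  have hvm := hv.measurable
  have hDm : MeasurableSet (closedBall z ρ) := measurableSet_closedBall
  have hq1 : 1 < p / (p - 1) := by rw [lt_div_iff₀ hp1]; linarith
  set D := closedBall z ρ
  set u₂ := fun y => v y + p / (1 - κ) * a y with hu₂
  have hum₂ := h₂.measurable
  -- Since (1-κ) · p/(1-κ) = p, the middle exponent is a convex combination of v and u₂; the same
  -- holds for the dual exponents.
  have e1 : (fun y => v y + p * a y) = fun y => κ * v y + (1 - κ) * u₂ y := by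
    ext y; simp only [hu₂]; field_simp; ring
  have e2 : (fun y => -(v y + p * a y) / (p - 1)) =
      fun y => κ * (-v y / (p - 1)) + (1 - κ) * (-u₂ y / (p - 1)) := by
    ext y; simp only [hu₂]; field_simp; ring
  set Y := expMeasure μ (fun y => -v y / (p - 1)) D ^ κ *
    expMeasure μ (fun y => -u₂ y / (p - 1)) D ^ (1 - κ) with hY
  have hYp : Y ^ (p - 1) ≠ 0 := by
    refine (ENNReal.rpow_pos_of_nonneg (ENNReal.mul_pos ?_ ?_) hp1.le).ne'
    · exact (ENNReal.rpow_pos_of_nonneg (hv.expMeasure_dual_closedBall_pos hμ z hρ) hκ0.le).ne'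
    · exact (ENNReal.rpow_pos_of_nonneg (h₂.expMeasure_dual_closedBall_pos hμ z hρ) hκ1'.le).ne'
  have hYt : Y ^ (p - 1) ≠ ∞ := by
    refine ENNReal.rpow_ne_top_of_nonneg hp1.le (ENNReal.mul_ne_top ?_ ?_)
    · exact ENNReal.rpow_ne_top_of_nonneg hκ0.le
        ((hv.dual hp).expMeasure_closedBall_lt_top hμ hq1 z ρ).ne
    · exact ENNReal.rpow_ne_top_of_nonneg hκ1'.le
        ((h₂.dual hp).expMeasure_closedBall_lt_top hμ hq1 z ρ).ne
  -- A reversed log-convexity inequality on D: multiply by dual factors, apply the A_p conditions of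
  -- v and u₂, then bound μ(D)^p by Hölder for the middle weight and log-convexity for its dual.
  have hX : expMeasure μ v D ^ κ * expMeasure μ u₂ D ^ (1 - κ) ≤
      (K ^ κ * K₂ ^ (1 - κ) : ℝ≥0) * expMeasure μ (fun y => v y + p * a y) D := by
    rw [← ENNReal.mul_le_mul_iff_left hYp hYt]
    calc expMeasure μ v D ^ κ * expMeasure μ u₂ D ^ (1 - κ) * Y ^ (p - 1)
        = (expMeasure μ v D * expMeasure μ (fun y => -v y / (p - 1)) D ^ (p - 1)) ^ κ *
          (expMeasure μ u₂ D * expMeasure μ (fun y => -u₂ y / (p - 1)) D ^ (p - 1)) ^ (1 - κ) := by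
          rw [hY, ENNReal.mul_rpow_of_nonneg _ _ hp1.le, ENNReal.mul_rpow_of_nonneg _ _ hκ0.le,
            ENNReal.mul_rpow_of_nonneg _ _ hκ1'.le, ← ENNReal.rpow_mul, ← ENNReal.rpow_mul,
            ← ENNReal.rpow_mul, ← ENNReal.rpow_mul, mul_comm κ (p - 1), mul_comm (1 - κ) (p - 1)]
          ring
      _ ≤ (K * μ D ^ p) ^ κ * (K₂ * μ D ^ p) ^ (1 - κ) :=
          mul_le_mul' (ENNReal.rpow_le_rpow (hv.le z ρ hρ) hκ0.le)
            (ENNReal.rpow_le_rpow (h₂.le z ρ hρ) hκ1'.le)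
      _ = (K ^ κ * K₂ ^ (1 - κ) : ℝ≥0) * μ D ^ p := by
          rw [ENNReal.mul_rpow_of_nonneg _ _ hκ0.le, ENNReal.mul_rpow_of_nonneg _ _ hκ1'.le]
          have : (μ D ^ p) ^ κ * (μ D ^ p) ^ (1 - κ) = μ D ^ p := by
            rw [← ENNReal.rpow_add_of_nonneg _ _ hκ0.le hκ1'.le, add_sub_cancel, ENNReal.rpow_one]
          conv_rhs => rw [← this]
          rw [ENNReal.coe_mul, ENNReal.coe_rpow_of_nonneg _ hκ0.le,
            ENNReal.coe_rpow_of_nonneg _ hκ1'.le]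
          ring
      _ ≤ (K ^ κ * K₂ ^ (1 - κ) : ℝ≥0) *
          (expMeasure μ (fun y => v y + p * a y) D * Y ^ (p - 1)) := by
          gcongr
          refine (measure_rpow_le_expMeasure h₁.measurable hp hDm).trans ?_
          gcongr
          rw [e2]
          exact expMeasure_convexComb_le hv.measurable_dual h₂.measurable_dual hκ0.le hκ1'.le
            (by ring) hDm
      _ = _ := by ring
  calc expMeasure μ (fun y => v y + p * a y) B * expMeasure μ v D ^ κ
      ≤ (expMeasure μ v B ^ κ * expMeasure μ u₂ D ^ (1 - κ)) * expMeasure μ v D ^ κ := by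
        gcongr
        rw [e1]
        refine (expMeasure_convexComb_le hvm hum₂ hκ0.le hκ1'.le (by ring) hB).trans ?_
        gcongr
    _ = expMeasure μ v B ^ κ * (expMeasure μ v D ^ κ * expMeasure μ u₂ D ^ (1 - κ)) := by ring
    _ ≤ expMeasure μ v B ^ κ *
        ((K ^ κ * K₂ ^ (1 - κ) : ℝ≥0) * expMeasure μ (fun y => v y + p * a y) D) := by gcongr
    _ = _ := by ring

/-- The maximal function conjugated by `exp a` is bounded on the weighted Morrey space. -/
theorem exists_setLIntegral_conj_ballMaximal_le [OpensMeasurableSpace X]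
    (hμ : IsDoublingOnBalls μ C) (hp : 1 < p)
    (hκ0 : 0 < κ) (hκ1 : κ < 1) (ha : Measurable a) (hv : IsExpAp μ p K v)
    (h₁ : IsExpAp μ p K₁ fun y => v y + p * a y)
    (h₂ : IsExpAp μ p K₂ fun y => v y + p / (1 - κ) * a y) :
    ∃ A : ℝ≥0, ∀ (z : ℕ → X) (r : ℕ → ℝ), (∀ n, 0 < r n) → ∀ (f : X → ℝ≥0∞) (N : ℝ≥0∞),
      Measurable f →
      (∀ x ρ, 0 < ρ → ∫⁻ y in closedBall x ρ, f y ^ p ∂(expMeasure μ v) ≤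
        N * expMeasure μ v (closedBall x ρ) ^ κ) →
      ∀ x R, 0 < R → ∫⁻ y in closedBall x R, (expWeight a y *
          ballMaximal μ z r (fun y => expWeight (fun y => -a y) y * f y) y) ^ p ∂(expMeasure μ v) ≤
        A * N * expMeasure μ v (closedBall x R) ^ κ := by
  have hp1 : 0 < p - 1 := by linarith
  have hp0 : 0 < p := by linarith
  have hvm := hv.measurable
  have hum := h₁.measurable
  set u := fun y => v y + p * a y with hu
  obtain ⟨A₁, hA₁⟩ := h₁.exists_lintegral_ballMaximal_rpow_le hμ hp
  have dv := hv.isDoublingOnBalls hμ hp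
  have du := h₁.isDoublingOnBalls hμ hp
  set Dv := K * C ^ p
  obtain ⟨E, hE⟩ : ∃ E : ℝ≥0, E = K ^ κ * K₂ ^ (1 - κ) := ⟨_, rfl⟩
  refine ⟨2 ^ (p - 1) * (A₁ * (Dv ^ 2) ^ κ + E * K₁ * (C ^ 2) ^ p),
    fun z r hr f N hf hN x₀ R hR => ?_⟩
  set g := fun y => expWeight (fun y => -a y) y * f y with hg
  have hgm : Measurable g := by fun_prop
  -- With u = v + pa the p-th power of the conjugating factor is absorbed in the weight, so only M g
  -- in L^p(e^u) remains.
  have hgp : ∀ y, expWeight u y * g y ^ p = expWeight v y * f y ^ p := by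
    intro y
    rw [hg, ENNReal.mul_rpow_of_nonneg _ _ hp0.le, expWeight_rpow, ← mul_assoc, expWeight_mul]
    congr 2
    ext y; simp only [hu]; ring
  have hgint : ∀ x ρ, 0 < ρ → ∫⁻ y in closedBall x ρ, g y ^ p ∂(expMeasure μ u) ≤
      N * expMeasure μ v (closedBall x ρ) ^ κ := by
    intro x ρ hρ
    refine le_trans (le_of_eq ?_) (hN x ρ hρ)
    rw [setLIntegral_expMeasure hum (by fun_prop) measurableSet_closedBall,
      setLIntegral_expMeasure hvm (by fun_prop) measurableSet_closedBall]
    simp_rw [hgp]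
  have hB0m : MeasurableSet (closedBall x₀ R) := measurableSet_closedBall
  have hSm : MeasurableSet (closedBall x₀ (3 * R)) := measurableSet_closedBall
  set S := closedBall x₀ (3 * R) with hS
  set g₁ := S.indicator g
  set g₂ := Sᶜ.indicator g
  have hg₁m : Measurable g₁ := hgm.indicator hSm
  have hlocal : ∫⁻ y in closedBall x₀ R, ballMaximal μ z r g₁ y ^ p ∂(expMeasure μ u) ≤
      (A₁ * (Dv ^ 2) ^ κ : ℝ≥0) * N * expMeasure μ v (closedBall x₀ R) ^ κ := by
    calc _ ≤ ∫⁻ y, ballMaximal μ z r g₁ y ^ p ∂(expMeasure μ u) := setLIntegral_le_lintegral _ _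
      _ ≤ A₁ * ∫⁻ y, g₁ y ^ p ∂(expMeasure μ u) := hA₁ z r hr g₁ hg₁m
      _ = A₁ * ∫⁻ y in S, g y ^ p ∂(expMeasure μ u) := by
          rw [← lintegral_indicator hSm]
          congr 2
          ext y
          by_cases hy : y ∈ S
          · simp [g₁, hy]
          · simp [g₁, hy, hp0]
      _ ≤ A₁ * (N * expMeasure μ v S ^ κ) := by gcongr; exact hgint _ _ (by positivity)
      _ ≤ A₁ * (N * ((Dv ^ 2 : ℝ≥0) * expMeasure μ v (closedBall x₀ R)) ^ κ) := by
          gcongr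
          rw [ENNReal.coe_pow]
          exact dv.measure_closedBall_le hR 2 (by rw [dist_self]; linarith)
      _ = _ := by
          rw [ENNReal.mul_rpow_of_nonneg _ _ hκ0.le, ENNReal.coe_mul,
            ENNReal.coe_rpow_of_nonneg _ hκ0.le]
          ring
  set U := expMeasure μ u (closedBall x₀ R)
  have hU0 : U ≠ 0 := (du.pos x₀ R hR).ne'
  have hUt : U ≠ ∞ := (du.lt_top x₀ R).ne
  set Q : ℝ≥0∞ := (E * K₁ * (C ^ 2) ^ p : ℝ≥0) * N * expMeasure μ v (closedBall x₀ R) ^ κ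
  have htail : ∀ y ∈ closedBall x₀ R, ballMaximal μ z r g₂ y ^ p ≤ Q * U⁻¹ := by
    intro y hy
    rw [← ENNReal.le_rpow_inv_iff hp0]
    refine ballMaximal_le fun n hn => ?_
    rw [ENNReal.le_rpow_inv_iff hp0]
    by_cases hsub : closedBall (z n) (r n) ⊆ S
    · have : ∫⁻ y in closedBall (z n) (r n), g₂ y ∂μ = 0 :=
        (setLIntegral_congr_fun measurableSet_closedBall fun y hy =>
          indicator_of_notMem (notMem_compl_iff.2 (hsub hy)) g).trans lintegral_zero
      rw [this, mul_zero, ENNReal.zero_rpow_of_pos hp0]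
      exact zero_le
    obtain ⟨w, hw, hwS⟩ := not_subset.1 hsub
    -- A ball that meets B(x₀, R) and leaves B(x₀, 3R) has radius at least R, so its triple contains
    -- B(x₀, R).
    have hRr : R ≤ r n := by
      rw [hS, mem_closedBall, not_le] at hwS
      rw [mem_closedBall] at hw hn hy
      have h1 := dist_triangle w (z n) x₀
      have h2 := dist_triangle (z n) y x₀
      rw [dist_comm (z n) y] at h2
      linarith
    have hsub' : closedBall x₀ R ⊆ closedBall (z n) (3 * r n) := by
      refine closedBall_subset_closedBall' ?_
      rw [mem_closedBall] at hn hy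
      have h1 := dist_triangle x₀ y (z n)
      rw [dist_comm x₀ y] at h1
      linarith
    have hρ : 0 < 3 * r n := by linarith
    have hratio := expMeasure_mul_rpow_le hμ hp hκ0 hκ1 hv h₁ h₂ hB0m hρ hsub'
    rw [← hE] at hratio
    have hDB : μ (closedBall (z n) (3 * r n)) ≤ (C ^ 2 : ℝ≥0) * μ (closedBall (z n) (r n)) := by
      rw [ENNReal.coe_pow]
      exact hμ.measure_closedBall_le (hr n) 2 (by rw [dist_self]; linarith [hr n])
    have hDm : MeasurableSet (closedBall (z n) (3 * r n)) := measurableSet_closedBall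
    have hNp := hgint (z n) _ hρ
    have hAp := h₁.le (z n) _ hρ
    set D := closedBall (z n) (3 * r n)
    have hmB0 := (hμ.pos (z n) _ (hr n)).ne'
    have hmBt := (hμ.lt_top (z n) (r n)).ne
    have hI : ∫⁻ y in closedBall (z n) (r n), g₂ y ∂μ ≤ ∫⁻ y in D, g y ∂μ :=
      (lintegral_mono_set (closedBall_subset_closedBall (by linarith [hr n]))).trans
        (lintegral_mono fun y => indicator_le_self _ _ y)
    -- Each distant ball is estimated on its own: Hölder against e^u, the Morrey bound on D, the
    -- comparison of the two weights on B(x₀, R) and D, and A_p for u on D. The bound does not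
    -- depend on the ball, so no sum over annuli appears.
    have hmain : (∫⁻ y in D, g y ∂μ) ^ p * U ≤ Q * μ (closedBall (z n) (r n)) ^ p := by
      calc (∫⁻ y in D, g y ∂μ) ^ p * U
          ≤ ((∫⁻ y in D, g y ^ p ∂(expMeasure μ u)) *
            expMeasure μ (fun y => -u y / (p - 1)) D ^ (p - 1)) * U := by
            gcongr
            exact setLIntegral_rpow_le_expMeasure hum hp hgm hDm
        _ ≤ ((N * expMeasure μ v D ^ κ) *
            expMeasure μ (fun y => -u y / (p - 1)) D ^ (p - 1)) * U := by gcongr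
        _ = N * expMeasure μ (fun y => -u y / (p - 1)) D ^ (p - 1) *
            (U * expMeasure μ v D ^ κ) := by ring
        _ ≤ N * expMeasure μ (fun y => -u y / (p - 1)) D ^ (p - 1) *
            (E * (expMeasure μ u D * expMeasure μ v (closedBall x₀ R) ^ κ)) :=
            mul_le_mul' le_rfl hratio
        _ = N * E * (expMeasure μ u D * expMeasure μ (fun y => -u y / (p - 1)) D ^ (p - 1)) *
            expMeasure μ v (closedBall x₀ R) ^ κ := by ring
        _ ≤ N * E * (K₁ * ((C ^ 2 : ℝ≥0) * μ (closedBall (z n) (r n))) ^ p) *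
            expMeasure μ v (closedBall x₀ R) ^ κ := by
            refine mul_le_mul' (mul_le_mul' le_rfl (hAp.trans ?_)) le_rfl
            gcongr
        _ = _ := by
            simp only [Q]
            rw [ENNReal.mul_rpow_of_nonneg _ _ hp0.le, ENNReal.coe_mul, ENNReal.coe_mul,
              ENNReal.coe_rpow_of_nonneg _ hp0.le]
            ring
    rw [← div_eq_mul_inv, ENNReal.le_div_iff_mul_le (Or.inl hU0) (Or.inl hUt)]
    have hmp0 : μ (closedBall (z n) (r n)) ^ p ≠ 0 :=
      (ENNReal.rpow_pos_of_nonneg (hμ.pos (z n) _ (hr n)) hp0.le).ne'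
    have hmpt : μ (closedBall (z n) (r n)) ^ p ≠ ∞ := ENNReal.rpow_ne_top_of_nonneg hp0.le hmBt
    calc _ ≤ ((μ (closedBall (z n) (r n)))⁻¹ * ∫⁻ y in D, g y ∂μ) ^ p * U := by gcongr
      _ = ((∫⁻ y in D, g y ∂μ) ^ p * U) * (μ (closedBall (z n) (r n)) ^ p)⁻¹ := by
          rw [ENNReal.mul_rpow_of_nonneg _ _ hp0.le, ENNReal.inv_rpow]; ring
      _ ≤ (Q * μ (closedBall (z n) (r n)) ^ p) * (μ (closedBall (z n) (r n)) ^ p)⁻¹ := by gcongr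
      _ = Q := by rw [mul_assoc, ENNReal.mul_inv_cancel hmp0 hmpt, mul_one]
  calc ∫⁻ y in closedBall x₀ R, (expWeight a y * ballMaximal μ z r g y) ^ p ∂(expMeasure μ v)
      = ∫⁻ y in closedBall x₀ R, ballMaximal μ z r g y ^ p ∂(expMeasure μ u) := by
        have hM : Measurable (ballMaximal μ z r g) := measurable_ballMaximal g
        rw [setLIntegral_expMeasure hvm (by fun_prop) hB0m,
          setLIntegral_expMeasure hum (by fun_prop) hB0m]
        refine lintegral_congr fun y => ?_
        rw [ENNReal.mul_rpow_of_nonneg _ _ hp0.le, expWeight_rpow, ← mul_assoc, expWeight_mul]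
    _ ≤ ∫⁻ y in closedBall x₀ R, 2 ^ (p - 1) * (ballMaximal μ z r g₁ y ^ p + Q * U⁻¹)
          ∂(expMeasure μ u) := by
        refine setLIntegral_mono' hB0m fun y hy => ?_
        have hsplit : g = fun y => g₁ y + g₂ y := by
          ext y
          exact (congrFun (indicator_self_add_compl S g) y).symm
        calc ballMaximal μ z r g y ^ p
            ≤ (ballMaximal μ z r g₁ y + ballMaximal μ z r g₂ y) ^ p := by
              gcongr
              conv_lhs => rw [hsplit]
              exact ballMaximal_add_le g₁ g₂ hg₁m y
          _ ≤ 2 ^ (p - 1) * (ballMaximal μ z r g₁ y ^ p + ballMaximal μ z r g₂ y ^ p) :=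
              ENNReal.rpow_add_le_mul_rpow_add_rpow _ _ hp.le
          _ ≤ _ := by gcongr; exact htail y hy
    _ = 2 ^ (p - 1) * ((∫⁻ y in closedBall x₀ R, ballMaximal μ z r g₁ y ^ p ∂(expMeasure μ u)) +
          Q * U⁻¹ * U) := by
        rw [lintegral_const_mul' _ _ (ENNReal.rpow_ne_top_of_nonneg hp1.le ENNReal.ofNat_ne_top),
          lintegral_add_right _ measurable_const, setLIntegral_const]
    _ ≤ 2 ^ (p - 1) * ((A₁ * (Dv ^ 2) ^ κ : ℝ≥0) * N * expMeasure μ v (closedBall x₀ R) ^ κ + Q) := by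
        rw [mul_assoc Q, ENNReal.inv_mul_cancel hU0 hUt, mul_one]
        gcongr
    _ = _ := by
        simp only [Q]
        push_cast
        rw [ENNReal.coe_rpow_of_nonneg 2 hp1.le, ENNReal.coe_ofNat]
        ring

end


/-! ### From the quasi-metric to a metric. -/

namespace QuasiMetric

variable {X : Type*}

/-- A power of a quasi-metric is equivalent to a metric. -/
theorem exists_pseudoMetricSpace (Q : QuasiMetric X) :
    ∃ (P : PseudoMetricSpace X) (ε : ℝ), 0 < ε ∧ (∀ x y, P.dist x y ≤ Q.d x y ^ ε) ∧
      ∀ x y, Q.d x y ^ ε ≤ 2 * P.dist x y := by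
  obtain ⟨A, hA, htri⟩ := Q.quasi_triangle
  have h3 : (1 : ℝ) < 3 * A ^ 2 := by nlinarith
  have hl : 0 < Real.log (3 * A ^ 2) := Real.log_pos h3
  -- Two applications of the quasi-triangle inequality cost 3A² for chains of three steps. With
  -- (3A²)^ε = 2, the power d^ε satisfies the hypothesis of the chain metrization theorem.
  set ε := Real.log 2 / Real.log (3 * A ^ 2) with hε
  have hε0 : 0 < ε := div_pos (Real.log_pos (by norm_num)) hl
  have hpow : (3 * A ^ 2) ^ ε = 2 := by
    rw [Real.rpow_def_of_pos (by linarith), hε, mul_div_cancel₀ _ hl.ne',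
      Real.exp_log (by norm_num)]
  set δ : X → X → ℝ≥0 := fun x y => ⟨Q.d x y ^ ε, Real.rpow_nonneg (Q.nonneg x y) ε⟩
  have hself : ∀ x, δ x x = 0 := fun x => NNReal.eq <| by
    change Q.d x x ^ ε = 0
    rw [(Q.eq_zero_iff x x).2 rfl, Real.zero_rpow hε0.ne']
  have hcomm : ∀ x y, δ x y = δ y x := fun x y => by ext; simp [δ, Q.symm x y]
  refine ⟨PseudoMetricSpace.ofPreNNDist δ hself hcomm, ε, hε0,
    fun x y => PseudoMetricSpace.dist_ofPreNNDist_le δ hself hcomm x y,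
    fun x y => PseudoMetricSpace.le_two_mul_dist_ofPreNNDist δ hself hcomm (fun x₁ x₂ x₃ x₄ => ?_)
      x y⟩
  rw [← NNReal.coe_le_coe]
  push_cast
  change Q.d x₁ x₄ ^ ε ≤ 2 * max (Q.d x₁ x₂ ^ ε) (max (Q.d x₂ x₃ ^ ε) (Q.d x₃ x₄ ^ ε))
  have n12 := Q.nonneg x₁ x₂
  have n23 := Q.nonneg x₂ x₃
  have n34 := Q.nonneg x₃ x₄
  set M := max (Q.d x₁ x₂) (max (Q.d x₂ x₃) (Q.d x₃ x₄)) with hM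
  have m1 : Q.d x₁ x₂ ≤ M := le_max_left _ _
  have m2 : Q.d x₂ x₃ ≤ M := (le_max_left _ _).trans (le_max_right _ _)
  have m3 : Q.d x₃ x₄ ≤ M := (le_max_right _ _).trans (le_max_right _ _)
  have hM0 : 0 ≤ M := n12.trans m1
  have hMε : M ^ ε = max (Q.d x₁ x₂ ^ ε) (max (Q.d x₂ x₃ ^ ε) (Q.d x₃ x₄ ^ ε)) := by
    rw [hM, (Real.monotoneOn_rpow_Ici_of_exponent_nonneg hε0.le).map_max n12
      (le_max_of_le_left n23),
      (Real.monotoneOn_rpow_Ici_of_exponent_nonneg hε0.le).map_max n23 n34]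
  rw [← hMε, ← hpow, ← Real.mul_rpow (by positivity) hM0]
  refine Real.rpow_le_rpow (Q.nonneg _ _) ?_ hε0.le
  calc Q.d x₁ x₄ ≤ A * (Q.d x₁ x₂ + Q.d x₂ x₄) := htri _ _ _
    _ ≤ A * (Q.d x₁ x₂ + A * (Q.d x₂ x₃ + Q.d x₃ x₄)) := by gcongr; exact htri _ _ _
    _ ≤ A * (M + A * (M + M)) := by gcongr
    _ ≤ 3 * A ^ 2 * M := by nlinarith [mul_nonneg (by linarith : 0 ≤ A) hM0]

theorem ball_mono (Q : QuasiMetric X) (x : X) {r s : ℝ} (h : r ≤ s) : Q.ball x r ⊆ Q.ball x s :=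
  fun _ hy => lt_of_lt_of_le hy h

theorem iUnion_ball_nat (Q : QuasiMetric X) (x : X) : ⋃ n : ℕ, Q.ball x (n + 1) = univ :=
  eq_univ_of_forall fun y => by
    obtain ⟨n, hn⟩ := exists_nat_gt (Q.d x y)
    exact mem_iUnion.2 ⟨n, show Q.d x y < n + 1 by linarith⟩

/-- The distance of `X` is equivalent to the power `ε` of the quasi-metric. -/
structure IsPowerEquiv [PseudoMetricSpace X] (Q : QuasiMetric X) (ε : ℝ) : Prop where
  pos : 0 < ε
  dist_le : ∀ x y : X, dist x y ≤ Q.d x y ^ ε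
  le_dist : ∀ x y : X, Q.d x y ^ ε ≤ 2 * dist x y

namespace IsPowerEquiv

variable [PseudoMetricSpace X] {Q : QuasiMetric X} {ε : ℝ} (h : Q.IsPowerEquiv ε)
include h

theorem ball_subset (x : X) (r : ℝ) : Q.ball x r ⊆ closedBall x (r ^ ε) := fun y hy => by
  rw [mem_closedBall, dist_comm]
  exact (h.dist_le x y).trans (Real.rpow_le_rpow (Q.nonneg _ _) (le_of_lt hy) h.pos.le)

/-- The factor 2 in the equivalence is doubled to 4 because quasi-metric balls are defined by a
strict inequality. -/
theorem closedBall_subset (x : X) {r : ℝ} (hr : 0 < r) :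
    closedBall x (r ^ ε / 4) ⊆ Q.ball x r := fun y hy => by
  rw [mem_closedBall, dist_comm] at hy
  have h1 := h.le_dist x y
  have h2 : 0 < r ^ ε := by positivity
  exact (Real.rpow_lt_rpow_iff (Q.nonneg _ _) hr.le h.pos).1 (by linarith)

theorem rpow_inv_rpow {ρ : ℝ} (hρ : 0 < ρ) : ((4 * ρ) ^ ε⁻¹) ^ ε = 4 * ρ :=
  Real.rpow_inv_rpow (by positivity) h.pos.ne'

theorem closedBall_subset_ball (x : X) {ρ : ℝ} (hρ : 0 < ρ) :
    closedBall x ρ ⊆ Q.ball x ((4 * ρ) ^ ε⁻¹) := by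
  have := h.closedBall_subset x (r := (4 * ρ) ^ ε⁻¹) (by positivity)
  rwa [h.rpow_inv_rpow hρ, mul_div_cancel_left₀ _ (by norm_num : (4 : ℝ) ≠ 0)] at this

theorem topology_eq : (inferInstance : TopologicalSpace X) = Q.topology := by
  ext U
  rw [Metric.isOpen_iff]
  refine forall₂_congr fun x _ => ⟨?_, ?_⟩
  · rintro ⟨δ, hδ, hU⟩
    refine ⟨(δ / 2) ^ ε⁻¹, by positivity, (h.ball_subset _ _).trans (subset_trans ?_ hU)⟩
    rw [Real.rpow_inv_rpow (by positivity) h.pos.ne']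
    exact fun y hy => (mem_closedBall.1 hy).trans_lt (half_lt_self hδ)
  · rintro ⟨τ, hτ, hU⟩
    exact ⟨τ ^ ε / 4, by positivity,
      ball_subset_closedBall.trans ((h.closedBall_subset x hτ).trans hU)⟩

variable [MeasurableSpace X] {ν : Measure X} {D : ℝ≥0} (hν : IsDoublingOnBalls ν D)
include hν

theorem measure_closedBall_le (x : X) {r : ℝ} (hr : 0 < r) :
    ν (closedBall x (r ^ ε)) ≤ (D ^ 2 : ℝ≥0) * ν (Q.ball x r) := by
  rw [ENNReal.coe_pow]
  have hp : 0 < r ^ ε / 4 := by positivity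
  exact (hν.measure_closedBall_le hp 2 (by rw [dist_self]; linarith)).trans
    (mul_le_mul' le_rfl (measure_mono (h.closedBall_subset x hr)))

theorem measure_ball_le (x : X) {ρ : ℝ} (hρ : 0 < ρ) :
    ν (Q.ball x ((4 * ρ) ^ ε⁻¹)) ≤ (D ^ 2 : ℝ≥0) * ν (closedBall x ρ) := by
  rw [ENNReal.coe_pow]
  refine (measure_mono (h.ball_subset x _)).trans (hν.measure_closedBall_le hρ 2 ?_)
  rw [h.rpow_inv_rpow hρ, dist_self]; linarith

end IsPowerEquiv

variable [MeasurableSpace X]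

theorem ae_of_forall_ball (Q : QuasiMetric X) {μ : Measure X} (x : X) {P : X → Prop}
    (h : ∀ n : ℕ, ∀ᵐ y ∂(μ.restrict (Q.ball x (n + 1))), P y) : ∀ᵐ y ∂μ, P y := by
  have := (ae_restrict_iUnion_iff (μ := μ) (fun n : ℕ => Q.ball x (n + 1)) P).2 h
  rwa [Q.iUnion_ball_nat, Measure.restrict_univ] at this

theorem LocallyIntegrableOnBalls.aemeasurable {Q : QuasiMetric X} {μ : Measure X} {f : X → ℝ}
    (hf : Q.LocallyIntegrableOnBalls μ f) : AEMeasurable f μ := by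
  rcases isEmpty_or_nonempty X with hE | ⟨⟨x⟩⟩
  · exact (measurable_of_empty f).aemeasurable
  rw [← Measure.restrict_univ (μ := μ), ← Q.iUnion_ball_nat x, aemeasurable_iUnion_iff]
  exact fun n => (hf x (n + 1) (by positivity)).aestronglyMeasurable.aemeasurable

end QuasiMetric

namespace IsHomogeneousType

variable {X : Type*} [MeasurableSpace X] {Q : QuasiMetric X} {μ : Measure X}
  (hX : IsHomogeneousType Q μ)
include hX

theorem exists_measure_ball_two_pow_mul_le : ∃ C : ℝ≥0, ∀ x r, 0 < r → ∀ n : ℕ,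
    μ (Q.ball x (2 ^ n * r)) ≤ C ^ n * μ (Q.ball x r) := by
  obtain ⟨C, hC⟩ := hX.doubling
  refine ⟨C, fun x r hr n => ?_⟩
  induction n with
  | zero => simp
  | succ n ih =>
    calc μ (Q.ball x (2 ^ (n + 1) * r)) = μ (Q.ball x (2 * (2 ^ n * r))) := by ring_nf
      _ ≤ C * μ (Q.ball x (2 ^ n * r)) := hC _ _ (by positivity)
      _ ≤ C * (C ^ n * μ (Q.ball x r)) := by gcongr
      _ = C ^ (n + 1) * μ (Q.ball x r) := by ring

/-- If one ball were null, doubling would make all concentric balls null, hence μ = 0. -/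
theorem measure_ball_pos (x : X) {r : ℝ} (hr : 0 < r) : 0 < μ (Q.ball x r) := by
  obtain ⟨C, hC⟩ := hX.exists_measure_ball_two_pow_mul_le
  by_contra! h0
  refine hX.ne_zero (Measure.measure_univ_eq_zero.1 ?_)
  rw [← Q.iUnion_ball_nat x, measure_iUnion_null_iff]
  intro n
  obtain ⟨k, hk⟩ := pow_unbounded_of_one_lt (((n : ℝ) + 1) / r) (by norm_num : (1 : ℝ) < 2)
  refine measure_mono_null (Q.ball_mono x ?_) (le_antisymm ((hC x r hr k).trans ?_) zero_le)
  · rw [div_lt_iff₀ hr] at hk; exact hk.le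
  · rw [nonpos_iff_eq_zero.1 h0, mul_zero]

theorem exists_isDoublingOnBalls [PseudoMetricSpace X] {ε : ℝ} (h : Q.IsPowerEquiv ε) :
    ∃ C : ℝ≥0, IsDoublingOnBalls μ C := by
  obtain ⟨C, hC⟩ := hX.exists_measure_ball_two_pow_mul_le
  have hε := h.pos
  -- The closed ball of radius 2ρ lies in the quasi-metric ball of radius (8ρ)^{1/ε}, and that of
  -- radius ρ contains the one of radius ρ^{1/ε}; k doublings bridge the gap.
  obtain ⟨k, hk⟩ := pow_unbounded_of_one_lt ((8 : ℝ) ^ ε⁻¹) (by norm_num : (1 : ℝ) < 2)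
  have hsub : ∀ x ρ, 0 < ρ → Q.ball x (ρ ^ ε⁻¹) ⊆ closedBall x ρ := fun x ρ hρ => by
    have := h.ball_subset x (ρ ^ ε⁻¹)
    rwa [Real.rpow_inv_rpow hρ.le hε.ne'] at this
  refine ⟨C ^ k, fun x ρ hρ => ?_, fun x ρ => ?_, fun x ρ hρ => ?_⟩
  · exact (hX.measure_ball_pos x (by positivity)).trans_le (measure_mono (hsub x ρ hρ))
  · refine (measure_mono ?_).trans_lt (hX.measure_ball_lt_top x ((4 * max ρ 1) ^ ε⁻¹)
      (by positivity))
    exact (closedBall_subset_closedBall (le_max_left _ _)).trans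
      (h.closedBall_subset_ball x (by positivity))
  · rw [ENNReal.coe_pow]
    calc μ (closedBall x (2 * ρ)) ≤ μ (Q.ball x (2 ^ k * ρ ^ ε⁻¹)) := by
          refine measure_mono ((h.closedBall_subset_ball x (by positivity)).trans
            (Q.ball_mono x ?_))
          rw [show 4 * (2 * ρ) = 8 * ρ by ring, Real.mul_rpow (by norm_num) hρ.le]
          gcongr
      _ ≤ C ^ k * μ (Q.ball x (ρ ^ ε⁻¹)) := hC _ _ (by positivity) _
      _ ≤ _ := by gcongr; exact hsub x ρ hρ

end IsHomogeneousType

/-! ### A_p weights on quasi-metric balls. -/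

namespace QuasiMetric.IsApWeight

variable {X : Type*} [MeasurableSpace X] {Q : QuasiMetric X} {μ : Measure X} {p : ℝ} {ω : X → ℝ}

theorem lintegral_mul_rpow_le (hX : IsHomogeneousType Q μ) (hp : 1 < p) (x : X) {r : ℝ}
    (hr : 0 < r) :
    (∫⁻ y in Q.ball x r, ENNReal.ofReal (ω y) ∂μ) *
      (∫⁻ y in Q.ball x r, ENNReal.ofReal (ω y) ^ (1 - p / (p - 1)) ∂μ) ^ (p - 1) ≤
      Q.apConstant μ p ω * μ (Q.ball x r) ^ p := by
  have hp1 : 0 < p - 1 := by linarith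
  have h0 := (hX.measure_ball_pos x hr).ne'
  have ht := (hX.measure_ball_lt_top x r hr).ne
  have h := le_iSup_of_le (f := fun x => ⨆ (r : ℝ) (_ : 0 < r),
    Q.laverageBall μ (fun y => ENNReal.ofReal (ω y)) x r *
      Q.laverageBall μ (fun y => ENNReal.ofReal (ω y) ^ (1 - p / (p - 1))) x r ^ (p - 1)) x
    (le_iSup₂_of_le r hr le_rfl)
  unfold laverageBall at h
  set m := μ (Q.ball x r)
  set I := ∫⁻ y in Q.ball x r, ENNReal.ofReal (ω y) ∂μ
  set J := ∫⁻ y in Q.ball x r, ENNReal.ofReal (ω y) ^ (1 - p / (p - 1)) ∂μ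
  calc I * J ^ (p - 1) = (m⁻¹ * I) * (m⁻¹ * J) ^ (p - 1) * m ^ p := by
        rw [ENNReal.mul_rpow_of_nonneg _ _ hp1.le, ENNReal.inv_rpow, ← ENNReal.rpow_neg]
        have : m⁻¹ * m ^ (-(p - 1)) * m ^ p = 1 := by
          rw [← ENNReal.rpow_neg_one, ← ENNReal.rpow_add _ _ h0 ht, ← ENNReal.rpow_add _ _ h0 ht]
          ring_nf
          exact ENNReal.rpow_zero
        calc _ = (m⁻¹ * m ^ (-(p - 1)) * m ^ p) * (I * J ^ (p - 1)) := by rw [this, one_mul]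
          _ = _ := by ring
    _ ≤ _ := by gcongr; exact h

/-- On a ball where ω has positive integral, the A_p bound makes ω^{1-p'} integrable, so this power,
infinite where ω = 0, is finite almost everywhere. Large concentric balls have this property and
exhaust X. -/
theorem ae_pos (hω : Q.IsApWeight μ p ω) (hX : IsHomogeneousType Q μ) (hp : 1 < p) :
    ∀ᵐ y ∂μ, 0 < ω y := by
  rcases isEmpty_or_nonempty X with hE | ⟨⟨x⟩⟩
  · exact ae_of_all _ fun y => hE.elim y
  have hp1 : 0 < p - 1 := by linarith
  have hm := hω.locallyIntegrable.aemeasurable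
  have hneg : 1 - p / (p - 1) < 0 := by
    have : 1 < p / (p - 1) := by rw [lt_div_iff₀ hp1]; linarith
    linarith
  obtain ⟨k, hk⟩ : ∃ k : ℕ, ∫⁻ y in Q.ball x (k + 1), ENNReal.ofReal (ω y) ∂μ ≠ 0 := by
    by_contra! hcon
    refine hω.not_ae_zero (Q.ae_of_forall_ball x fun n => ?_)
    filter_upwards [(lintegral_eq_zero_iff' hm.ennreal_ofReal.restrict).1 (hcon n)] with y hy
    exact le_antisymm (ENNReal.ofReal_eq_zero.1 hy) (hω.nonneg y)
  refine Q.ae_of_forall_ball x fun n => ?_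
  set R : ℝ := ((max n k : ℕ) : ℝ) + 1
  have hR : 0 < R := by positivity
  have hI : ∫⁻ y in Q.ball x R, ENNReal.ofReal (ω y) ∂μ ≠ 0 := fun h0 => hk <|
    le_antisymm ((lintegral_mono_set (Q.ball_mono x (by simp [R]))).trans h0.le) zero_le
  have hJ : ∫⁻ y in Q.ball x R, ENNReal.ofReal (ω y) ^ (1 - p / (p - 1)) ∂μ ≠ ∞ := by
    intro htop
    have h := lintegral_mul_rpow_le (ω := ω) hX hp x hR
    rw [htop, ENNReal.top_rpow_of_pos hp1, ENNReal.mul_top hI] at h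
    exact (ENNReal.mul_ne_top hω.apConstant_lt_top.ne (ENNReal.rpow_ne_top_of_nonneg (by linarith)
      (hX.measure_ball_lt_top x R hR).ne)) (top_le_iff.1 h)
  have hae := ae_lt_top' (hm.ennreal_ofReal.pow_const _).restrict hJ
  refine ae_restrict_of_ae_restrict_of_subset (Q.ball_mono x (by simp [R]) :
    Q.ball x (n + 1) ⊆ Q.ball x R) ?_
  filter_upwards [hae] with y hy
  refine (hω.nonneg y).lt_of_ne fun h0 => ?_
  rw [← h0, ENNReal.ofReal_zero, ENNReal.zero_rpow_of_neg hneg] at hy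
  exact lt_irrefl _ hy

theorem exists_expWeight_ae_eq (hω : Q.IsApWeight μ p ω) (hX : IsHomogeneousType Q μ)
    (hp : 1 < p) :
    ∃ v : X → ℝ, Measurable v ∧ (fun y => ENNReal.ofReal (ω y)) =ᵐ[μ] expWeight v := by
  have hm := hω.locallyIntegrable.aemeasurable
  refine ⟨fun y => Real.log (hm.mk ω y), Real.measurable_log.comp hm.measurable_mk, ?_⟩
  filter_upwards [hm.ae_eq_mk, hω.ae_pos hX hp] with y h1 h2
  rw [expWeight, ← h1, Real.exp_log h2]

theorem exists_lintegral_expWeight_mul_rpow_le (hω : Q.IsApWeight μ p ω)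
    (hX : IsHomogeneousType Q μ) (hp : 1 < p) {v : X → ℝ}
    (hv : (fun y => ENNReal.ofReal (ω y)) =ᵐ[μ] expWeight v) :
    ∃ K : ℝ≥0, ∀ x r, 0 < r → (∫⁻ y in Q.ball x r, expWeight v y ∂μ) *
      (∫⁻ y in Q.ball x r, expWeight (fun y => -v y / (p - 1)) y ∂μ) ^ (p - 1) ≤
      K * μ (Q.ball x r) ^ p := by
  have hp1 : 0 < p - 1 := by linarith
  refine ⟨(Q.apConstant μ p ω).toNNReal, fun x r hr => ?_⟩
  rw [ENNReal.coe_toNNReal hω.apConstant_lt_top.ne]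
  refine le_trans (le_of_eq ?_) (lintegral_mul_rpow_le (ω := ω) hX hp x hr)
  congr 1
  · exact lintegral_congr_ae (ae_restrict_of_ae hv.symm)
  · congr 1
    refine lintegral_congr_ae (ae_restrict_of_ae ?_)
    filter_upwards [hv] with y hy
    rw [hy, expWeight_rpow]
    congr 1
    ext y
    field_simp
    ring

theorem exists_isExpAp [PseudoMetricSpace X] [OpensMeasurableSpace X] (hω : Q.IsApWeight μ p ω)
    (hX : IsHomogeneousType Q μ) (hp : 1 < p) {v : X → ℝ} (hvm : Measurable v)
    (hv : (fun y => ENNReal.ofReal (ω y)) =ᵐ[μ] expWeight v) {ε : ℝ} (h : Q.IsPowerEquiv ε)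
    {C : ℝ≥0} (hμ : IsDoublingOnBalls μ C) : ∃ K : ℝ≥0, IsExpAp μ p K v := by
  have hp0 : 0 ≤ p := by linarith
  have hp1 : 0 ≤ p - 1 := by linarith
  obtain ⟨K, hK⟩ := hω.exists_lintegral_expWeight_mul_rpow_le hX hp hv
  refine ⟨K * (C ^ 2) ^ p, hvm, fun x ρ hρ => ?_⟩
  rw [expMeasure_apply measurableSet_closedBall, expMeasure_apply measurableSet_closedBall]
  have hsub := h.closedBall_subset_ball x hρ
  calc _ ≤ _ := mul_le_mul' (lintegral_mono_set hsub)
        (ENNReal.rpow_le_rpow (lintegral_mono_set hsub) hp1)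
    _ ≤ K * μ (Q.ball x ((4 * ρ) ^ ε⁻¹)) ^ p := hK x _ (by positivity)
    _ ≤ K * ((C ^ 2 : ℝ≥0) * μ (closedBall x ρ)) ^ p := by
        gcongr; exact h.measure_ball_le hμ x hρ
    _ = _ := by
        rw [ENNReal.mul_rpow_of_nonneg _ _ hp0, ENNReal.coe_mul, ENNReal.coe_rpow_of_nonneg _ hp0,
          mul_assoc]

end QuasiMetric.IsApWeight


/-! ### From BMO to boundedness. -/

section

variable {X : Type*} [MeasurableSpace X]

theorem upperLIntegral_le_lintegral {ν : Measure X} {φ h : X → ℝ≥0∞} (hh : Measurable h)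
    (hle : ∀ᵐ x ∂ν, φ x ≤ h x) : upperLIntegral ν φ ≤ ∫⁻ x, h x ∂ν :=
  (iInf₂_le h hh).trans (iInf_le _ hle)

theorem lintegral_le_upperLIntegral {ν : Measure X} {φ g : X → ℝ≥0∞}
    (hle : ∀ᵐ x ∂ν, g x ≤ φ x) : ∫⁻ x, g x ∂ν ≤ upperLIntegral ν φ :=
  le_iInf₂ fun _ _ => le_iInf fun h => lintegral_mono_ae (by
    filter_upwards [hle, h] with x h1 h2 using h1.trans h2)

/-- There is a sequence of balls such that every ball is contained in one of comparable measure. -/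
theorem IsDoublingOnBalls.exists_seq_closedBall [PseudoMetricSpace X] [OpensMeasurableSpace X]
    [Nonempty X] {μ : Measure X} {C : ℝ≥0} (h : IsDoublingOnBalls μ C) :
    ∃ (z : ℕ → X) (r : ℕ → ℝ), (∀ n, 0 < r n) ∧ ∀ x ρ, 0 < ρ → ∃ n,
      closedBall x ρ ⊆ closedBall (z n) (r n) ∧
        μ (closedBall (z n) (r n)) ≤ C ^ 3 * μ (closedBall x ρ) := by
  have := h.secondCountableTopology
  refine ⟨fun n => TopologicalSpace.denseSeq X n.unpair.1,
    fun n => 2 ^ (Equiv.intEquivNat.symm n.unpair.2 : ℤ), fun n => by positivity,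
    fun x ρ hρ => ?_⟩
  -- With 2^k ≤ ρ < 2^{k+1} and a centre within 2^k of x, the radius 2^{k+2} contains the given
  -- ball, and the chosen ball lies in B(x, 8ρ).
  obtain ⟨k, hk1, hk2⟩ := exists_mem_Ico_zpow (y := (2 : ℝ)) hρ (by norm_num)
  have hk0 : (0 : ℝ) < 2 ^ k := by positivity
  obtain ⟨i, hi⟩ := (TopologicalSpace.denseRange_denseSeq X).exists_dist_lt x hk0
  have e1 : (2 : ℝ) ^ (k + 1) = 2 * 2 ^ k := by rw [zpow_add₀ (by norm_num)]; ring
  have e2 : (2 : ℝ) ^ (k + 2) = 4 * 2 ^ k := by rw [zpow_add₀ (by norm_num)]; norm_num; ring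
  refine ⟨Nat.pair i (Equiv.intEquivNat (k + 2)), ?_⟩
  simp only [Nat.unpair_pair, Equiv.symm_apply_apply]
  rw [e1] at hk2
  rw [e2]
  refine ⟨closedBall_subset_closedBall' (by linarith), h.measure_closedBall_le hρ 3 ?_⟩
  rw [dist_comm]
  linarith

namespace QuasiMetric

variable {Q : QuasiMetric X} {μ : Measure X}

theorem MemBMO.exists_hasUnitMeanOscillation [PseudoMetricSpace X] {ε : ℝ}
    (h : Q.IsPowerEquiv ε) (hX : IsHomogeneousType Q μ) {C : ℝ≥0} (hμ : IsDoublingOnBalls μ C)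
    {b b' : X → ℝ} (hb : Q.MemBMO μ b) (hbb' : b =ᵐ[μ] b') :
    ∃ N : ℝ, 0 < N ∧ ∃ m, HasUnitMeanOscillation μ (fun y => N⁻¹ * b' y) m := by
  -- The factor C² pays for averaging over the quasi-metric ball around a closed ball; the 1 keeps M
  -- positive when b is constant.
  set M : ℝ≥0 := (Q.bmoNorm μ b).toNNReal * C ^ 2 + 1 with hM
  have hM0 : 0 < M := by positivity
  refine ⟨M, by exact_mod_cast hM0,
    fun x ρ => (M : ℝ)⁻¹ * ⨍ y in Q.ball x ((4 * ρ) ^ ε⁻¹), b y ∂μ, fun x ρ hρ => ?_⟩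
  have hr : 0 < (4 * ρ) ^ ε⁻¹ := by positivity
  set r := (4 * ρ) ^ ε⁻¹ with hrdef
  set c := ⨍ y in Q.ball x r, b y ∂μ
  have h0 := (hX.measure_ball_pos x hr).ne'
  have ht := (hX.measure_ball_lt_top x r hr).ne
  have hosc : ∫⁻ y in Q.ball x r, ENNReal.ofReal |b y - c| ∂μ ≤
      (Q.bmoNorm μ b).toNNReal * μ (Q.ball x r) := by
    have hle : Q.laverageBall μ (fun y => ENNReal.ofReal |b y - c|) x r ≤ Q.bmoNorm μ b :=
      le_iSup_of_le (f := fun z => ⨆ (r : ℝ) (_ : 0 < r), Q.laverageBall μ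
        (fun x => ENNReal.ofReal |b x - ⨍ y in Q.ball z r, b y ∂μ|) z r) x
        (le_iSup₂_of_le r hr le_rfl)
    rw [ENNReal.coe_toNNReal hb.2.ne]
    have := mul_le_mul' hle (le_refl (μ (Q.ball x r)))
    rwa [laverageBall, mul_comm (_)⁻¹, mul_assoc, ENNReal.inv_mul_cancel h0 ht, mul_one] at this
  have hpt : ∀ y, ENNReal.ofReal |(M : ℝ)⁻¹ * b' y - (M : ℝ)⁻¹ * c| =
      (M : ℝ≥0∞)⁻¹ * ENNReal.ofReal |b' y - c| := by
    intro y
    rw [← mul_sub, abs_mul, ENNReal.ofReal_mul (abs_nonneg _), abs_of_nonneg (by positivity),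
      ENNReal.ofReal_inv_of_pos (by exact_mod_cast hM0), ENNReal.ofReal_coe_nnreal]
  refine le_of_eq_of_le (lintegral_congr hpt) ?_
  have hMne : (M : ℝ≥0∞) ≠ 0 := by exact_mod_cast hM0.ne'
  rw [lintegral_const_mul' _ _ (ENNReal.inv_ne_top.2 hMne), mul_comm, ← div_eq_mul_inv]
  refine ENNReal.div_le_of_le_mul' ?_
  calc ∫⁻ y in closedBall x ρ, ENNReal.ofReal |b' y - c| ∂μ
      = ∫⁻ y in closedBall x ρ, ENNReal.ofReal |b y - c| ∂μ := by
        refine lintegral_congr_ae (ae_restrict_of_ae ?_)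
        filter_upwards [hbb'] with y hy
        rw [hy]
    _ ≤ ∫⁻ y in Q.ball x r, ENNReal.ofReal |b y - c| ∂μ :=
        lintegral_mono_set (h.closedBall_subset_ball x hρ)
    _ ≤ (Q.bmoNorm μ b).toNNReal * ((C ^ 2 : ℝ≥0) * μ (closedBall x ρ)) :=
        hosc.trans (mul_le_mul' le_rfl (h.measure_ball_le hμ x hρ))
    _ ≤ M * μ (closedBall x ρ) := by
        rw [← mul_assoc]
        gcongr
        rw [hM]; push_cast
        exact le_self_add

/-- The maximal commutator is dominated by conjugates of a maximal function over a sequence of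
balls. -/
theorem maximalCommutator_le [PseudoMetricSpace X] {ε : ℝ}
    (h : Q.IsPowerEquiv ε) (hX : IsHomogeneousType Q μ) {C : ℝ≥0} (hμ : IsDoublingOnBalls μ C)
    {z : ℕ → X} {r : ℕ → ℝ}
    (hr0 : ∀ n, 0 < r n) (hzr : ∀ x ρ, 0 < ρ → ∃ n, closedBall x ρ ⊆ closedBall (z n) (r n) ∧
        μ (closedBall (z n) (r n)) ≤ C ^ 3 * μ (closedBall x ρ))
    {b a : X → ℝ} {t : ℝ} (ht : 0 < t) (ha : Measurable a) (hba : ∀ᵐ y ∂μ, a y = t * b y)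
    {f : X → ℝ} {g : X → ℝ≥0∞} (hg : Measurable g) (hfg : ∀ᵐ y ∂μ, ‖f y‖ₑ = g y) {x : X}
    (hx : a x = t * b x) :
    Q.maximalCommutator μ b f x ≤ C ^ 5 * ENNReal.ofReal t⁻¹ *
      (expWeight a x * ballMaximal μ z r (fun y => expWeight (fun y => -a y) y * g y) x +
        expWeight (fun y => -a y) x *
          ballMaximal μ z r (fun y => expWeight (fun y => -(-a y)) y * g y) x) := by
  refine iSup₂_le fun w s => iSup₂_le fun hs hxw => ?_
  have hsε : 0 < s ^ ε := by positivity
  obtain ⟨n, hsub, hn⟩ := hzr w (s ^ ε) hsε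
  have hQB : Q.ball w s ⊆ closedBall (z n) (r n) := (h.ball_subset w s).trans hsub
  have hxB : x ∈ closedBall (z n) (r n) := hQB hxw
  have hmu : μ (closedBall (z n) (r n)) ≤ C ^ 5 * μ (Q.ball w s) := by
    refine hn.trans ((mul_le_mul' le_rfl (h.measure_closedBall_le hμ w hs)).trans_eq ?_)
    push_cast; ring
  have q0 := (hX.measure_ball_pos w hs).ne'
  have qt := (hX.measure_ball_lt_top w s hs).ne
  have m0 := (hμ.pos (z n) _ (hr0 n)).ne'
  have mt := (hμ.lt_top (z n) (r n)).ne
  have l1 := le_ballMaximal (ν := μ) (z := z) (r := r)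
    (fun y => expWeight (fun y => -a y) y * g y) n hxB
  have l2 := le_ballMaximal (ν := μ) (z := z) (r := r)
    (fun y => expWeight (fun y => -(-a y)) y * g y) n hxB
  set B := closedBall (z n) (r n)
  have hinv : (μ (Q.ball w s))⁻¹ ≤ C ^ 5 * (μ B)⁻¹ := by
    calc (μ (Q.ball w s))⁻¹ = (μ (Q.ball w s))⁻¹ * (μ B * (μ B)⁻¹) := by
          rw [ENNReal.mul_inv_cancel m0 mt, mul_one]
      _ ≤ (μ (Q.ball w s))⁻¹ * ((C ^ 5 * μ (Q.ball w s)) * (μ B)⁻¹) := by gcongr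
      _ = C ^ 5 * ((μ (Q.ball w s))⁻¹ * μ (Q.ball w s)) * (μ B)⁻¹ := by ring
      _ = _ := by rw [ENNReal.inv_mul_cancel q0 qt, mul_one]
  have hpt : ∀ᵐ y ∂μ, ENNReal.ofReal (|b x - b y| * |f y|) ≤ ENNReal.ofReal t⁻¹ *
      (expWeight a x * (expWeight (fun y => -a y) y * g y) +
        expWeight (fun y => -a y) x * (expWeight (fun y => -(-a y)) y * g y)) := by
    filter_upwards [hba, hfg] with y hy1 hy2
    rw [ENNReal.ofReal_mul (abs_nonneg _), ← Real.norm_eq_abs (f y), ofReal_norm, hy2]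
    -- |u| ≤ e^u + e^{-u} with u = t(b(x) - b(y)) separates the variables x and y.
    have h1 : |b x - b y| ≤ t⁻¹ * (Real.exp (a x) * Real.exp (-a y) +
        Real.exp (-a x) * Real.exp (a y)) := by
      rw [← Real.exp_add, ← Real.exp_add, hy1, hx, inv_mul_eq_div, le_div_iff₀ ht]
      have := Real.abs_le_exp_add_exp_neg (t * (b x - b y))
      rw [abs_mul, abs_of_pos ht] at this
      rw [mul_comm]
      refine this.trans (le_of_eq ?_)
      ring_nf
    calc ENNReal.ofReal |b x - b y| * g y
        ≤ ENNReal.ofReal (t⁻¹ * (Real.exp (a x) * Real.exp (-a y) +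
            Real.exp (-a x) * Real.exp (a y))) * g y := by gcongr
      _ = _ := by
        simp only [expWeight, neg_neg]
        rw [ENNReal.ofReal_mul (by positivity), ENNReal.ofReal_add (by positivity) (by positivity),
          ENNReal.ofReal_mul (Real.exp_pos _).le, ENNReal.ofReal_mul (Real.exp_pos _).le]
        ring
  calc Q.laverageBall μ (fun y => ENNReal.ofReal (|b x - b y| * |f y|)) w s
      ≤ (C ^ 5 * (μ B)⁻¹) * ∫⁻ y in B, ENNReal.ofReal t⁻¹ *
          (expWeight a x * (expWeight (fun y => -a y) y * g y) +
            expWeight (fun y => -a y) x * (expWeight (fun y => -(-a y)) y * g y)) ∂μ :=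
        mul_le_mul' hinv ((lintegral_mono_set hQB).trans (lintegral_mono_ae (ae_restrict_of_ae hpt)))
    _ = C ^ 5 * ENNReal.ofReal t⁻¹ *
        (expWeight a x * ((μ B)⁻¹ * ∫⁻ y in B, expWeight (fun y => -a y) y * g y ∂μ) +
          expWeight (fun y => -a y) x *
            ((μ B)⁻¹ * ∫⁻ y in B, expWeight (fun y => -(-a y)) y * g y ∂μ)) := by
        rw [lintegral_const_mul' _ _ ENNReal.ofReal_ne_top, lintegral_add_left (by fun_prop),
          lintegral_const_mul' _ _ (expWeight_ne_top _ _),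
          lintegral_const_mul' _ _ (expWeight_ne_top _ _)]
        ring
    _ ≤ _ := by gcongr

theorem IsApWeight.lintegral_ball_ne_top {p : ℝ} {ω : X → ℝ} (hω : Q.IsApWeight μ p ω) (x : X)
    {r : ℝ} (hr : 0 < r) : ∫⁻ y in Q.ball x r, ENNReal.ofReal (ω y) ∂μ ≠ ∞ :=
  ((hω.locallyIntegrable x r hr).lintegral_lt_top).ne

theorem IsApWeight.lintegral_ball_ne_zero {p : ℝ} {ω : X → ℝ} (hω : Q.IsApWeight μ p ω)
    (hX : IsHomogeneousType Q μ) (hp : 1 < p) (x : X) {r : ℝ} (hr : 0 < r) :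
    ∫⁻ y in Q.ball x r, ENNReal.ofReal (ω y) ∂μ ≠ 0 := by
  intro h0
  rw [lintegral_eq_zero_iff' hω.locallyIntegrable.aemeasurable.ennreal_ofReal.restrict] at h0
  have hfalse : ∀ᵐ y ∂(μ.restrict (Q.ball x r)), False := by
    filter_upwards [h0, ae_restrict_of_ae (hω.ae_pos hX hp)] with y h1 h2
    exact h2.not_ge (ENNReal.ofReal_eq_zero.1 h1)
  rw [ae_iff] at hfalse
  simp only [not_false_eq_true] at hfalse
  have : μ.restrict (Q.ball x r) univ = 0 := hfalse
  rw [Measure.restrict_apply_univ] at this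
  exact (hX.measure_ball_pos x hr).ne' this

theorem IsApWeight.upperLIntegral_le {p κ : ℝ} {ω : X → ℝ} (hω : Q.IsApWeight μ p ω)
    (hX : IsHomogeneousType Q μ) (hp : 1 < p) (hκ : 0 ≤ κ) (g : X → ℝ≥0∞) (x : X) {r : ℝ}
    (hr : 0 < r) :
    upperLIntegral (μ.restrict (Q.ball x r)) (fun y => g y ^ p * ENNReal.ofReal (ω y)) ≤
      Q.morreyNorm μ p κ ω g ^ p * (∫⁻ y in Q.ball x r, ENNReal.ofReal (ω y) ∂μ) ^ κ := by
  have hp0 : 0 < p := by linarith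
  have h : (upperLIntegral (μ.restrict (Q.ball x r)) (fun y => g y ^ p * ENNReal.ofReal (ω y)) /
      (∫⁻ y in Q.ball x r, ENNReal.ofReal (ω y) ∂μ) ^ κ) ^ (1 / p) ≤ Q.morreyNorm μ p κ ω g :=
    le_iSup_of_le (f := fun x => ⨆ (r : ℝ) (_ : 0 < r),
      (upperLIntegral (μ.restrict (Q.ball x r)) (fun y => g y ^ p * ENNReal.ofReal (ω y)) /
        (∫⁻ y in Q.ball x r, ENNReal.ofReal (ω y) ∂μ) ^ κ) ^ (1 / p)) x
      (le_iSup₂_of_le r hr le_rfl)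
  have h2 := ENNReal.rpow_le_rpow h hp0.le
  rw [← ENNReal.rpow_mul, one_div_mul_cancel hp0.ne', ENNReal.rpow_one] at h2
  rwa [ENNReal.div_le_iff_le_mul] at h2
  · exact Or.inl (ENNReal.rpow_pos_of_nonneg (pos_iff_ne_zero.2
      (hω.lintegral_ball_ne_zero hX hp x hr)) hκ).ne'
  · exact Or.inl (ENNReal.rpow_ne_top_of_nonneg hκ (hω.lintegral_ball_ne_top x hr))

theorem IsApWeight.morreyNorm_le {p κ : ℝ} {ω : X → ℝ} (hω : Q.IsApWeight μ p ω)
    (hX : IsHomogeneousType Q μ) (hp : 1 < p) (hκ : 0 ≤ κ) {g : X → ℝ≥0∞} {N : ℝ≥0∞}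
    (h : ∀ x r, 0 < r →
      upperLIntegral (μ.restrict (Q.ball x r)) (fun y => g y ^ p * ENNReal.ofReal (ω y)) ≤
        N * (∫⁻ y in Q.ball x r, ENNReal.ofReal (ω y) ∂μ) ^ κ) :
    Q.morreyNorm μ p κ ω g ≤ N ^ (1 / p) := by
  have hp0 : 0 < p := by linarith
  refine iSup_le fun x => iSup₂_le fun r hr => ENNReal.rpow_le_rpow ?_ (by positivity)
  rw [ENNReal.div_le_iff_le_mul]
  · exact h x r hr
  · exact Or.inl (ENNReal.rpow_pos_of_nonneg (pos_iff_ne_zero.2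
      (hω.lintegral_ball_ne_zero hX hp x hr)) hκ).ne'
  · exact Or.inl (ENNReal.rpow_ne_top_of_nonneg hκ (hω.lintegral_ball_ne_top x hr))

/-- The two conjugated maximal functions give a measurable majorant of the commutator, so its upper
integral is controlled. The rest is passage between quasi-metric and closed balls, at the price of
doubling constants of the weight. -/
theorem MemBMO.exists_morreyNorm_maximalCommutator_le (hX : IsHomogeneousType Q μ) {p κ : ℝ}
    (hp : 1 < p) (hκ0 : 0 < κ) (hκ1 : κ < 1) {ω : X → ℝ} (hω : Q.IsApWeight μ p ω) {b : X → ℝ}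
    (hb : Q.MemBMO μ b) :
    ∃ A : ℝ≥0, ∀ f : X → ℝ, AEMeasurable f μ →
      Q.morreyNorm μ p κ ω (Q.maximalCommutator μ b f) ≤
        A * Q.morreyNorm μ p κ ω fun x => ‖f x‖ₑ := by
  have hp0 : 0 < p := by linarith
  have hp1 : 0 < p - 1 := by linarith
  have hκ' : 0 < 1 - κ := by linarith
  rcases isEmpty_or_nonempty X with hE | hE
  · exact ⟨0, fun f _ => iSup_le fun x => hE.elim x⟩
  obtain ⟨P, ε, hε, hd1, hd2⟩ := Q.exists_pseudoMetricSpace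
  let := P
  have h : Q.IsPowerEquiv ε := ⟨hε, hd1, hd2⟩
  have : BorelSpace X := ⟨by rw [hX.borel, ← h.topology_eq]⟩
  obtain ⟨C, hμ⟩ := hX.exists_isDoublingOnBalls h
  obtain ⟨v, hvm, hvω⟩ := hω.exists_expWeight_ae_eq hX hp
  obtain ⟨K, hv⟩ := hω.exists_isExpAp hX hp hvm hvω h hμ
  have dv := hv.isDoublingOnBalls hμ hp
  set Dv := K * C ^ p
  have hbm := hb.1.aemeasurable
  set b' := hbm.mk b with hb'
  have hb'm : Measurable b' := hbm.measurable_mk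
  obtain ⟨M, hM0, m, hosc⟩ := hb.exists_hasUnitMeanOscillation h hX hμ hbm.ae_eq_mk
  obtain ⟨s₀, hs₀, K', hK'⟩ := hv.exists_add_mul hμ hp (by fun_prop) hosc
  obtain ⟨z, r, hr0, hzr⟩ := hμ.exists_seq_closedBall
  -- The largest multiple of a needed in the exponent is p/(1-κ), with either sign; this t makes it
  -- s₀ times the normalised b.
  set t := s₀ * (1 - κ) / p * M⁻¹ with ht
  have ht0 : 0 < t := by positivity
  set a := fun y => t * b' y with ha
  have ham : Measurable a := by fun_prop
  have hAp : ∀ s : ℝ, |s| ≤ p / (1 - κ) → IsExpAp μ p K' fun y => v y + s * a y := by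
    intro s hs
    have := hK' (s * (s₀ * (1 - κ) / p)) (by
      rw [abs_mul, abs_of_pos (by positivity : 0 < s₀ * (1 - κ) / p)]
      calc |s| * (s₀ * (1 - κ) / p) ≤ p / (1 - κ) * (s₀ * (1 - κ) / p) := by gcongr
        _ = s₀ := by field_simp)
    convert this using 2 with y
    simp only [ha, ht]
    ring
  have hle : p ≤ p / (1 - κ) := by rw [le_div_iff₀ hκ']; nlinarith
  have habs : |p / (1 - κ)| = p / (1 - κ) := abs_of_pos (by positivity)
  have hneg : ∀ s : ℝ, (fun y => v y + s * -a y) = fun y => v y + (-s) * a y := fun s => by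
    ext y; ring
  obtain ⟨A₁, hA₁⟩ := exists_setLIntegral_conj_ballMaximal_le hμ hp hκ0 hκ1 ham hv
    (hAp p (by rwa [abs_of_pos hp0])) (hAp _ habs.le)
  obtain ⟨A₂, hA₂⟩ := exists_setLIntegral_conj_ballMaximal_le (a := fun y => -a y) hμ hp hκ0 hκ1
    ham.neg hv (by rw [hneg]; exact hAp (-p) (by rwa [abs_neg, abs_of_pos hp0]))
    (by rw [hneg]; exact hAp _ (by rw [abs_neg, habs]))
  set E : ℝ≥0 := C ^ 5 * t⁻¹.toNNReal with hE
  set F : ℝ≥0 := E ^ p * (2 ^ (p - 1) * (A₁ + A₂)) * (Dv ^ 2) ^ κ * (Dv ^ 2) ^ κ with hF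
  refine ⟨F ^ (1 / p), fun f hf => ?_⟩
  set N₀ := Q.morreyNorm μ p κ ω fun x => ‖f x‖ₑ with hN₀
  set g := fun y => ‖hf.mk f y‖ₑ with hg
  have hgm : Measurable g := hf.measurable_mk.enorm
  have hfg : ∀ᵐ y ∂μ, ‖f y‖ₑ = g y := by
    filter_upwards [hf.ae_eq_mk] with y hy
    rw [hg, hy]
  have hW : ∀ x r, ∫⁻ y in Q.ball x r, ENNReal.ofReal (ω y) ∂μ = expMeasure μ v (Q.ball x r) := by
    intro x r
    rw [lintegral_congr_ae (ae_restrict_of_ae hvω), expMeasure,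
      withDensity_apply₀ _ (hX.nullMeasurableSet_ball x r)]
  set N := N₀ ^ p * (Dv ^ 2 : ℝ≥0) ^ κ with hN
  have hball : ∀ x ρ, 0 < ρ → ∫⁻ y in closedBall x ρ, g y ^ p ∂(expMeasure μ v) ≤
      N * expMeasure μ v (closedBall x ρ) ^ κ := by
    intro x ρ hρ
    have hs : 0 < (4 * ρ) ^ ε⁻¹ := by positivity
    set s := (4 * ρ) ^ ε⁻¹ with hsdef
    calc ∫⁻ y in closedBall x ρ, g y ^ p ∂(expMeasure μ v)
        = ∫⁻ y in closedBall x ρ, ‖f y‖ₑ ^ p * ENNReal.ofReal (ω y) ∂μ := by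
          rw [setLIntegral_expMeasure hvm (by fun_prop) measurableSet_closedBall]
          refine lintegral_congr_ae (ae_restrict_of_ae ?_)
          filter_upwards [hfg, hvω] with y h1 h2
          rw [h1, h2, mul_comm]
      _ ≤ ∫⁻ y in Q.ball x s, ‖f y‖ₑ ^ p * ENNReal.ofReal (ω y) ∂μ :=
          lintegral_mono_set (h.closedBall_subset_ball x hρ)
      _ ≤ upperLIntegral (μ.restrict (Q.ball x s)) fun y => ‖f y‖ₑ ^ p * ENNReal.ofReal (ω y) :=
          lintegral_le_upperLIntegral (ae_of_all _ fun _ => le_rfl)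
      _ ≤ N₀ ^ p * (expMeasure μ v (Q.ball x s)) ^ κ := by
          rw [← hW]
          exact hω.upperLIntegral_le hX hp hκ0.le _ x hs
      _ ≤ N₀ ^ p * ((Dv ^ 2 : ℝ≥0) * expMeasure μ v (closedBall x ρ)) ^ κ := by
          gcongr
          exact h.measure_ball_le dv x hρ
      _ = _ := by rw [ENNReal.mul_rpow_of_nonneg _ _ hκ0.le, hN]; ring
  have hfin : (F : ℝ≥0∞) * N₀ ^ p = E ^ p * (2 ^ (p - 1) * (A₁ + A₂)) * N * (Dv ^ 2 : ℝ≥0) ^ κ := by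
    rw [hF, hN]
    push_cast
    rw [ENNReal.coe_rpow_of_nonneg _ hp0.le, ENNReal.coe_rpow_of_nonneg _ hp1.le,
      ENNReal.coe_rpow_of_nonneg _ hκ0.le, ENNReal.coe_ofNat]
    push_cast
    ring
  have hroot : (F ^ (1 / p) : ℝ≥0) * N₀ = (F * N₀ ^ p) ^ (1 / p) := by
    rw [ENNReal.mul_rpow_of_nonneg _ _ (by positivity), ← ENNReal.rpow_mul,
      mul_one_div_cancel hp0.ne', ENNReal.rpow_one, ENNReal.coe_rpow_of_nonneg _ (by positivity)]
  rw [hroot]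
  refine hω.morreyNorm_le hX hp hκ0.le fun x s hs => ?_
  set S₁ := fun y => expWeight a y *
    ballMaximal μ z r (fun y => expWeight (fun y => -a y) y * g y) y with hS₁
  set S₂ := fun y => expWeight (fun y => -a y) y *
    ballMaximal μ z r (fun y => expWeight (fun y => -(-a y)) y * g y) y with hS₂
  have hS₁m : Measurable S₁ := by
    have : Measurable (ballMaximal μ z r fun y => expWeight (fun y => -a y) y * g y) :=
      measurable_ballMaximal _
    fun_prop
  have hS₂m : Measurable S₂ := by
    have : Measurable (ballMaximal μ z r fun y => expWeight (fun y => -(-a y)) y * g y) :=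
      measurable_ballMaximal _
    fun_prop
  have hba : ∀ᵐ y ∂μ, a y = t * b y := by
    filter_upwards [hbm.ae_eq_mk] with y hy
    rw [ha, hy]
  have hR : 0 < s ^ ε := by positivity
  calc upperLIntegral (μ.restrict (Q.ball x s))
        (fun y => Q.maximalCommutator μ b f y ^ p * ENNReal.ofReal (ω y))
      ≤ ∫⁻ y in Q.ball x s, expWeight v y * (E * (S₁ y + S₂ y)) ^ p ∂μ := by
        refine upperLIntegral_le_lintegral (by fun_prop) (ae_restrict_of_ae ?_)
        filter_upwards [hba, hvω] with y hy1 hy2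
        rw [hy2, mul_comm]
        gcongr
        refine (maximalCommutator_le h hX hμ hr0 hzr ht0 ham hba hgm hfg hy1).trans (le_of_eq ?_)
        rw [hE]
        push_cast
        rfl
    _ ≤ ∫⁻ y in closedBall x (s ^ ε), expWeight v y * (E * (S₁ y + S₂ y)) ^ p ∂μ :=
        lintegral_mono_set (h.ball_subset x s)
    _ ≤ ∫⁻ y in closedBall x (s ^ ε), E ^ p * (2 ^ (p - 1) * (S₁ y ^ p + S₂ y ^ p))
          ∂(expMeasure μ v) := by
        rw [← setLIntegral_expMeasure hvm (by fun_prop) measurableSet_closedBall]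
        refine lintegral_mono fun y => ?_
        rw [ENNReal.mul_rpow_of_nonneg _ _ hp0.le]
        gcongr
        exact ENNReal.rpow_add_le_mul_rpow_add_rpow _ _ hp.le
    _ = E ^ p * (2 ^ (p - 1) * (∫⁻ y in closedBall x (s ^ ε), S₁ y ^ p ∂(expMeasure μ v) +
          ∫⁻ y in closedBall x (s ^ ε), S₂ y ^ p ∂(expMeasure μ v))) := by
        rw [lintegral_const_mul' _ _ (ENNReal.rpow_ne_top_of_nonneg hp0.le ENNReal.coe_ne_top),
          lintegral_const_mul' _ _ (ENNReal.rpow_ne_top_of_nonneg hp1.le ENNReal.ofNat_ne_top),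
          lintegral_add_left (by fun_prop)]
    _ ≤ E ^ p * (2 ^ (p - 1) * (A₁ * N * expMeasure μ v (closedBall x (s ^ ε)) ^ κ +
          A₂ * N * expMeasure μ v (closedBall x (s ^ ε)) ^ κ)) := by
        gcongr
        · exact hA₁ z r hr0 g N hgm hball x _ hR
        · exact hA₂ z r hr0 g N hgm hball x _ hR
    _ = E ^ p * (2 ^ (p - 1) * (A₁ + A₂)) * N * expMeasure μ v (closedBall x (s ^ ε)) ^ κ := by
        ring
    _ ≤ E ^ p * (2 ^ (p - 1) * (A₁ + A₂)) * N *
          ((Dv ^ 2 : ℝ≥0) * expMeasure μ v (Q.ball x s)) ^ κ := by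
        gcongr
        exact h.measure_closedBall_le dv x hs
    _ = F * N₀ ^ p * (∫⁻ y in Q.ball x s, ENNReal.ofReal (ω y) ∂μ) ^ κ := by
        rw [hfin, hW, ENNReal.mul_rpow_of_nonneg _ _ hκ0.le]
        ring

end QuasiMetric

end


/-! ### Measurability of the commutator, and necessity of BMO. -/

namespace QuasiMetric

variable {X : Type*} [MeasurableSpace X] {Q : QuasiMetric X} {μ : Measure X}

/-- By Fatou the integral is lower semicontinuous in c. -/
theorem isOpen_lt_lintegral_abs_sub_mul {ν : Measure X} {b f : X → ℝ} (hb : AEMeasurable b ν)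
    (hf : AEMeasurable f ν) (l : ℝ≥0∞) :
    IsOpen {c : ℝ | l < ∫⁻ y, ENNReal.ofReal (|c - b y| * |f y|) ∂ν} := by
  rw [← isClosed_compl_iff]
  refine IsSeqClosed.isClosed fun c c₀ hc hlim => ?_
  simp only [mem_compl_iff, mem_ofPred_eq, not_lt] at hc ⊢
  calc ∫⁻ y, ENNReal.ofReal (|c₀ - b y| * |f y|) ∂ν
      = ∫⁻ y, liminf (fun n => ENNReal.ofReal (|c n - b y| * |f y|)) atTop ∂ν := by
        refine lintegral_congr fun y => (Tendsto.liminf_eq ?_).symm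
        have hcont : Continuous fun c : ℝ => ENNReal.ofReal (|c - b y| * |f y|) :=
          ENNReal.continuous_ofReal.comp (by fun_prop)
        exact (hcont.tendsto c₀).comp hlim
    _ ≤ liminf (fun n => ∫⁻ y, ENNReal.ofReal (|c n - b y| * |f y|) ∂ν) atTop :=
        lintegral_liminf_le' fun n => by fun_prop
    _ ≤ l := by
        refine (liminf_le_liminf (Eventually.of_forall hc)).trans ?_
        simp

/-- If the quasi-metric balls are open, then the maximal commutator is measurable. -/
theorem aemeasurable_maximalCommutator (hX : IsHomogeneousType Q μ)
    (hopen : ∀ x r, @IsOpen X Q.topology (Q.ball x r)) {b f : X → ℝ} (hb : AEMeasurable b μ)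
    (hf : AEMeasurable f μ) : AEMeasurable (Q.maximalCommutator μ b f) μ := by
  set φ : X → ℝ → ℝ → ℝ≥0∞ := fun z r c =>
    Q.laverageBall μ (fun y => ENNReal.ofReal (|c - b y| * |f y|)) z r with hφ
  refine ⟨fun x => ⨆ (z : X) (r : ℝ) (_ : 0 < r) (_ : x ∈ Q.ball z r), φ z r (hb.mk b x), ?_, ?_⟩
  swap
  · filter_upwards [hb.ae_eq_mk] with x hx
    simp only [maximalCommutator, hφ, ← hx]
  refine measurable_of_Ioi fun l => ?_
  have hU : ∀ z r, 0 < r → IsOpen {c | l < φ z r c} := by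
    intro z r hr
    have h0 := (hX.measure_ball_pos z hr).ne'
    have ht := (hX.measure_ball_lt_top z r hr).ne
    convert isOpen_lt_lintegral_abs_sub_mul (ν := μ.restrict (Q.ball z r)) hb.restrict
      hf.restrict (l * μ (Q.ball z r)) using 3 with c
    simp only [hφ, laverageBall]
    rw [mul_comm, ← div_eq_mul_inv,
      ENNReal.lt_div_iff_mul_lt (Or.inl h0) (Or.inl ht)]
  -- The point x enters through membership in a ball and through the value b(x). A countable basis
  -- of ℝ separates the two: for each basic V the admissible balls have an open union, however many
  -- they are.
  have hset : (fun x => ⨆ (z : X) (r : ℝ) (_ : 0 < r) (_ : x ∈ Q.ball z r),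
      φ z r (hb.mk b x)) ⁻¹' Ioi l = ⋃ V ∈ TopologicalSpace.countableBasis ℝ,
        (⋃ (z : X) (r : ℝ) (_ : 0 < r ∧ V ⊆ {c | l < φ z r c}), Q.ball z r) ∩ hb.mk b ⁻¹' V := by
    ext x
    simp only [mem_preimage, mem_Ioi, lt_iSup_iff, mem_iUnion, mem_inter_iff, exists_prop]
    constructor
    · rintro ⟨z, r, hr, hx, hl⟩
      obtain ⟨V, hV, hxV, hVU⟩ := (TopologicalSpace.isBasis_countableBasis ℝ).exists_subset_of_mem_open
        (show hb.mk b x ∈ {c | l < φ z r c} from hl) (hU z r hr)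
      exact ⟨V, hV, ⟨z, r, ⟨hr, hVU⟩, hx⟩, hxV⟩
    · rintro ⟨V, -, ⟨z, r, ⟨hr, hVU⟩, hx⟩, hxV⟩
      exact ⟨z, r, hr, hx, hVU hxV⟩
  rw [hset]
  refine MeasurableSet.biUnion (TopologicalSpace.countable_countableBasis ℝ) fun V hV =>
    MeasurableSet.inter ?_ (hb.measurable_mk
      (TopologicalSpace.isOpen_of_mem_countableBasis hV).measurableSet)
  rw [hX.borel]
  let := Q.topology
  refine MeasurableSpace.measurableSet_generateFrom ?_
  exact isOpen_iUnion fun z => isOpen_iUnion fun r => isOpen_iUnion fun _ => hopen z r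

/-- The weight of the intersection of two balls is at most that of either, so I = I^{1-κ} I^κ is
bounded using the fixed ball for the first factor and the varying one for the second. -/
theorem memMorrey_indicator_ball (hX : IsHomogeneousType Q μ) {p κ : ℝ} (hp : 1 < p)
    (hκ0 : 0 < κ) (hκ1 : κ < 1) {ω : X → ℝ} (hω : Q.IsApWeight μ p ω) (z : X) {r : ℝ} (hr : 0 < r) :
    Q.MemMorrey μ p κ ω ((Q.ball z r).indicator fun _ => 1) ∧
      Q.morreyNorm μ p κ ω (fun x => ‖(Q.ball z r).indicator (fun _ => (1 : ℝ)) x‖ₑ) ≤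
        ((∫⁻ y in Q.ball z r, ENNReal.ofReal (ω y) ∂μ) ^ (1 - κ)) ^ (1 / p) := by
  have hp0 : 0 < p := by linarith
  have hκ' : 0 < 1 - κ := by linarith
  have hm : AEMeasurable ((Q.ball z r).indicator fun _ => (1 : ℝ)) μ :=
    aemeasurable_const.indicator₀ (hX.nullMeasurableSet_ball z r)
  have hωm := hω.locallyIntegrable.aemeasurable.ennreal_ofReal
  have hnorm : Q.morreyNorm μ p κ ω
      (fun x => ‖(Q.ball z r).indicator (fun _ => (1 : ℝ)) x‖ₑ) ≤
        ((∫⁻ y in Q.ball z r, ENNReal.ofReal (ω y) ∂μ) ^ (1 - κ)) ^ (1 / p) := by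
    refine hω.morreyNorm_le hX hp hκ0.le fun x s hs => ?_
    have hpt : ∀ y, ‖(Q.ball z r).indicator (fun _ => (1 : ℝ)) y‖ₑ ^ p * ENNReal.ofReal (ω y) =
        (Q.ball z r).indicator (fun y => ENNReal.ofReal (ω y)) y := by
      intro y
      by_cases hy : y ∈ Q.ball z r <;> simp [hy, hp0]
    simp_rw [hpt]
    rw [upperLIntegral_eq_lintegral _ _ (hωm.indicator₀ (hX.nullMeasurableSet_ball z r)).restrict]
    set I := ∫⁻ y in Q.ball x s, (Q.ball z r).indicator (fun y => ENNReal.ofReal (ω y)) y ∂μ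
    have h1 : I ≤ ∫⁻ y in Q.ball x s, ENNReal.ofReal (ω y) ∂μ :=
      lintegral_mono fun y => indicator_le_self _ _ y
    have h2 : I ≤ ∫⁻ y in Q.ball z r, ENNReal.ofReal (ω y) ∂μ := by
      rw [← lintegral_indicator₀ (hX.nullMeasurableSet_ball z r)]
      exact setLIntegral_le_lintegral _ _
    calc I = I ^ (1 - κ) * I ^ κ := by
          rw [← ENNReal.rpow_add_of_nonneg _ _ hκ'.le hκ0.le, sub_add_cancel, ENNReal.rpow_one]
      _ ≤ _ := by gcongr
  refine ⟨⟨hm, hnorm.trans_lt (lt_top_iff_ne_top.2 ?_)⟩, hnorm⟩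
  exact ENNReal.rpow_ne_top_of_nonneg (by positivity)
    (ENNReal.rpow_ne_top_of_nonneg hκ'.le (hω.lintegral_ball_ne_top z hr))

/-- On a ball, the maximal commutator of its indicator dominates the oscillation of `b`. -/
theorem ofReal_abs_sub_setAverage_le_maximalCommutator (hX : IsHomogeneousType Q μ) {b : X → ℝ}
    (hb : Q.LocallyIntegrableOnBalls μ b) {z x : X} {r : ℝ} (hr : 0 < r) (hx : x ∈ Q.ball z r) :
    ENNReal.ofReal |b x - ⨍ y in Q.ball z r, b y ∂μ| ≤
      Q.maximalCommutator μ b ((Q.ball z r).indicator fun _ => 1) x := by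
  have h0 := (hX.measure_ball_pos z hr).ne'
  have ht := (hX.measure_ball_lt_top z r hr).ne
  refine le_trans ?_ (le_iSup₂_of_le z r (le_iSup₂_of_le hr hx le_rfl))
  have hint : ∫⁻ y in Q.ball z r, ENNReal.ofReal (|b x - b y| *
      |(Q.ball z r).indicator (fun _ => (1 : ℝ)) y|) ∂μ =
      ∫⁻ y in Q.ball z r, ‖b x - b y‖ₑ ∂μ := by
    refine lintegral_congr_ae ?_
    filter_upwards [ae_restrict_mem₀ (hX.nullMeasurableSet_ball z r)] with y hy
    rw [indicator_of_mem hy, abs_one, mul_one, ← Real.norm_eq_abs, ofReal_norm]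
  rw [laverageBall, hint, mul_comm, ← div_eq_mul_inv, ENNReal.le_div_iff_mul_le (Or.inl h0)
    (Or.inl ht)]
  have hreal : μ.real (Q.ball z r) * (b x - ⨍ y in Q.ball z r, b y ∂μ) =
      ∫ y in Q.ball z r, (b x - b y) ∂μ := by
    have hne : μ.real (Q.ball z r) ≠ 0 := ENNReal.toReal_ne_zero.2 ⟨h0, ht⟩
    have hfin : IsFiniteMeasure (μ.restrict (Q.ball z r)) :=
      ⟨by rw [Measure.restrict_apply_univ]; exact ht.lt_top⟩
    rw [integral_sub (integrable_const _) (hb z r hr), setIntegral_const, setAverage_eq,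
      smul_eq_mul, smul_eq_mul, mul_sub, mul_inv_cancel_left₀ hne]
  calc ENNReal.ofReal |b x - ⨍ y in Q.ball z r, b y ∂μ| * μ (Q.ball z r)
      = ‖μ.real (Q.ball z r) * (b x - ⨍ y in Q.ball z r, b y ∂μ)‖ₑ := by
        rw [enorm_mul, mul_comm, ← Real.norm_eq_abs, ofReal_norm,
          Real.enorm_eq_ofReal measureReal_nonneg, ofReal_measureReal ht]
    _ ≤ _ := by rw [hreal]; exact enorm_integral_le_lintegral_enorm _

theorem IsBoundedOnMorrey.memBMO (hX : IsHomogeneousType Q μ) {p κ : ℝ} (hp : 1 < p)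
    (hκ0 : 0 < κ) (hκ1 : κ < 1) {ω : X → ℝ} (hω : Q.IsApWeight μ p ω) {b : X → ℝ}
    (hb : Q.LocallyIntegrableOnBalls μ b)
    (h : Q.IsBoundedOnMorrey μ p κ ω (Q.maximalCommutator μ b)) : Q.MemBMO μ b := by
  have hp0 : 0 < p := by linarith
  have hκ' : 0 < 1 - κ := by linarith
  obtain ⟨A, hA⟩ := h
  obtain ⟨v, hvm, hvω⟩ := hω.exists_expWeight_ae_eq hX hp
  obtain ⟨K, hK⟩ := hω.exists_lintegral_expWeight_mul_rpow_le hX hp hvω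
  refine ⟨hb, lt_of_le_of_lt (iSup_le fun z => iSup₂_le fun r hr => ?_)
    (ENNReal.coe_lt_top (r := (A ^ p * K) ^ (1 / p)))⟩
  have h0 := (hX.measure_ball_pos z hr).ne'
  have ht := (hX.measure_ball_lt_top z r hr).ne
  obtain ⟨hmem, hnorm⟩ := memMorrey_indicator_ball hX hp hκ0 hκ1 hω z hr
  have hbd := (hA _ hmem).2.trans (mul_le_mul' le_rfl hnorm)
  have hup := hω.upperLIntegral_le hX hp hκ0.le
    (Q.maximalCommutator μ b ((Q.ball z r).indicator fun _ => 1)) z hr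
  have hKB := hK z r hr
  set B := Q.ball z r
  set c := ⨍ y in B, b y ∂μ
  have hbm := hb.aemeasurable
  set g := fun y => ENNReal.ofReal |hbm.mk b y - c|
  have hgm : Measurable g := by
    have := hbm.measurable_mk
    fun_prop
  have hgb : ∀ᵐ y ∂μ, ENNReal.ofReal |b y - c| = g y := by
    filter_upwards [hbm.ae_eq_mk] with y hy
    rw [hy]
  set W := ∫⁻ y in B, ENNReal.ofReal (ω y) ∂μ with hWdef
  have hWv : W = ∫⁻ y in B, expWeight v y ∂μ := lintegral_congr_ae (ae_restrict_of_ae hvω)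
  have hosc : ∫⁻ y in B, expWeight v y * g y ^ p ∂μ ≤ A ^ p * W := by
    calc ∫⁻ y in B, expWeight v y * g y ^ p ∂μ
        ≤ upperLIntegral (μ.restrict B) (fun y =>
          Q.maximalCommutator μ b (B.indicator fun _ => 1) y ^ p * ENNReal.ofReal (ω y)) := by
          refine lintegral_le_upperLIntegral ?_
          filter_upwards [ae_restrict_mem₀ (hX.nullMeasurableSet_ball z r),
            ae_restrict_of_ae hgb, ae_restrict_of_ae hvω] with y h1 h2 h3
          rw [h3, mul_comm, ← h2]
          gcongr
          exact ofReal_abs_sub_setAverage_le_maximalCommutator hX hb hr h1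
      _ ≤ (A * (W ^ (1 - κ)) ^ (1 / p)) ^ p * W ^ κ := hup.trans (by gcongr)
      _ = A ^ p * W := by
          rw [ENNReal.mul_rpow_of_nonneg _ _ hp0.le, ← ENNReal.rpow_mul (W ^ (1 - κ)),
            one_div_mul_cancel hp0.ne', ENNReal.rpow_one, mul_assoc,
            ← ENNReal.rpow_add_of_nonneg _ _ hκ'.le hκ0.le, sub_add_cancel, ENNReal.rpow_one]
  -- B is only null-measurable, so Hölder is applied on the whole space to the restricted measure.
  have hH := setLIntegral_rpow_le_expMeasure (μ := μ.restrict B) hvm hp hgm MeasurableSet.univ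
  rw [setLIntegral_expMeasure hvm (by fun_prop) MeasurableSet.univ,
    expMeasure_apply MeasurableSet.univ, Measure.restrict_univ] at hH
  have hI : (∫⁻ y in B, g y ∂μ) ^ p ≤ (A ^ p * K : ℝ≥0) * μ B ^ p := by
    calc (∫⁻ y in B, g y ∂μ) ^ p ≤ _ := hH
      _ ≤ (A ^ p * W) * _ := by gcongr
      _ = A ^ p * ((∫⁻ y in B, expWeight v y ∂μ) *
          (∫⁻ y in B, expWeight (fun y => -v y / (p - 1)) y ∂μ) ^ (p - 1)) := by
          rw [hWv, mul_assoc]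
      _ ≤ A ^ p * (K * μ B ^ p) := by gcongr
      _ = _ := by
          rw [ENNReal.coe_mul, ENNReal.coe_rpow_of_nonneg _ hp0.le, mul_assoc]
  rw [laverageBall, lintegral_congr_ae (ae_restrict_of_ae hgb), mul_comm, ← div_eq_mul_inv]
  refine ENNReal.div_le_of_le_mul ?_
  rw [← ENNReal.rpow_le_rpow_iff hp0, ENNReal.mul_rpow_of_nonneg _ _ hp0.le,
    ENNReal.coe_rpow_of_nonneg _ (by positivity), ← ENNReal.rpow_mul, one_div_mul_cancel hp0.ne',
    ENNReal.rpow_one]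
  exact hI

end QuasiMetric

end

theorem theorem1p2 {X : Type*} [MeasurableSpace X] (Q : QuasiMetric X) (μ : Measure X)
    (hX : IsHomogeneousType Q μ) (hinf : μ Set.univ = ∞) (hpt : ∀ x : X, μ {x} = 0)
    (p κ : ℝ) (hp : 1 < p) (hκ0 : 0 < κ) (hκ1 : κ < 1)
    (ω : X → ℝ) (hω : Q.IsApWeight μ p ω)
    (b : X → ℝ) (hb : Q.LocallyIntegrableOnBalls μ b) :
    Q.IsBoundedOnMorrey μ p κ ω (Q.maximalCommutator μ b) ↔ Q.MemBMO μ b := by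
  refine ⟨fun h => h.memBMO hX hp hκ0 hκ1 hω hb, fun h => ?_⟩
  obtain ⟨A, hA⟩ := h.exists_morreyNorm_maximalCommutator_le hX hp hκ0 hκ1 hω
  exact ⟨A, fun f hf => ⟨fun hopen => QuasiMetric.aemeasurable_maximalCommutator hX hopen
    hb.aemeasurable hf.1, hA f hf.1⟩⟩
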